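/- **Setting.** Work in $\mathbb R^2$ with the orthonormal basis $e_1,e_2$. A *cell* is a trapezium $ABCD$ (vertices in cyclic order) whose bases $AB\parallel CD$ are parallel to $e_1$, with $\langle AD,e_2\rangle>0$ and $|CD|\le|AB|$. It is *compressible* if $|CD|<|AB|$ and *incompressible* if $|CD|=|AB|$. Its vector field $V_{ABCD}$ vanishes outside $\operatorname{conv}(ABCD)$ and on $\operatorname{conv}(ABCD)$ is $$\frac{AD}{\langle AD,e_2\rangle}\ \text{ (incompressible)},\qquad \frac{x-P}{\langle x-P,e_2\rangle}\ \text{ (compressible)},$$ where $P$ is the intersection of the lines $AD$ and $BC$. With a finite collection $\mathcal C_1,\dots,\mathcal C_N$ of cells we associate the field $$\sum_i\frac{\mathbf 1_{\operatorname{conv}\mathcal C_i}}{\max(1,\sum_j\mathbf 1_{\operatorname{conv}\mathcal C_j})}V_{\mathcal C_i}.$$ *Patch.* For a compressible cell $ABCD$ let $E,F,G$ divide $DC$, and $L,M,N$ divide $AB$, into four equal parts (in this order). Let $U,V$ be the midpoints of $AD$ and $BC$, and let $X,Y,Z\in UV$ be the consecutive points with $|UX|=|AL|$, $|XY|=|EF|$,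 $|YZ|=|MN|$, $|ZV|=|GC|$. Patch replaces $ABCD$ by the *lower* incompressible cells $ALXU$, $MNZY$, the *upper* incompressible cells $XYFE$, $ZVCG$, and the compressible cells $UXED$, $LMYX$, $YZGF$, $NBVZ$. Incompressible cells are left unchanged (and keep the label lower or upper). Fix a compressible cell $ABCD$. Let $h=\operatorname{dist}(AB,CD)$, let $\Omega$ be the interior of $\operatorname{conv}(ABCD)$, let $\mathcal P_n$ be the collection of cells obtained by applying Patch $n$ times to $ABCD$, let $B_n$ be the field associated with $\mathcal P_n$, and let $B$ be the pointwise limit of $B_n$. Let $S=\bigcap_n S_n$, where $S_n$ is the union of $\operatorname{conv}\mathcal C'$ over the compressible cells $\mathcal C'\in\mathcal P_n$. Let $\mathcal L$ be the union of the horizontal lines at heights $m2^{-n}h$ above $AB$ ($n\in\mathbb N$, $0\le m\le 2^n$). Let $\rho=1$ inside the lower incompressible cells of all $\mathcal P_n$ and $\rho=|AB|/|CD|$ inside the upper ones (this defines $\rho$ a.e. in $\Omega$). A *trajectory* of $B$ is a simple curve $K\subset\Omega$ of finite length that has an injective Lipschitz parametrization $\gamma:I\to\Omega$ on a nonempty connected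 set $I\subset\mathbb R$ with $\dot\gamma(t)=B(\gamma(t))$ for a.e. $t\in I$. If $\lambda$ is a finite signed Borel measure on $\Omega$ with $\operatorname{div}B=\lambda$ in the sense of distributions, its Cantor part $\lambda^c=\operatorname{div}^cB$ is the last term of the decomposition $\lambda=\lambda^a+\lambda^j+\lambda^c$ in which $\lambda^a\ll\mathcal L^2$, $\lambda^j+\lambda^c\perp\mathcal L^2$, $\lambda^c(E)=0$ whenever $\mathcal H^1(E)<\infty$, and $\lambda^j\ll\mathcal H^1$ is concentrated on a set that is $\sigma$-finite for $\mathcal H^1$. **Lemma (flow of $B$).** $B_n\to B$ uniformly on $\Omega\setminus\mathcal L$, and there is a family $\mathfrak F$ of pairwise disjoint trajectories of $B$ with $\bigcup_{K\in\mathfrak F}K=\Omega$. Each $K\in\mathfrak F$ is parametrized on the whole interval $(0,h)$ by a solution $\gamma_K$ as above such that $\gamma_K(t)$ is at height $t$ above $AB$. Moreover, the distributional divergence of $B$ in $\Omega$ is a finite signed measure that admits a decomposition as above, and for $(|\operatorname{div}^cB|+\mathcal L^2)$-a.e. $x\in\Omega$ the trajectory $K_x\in\mathfrak F$ through $x$ contains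 exactly one point of $S$. Consequently, for $(|\operatorname{div}^cB|+\mathcal L^2)$-a.e. $x\in\Omega$, writing $x=\gamma_{K_x}(t_x)$ and $K_x\cap S=\{\gamma_{K_x}(t_x^*)\}$, one has $\rho(x)=1$ if $t_x<t_x^*$ and $\rho(x)=|AB|/|CD|$ if $t_x>t_x^*$. -/

import Mathlib

open MeasureTheory Set Filter Topology
open scoped ContDiff

noncomputable section

/-- The Euclidean plane. The coordinate along `e₁` is `x 0`, the coordinate along `e₂` is `x 1`. -/
abbrev Plane : Type := EuclideanSpace ℝ (Fin 2)

/-- A quadrilateral, given by its four vertices in cyclic order. -/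
structure Quad where
  A : Plane
  B : Plane
  C : Plane
  D : Plane

namespace Quad

/-- The closed convex hull of the vertices. -/
def conv (Q : Quad) : Set Plane := convexHull ℝ {Q.A, Q.B, Q.C, Q.D}

/-- A cell: a trapezium `ABCD` whose bases `AB`, `CD` are parallel to `e₁` (the vectors `AB` and
`DC` are nonzero and point in the same direction), `CD` lies above `AB`, and `|CD| ≤ |AB|`. -/
structure IsCell (Q : Quad) : Prop where
  lower_base : Q.A 1 = Q.B 1
  upper_base : Q.D 1 = Q.C 1
  height_pos : Q.A 1 < Q.D 1
  same_direction : 0 < (Q.B 0 - Q.A 0) * (Q.C 0 - Q.D 0)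
  base_le : dist Q.C Q.D ≤ dist Q.A Q.B

/-- The upper base is strictly shorter than the lower one. -/
def Compressible (Q : Quad) : Prop := dist Q.C Q.D < dist Q.A Q.B

/-- For a compressible cell, the intersection point of the lines `AD` and `BC`
(see `apex_mem_lines`). -/
def apex (Q : Quad) : Plane :=
  Q.A + (dist Q.A Q.B / (dist Q.A Q.B - dist Q.C Q.D)) • (Q.D - Q.A)

open Classical in
/-- The vector field associated with a cell. -/
def field (Q : Quad) (x : Plane) : Plane :=
  if x ∈ Q.conv then
    if Q.Compressible then ((x - Q.apex) 1)⁻¹ • (x - Q.apex)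
    else ((Q.D - Q.A) 1)⁻¹ • (Q.D - Q.A)
  else 0

/-! The auxiliary points of the subdivision. The points `E, F, G` divide `DC` and `L, M, N`
divide `AB` into four equal parts; `U`, `V` are the midpoints of the sides `AD` and `BC`; and
`X, Y, Z` are the points on `UV` with `|UX| = |AL|`, `|XY| = |EF|`, `|YZ| = |MN|`
(and then `|ZV| = |GC|`). -/

def ptE (Q : Quad) : Plane := Q.D + (1 / 4 : ℝ) • (Q.C - Q.D)
def ptF (Q : Quad) : Plane := Q.D + (2 / 4 : ℝ) • (Q.C - Q.D)
def ptG (Q : Quad) : Plane := Q.D + (3 / 4 : ℝ) • (Q.C - Q.D)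
def ptL (Q : Quad) : Plane := Q.A + (1 / 4 : ℝ) • (Q.B - Q.A)
def ptM (Q : Quad) : Plane := Q.A + (2 / 4 : ℝ) • (Q.B - Q.A)
def ptN (Q : Quad) : Plane := Q.A + (3 / 4 : ℝ) • (Q.B - Q.A)
def ptU (Q : Quad) : Plane := midpoint ℝ Q.A Q.D
def ptV (Q : Quad) : Plane := midpoint ℝ Q.B Q.C
def ptX (Q : Quad) : Plane := Q.ptU + (Q.ptL - Q.A)
def ptY (Q : Quad) : Plane := Q.ptX + (Q.ptF - Q.ptE)
def ptZ (Q : Quad) : Plane := Q.ptY + (Q.ptN - Q.ptM)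

/-- The two lower incompressible cells `ALXU`, `MNZY` of the subdivision. -/
def lowerParts (Q : Quad) : List Quad :=
  [⟨Q.A, Q.ptL, Q.ptX, Q.ptU⟩, ⟨Q.ptM, Q.ptN, Q.ptZ, Q.ptY⟩]

/-- The two upper incompressible cells `XYFE`, `ZVCG` of the subdivision. -/
def upperParts (Q : Quad) : List Quad :=
  [⟨Q.ptX, Q.ptY, Q.ptF, Q.ptE⟩, ⟨Q.ptZ, Q.ptV, Q.C, Q.ptG⟩]

/-- The four compressible cells `UXED`, `LMYX`, `YZGF`, `NBVZ` of the subdivision. -/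
def compressibleParts (Q : Quad) : List Quad :=
  [⟨Q.ptU, Q.ptX, Q.ptE, Q.D⟩, ⟨Q.ptL, Q.ptM, Q.ptY, Q.ptX⟩,
   ⟨Q.ptY, Q.ptZ, Q.ptG, Q.ptF⟩, ⟨Q.ptN, Q.B, Q.ptV, Q.ptZ⟩]

open Classical in
/-- The operation `Patch` on a single cell. -/
def patch (Q : Quad) : List Quad :=
  if Q.Compressible then Q.lowerParts ++ Q.upperParts ++ Q.compressibleParts else [Q]

/-- The collection `P_n` of cells obtained from `Q` by applying `Patch` `n` times. -/
def cells (Q : Quad) : ℕ → List Quad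
  | 0 => [Q]
  | n + 1 => (cells Q n).flatMap patch

open Classical in
/-- The compressible cells of `P_n`. -/
def compressibleCells (Q : Quad) (n : ℕ) : List Quad :=
  (Q.cells n).filter (fun R => R.Compressible)

/-- The lower incompressible cells of `P_n`. -/
def lowerCells (Q : Quad) : ℕ → List Quad
  | 0 => []
  | n + 1 => lowerCells Q n ++ (Q.compressibleCells n).flatMap lowerParts

/-- The upper incompressible cells of `P_n`. -/
def upperCells (Q : Quad) : ℕ → List Quad
  | 0 => []
  | n + 1 => upperCells Q n ++ (Q.compressibleCells n).flatMap upperParts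

end Quad

/-- The vector field associated with a finite collection of cells: each cell is weighted by its
indicator function divided by `max(1, N(x))`, where `N(x)` is the number of cells containing `x`. -/
def unionField (l : List Quad) (x : Plane) : Plane :=
  (l.map fun R =>
    ((R.conv.indicator (fun _ => (1 : ℝ)) x) /
      max 1 (l.map fun R' => R'.conv.indicator (fun _ => (1 : ℝ)) x).sum) • R.field x).sum

namespace Quad

/-- The open domain `Ω`, the interior of the initial cell. -/
def domain (Q : Quad) : Set Plane := interior Q.conv

/-- The height `dist(AB, CD)` of a cell. -/
def height (Q : Quad) : ℝ := Q.D 1 - Q.A 1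

/-- The `n`-th approximation `B_n`. -/
def approxField (Q : Quad) (n : ℕ) : Plane → Plane := unionField (Q.cells n)

/-- The limit field `B`, the pointwise limit of the fields `B_n`. -/
def limitField (Q : Quad) (x : Plane) : Plane :=
  limUnder atTop (fun n => Q.approxField n x)

/-- The union `L` of the horizontal lines at the dyadic levels of the initial cell. -/
def dyadicLines (Q : Quad) : Set Plane :=
  {x | ∃ n m : ℕ, m ≤ 2 ^ n ∧ x 1 = Q.A 1 + (m / 2 ^ n : ℝ) * Q.height}

/-- The Cantor set `S`: the intersection over `n` of the union of the (closed) compressible cells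
of `P_n`. -/
def cantorSet (Q : Quad) : Set Plane :=
  ⋂ n : ℕ, ⋃ R ∈ Q.compressibleCells n, R.conv

/-- The ratio `|AB| / |CD|`. -/
def ratio (Q : Quad) : ℝ := dist Q.A Q.B / dist Q.C Q.D

open Classical in
/-- The density `ρ`: it is `1` inside the lower incompressible cells and `|AB| / |CD|` inside the
upper ones. This determines `ρ` almost everywhere in `Ω`; the remaining points get the value `0`. -/
def density (Q : Quad) (x : Plane) : ℝ :=
  if ∃ n, ∃ R ∈ Q.lowerCells n, x ∈ interior R.conv then 1
  else if ∃ n, ∃ R ∈ Q.upperCells n, x ∈ interior R.conv then Q.ratio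
  else 0

/-- On a compressible cell, `apex` is the intersection point of the lines `AD` and `BC`. -/
theorem apex_mem_lines (Q : Quad) (hQ : Q.IsCell) (hc : Q.Compressible) :
    Q.apex ∈ line[ℝ, Q.A, Q.D] ∧ Q.apex ∈ line[ℝ, Q.B, Q.C] := by
  constructor
  · have h := AffineMap.lineMap_mem_affineSpan_pair
      (dist Q.A Q.B / (dist Q.A Q.B - dist Q.C Q.D)) Q.A Q.D
    rw [AffineMap.lineMap_apply, vsub_eq_sub, vadd_eq_add, add_comm] at h
    exact h
  · have h := AffineMap.lineMap_mem_affineSpan_pair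
      (dist Q.A Q.B / (dist Q.A Q.B - dist Q.C Q.D)) Q.B Q.C
    rw [AffineMap.lineMap_apply, vsub_eq_sub, vadd_eq_add, add_comm] at h
    convert h using 1
    have h1 := hQ.lower_base
    have h2 := hQ.upper_base
    have h3 := hQ.same_direction
    have hAB : dist Q.A Q.B = |Q.A 0 - Q.B 0| := by
      rw [EuclideanSpace.dist_eq]
      simp [Fin.sum_univ_two, h1, Real.sqrt_sq_eq_abs, Real.dist_eq]
    have hCD : dist Q.C Q.D = |Q.C 0 - Q.D 0| := by
      rw [EuclideanSpace.dist_eq]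
      simp [Fin.sum_univ_two, h2, Real.sqrt_sq_eq_abs, Real.dist_eq]
    have hc' : |Q.C 0 - Q.D 0| < |Q.A 0 - Q.B 0| := by
      have := hc
      unfold Compressible at this
      rwa [hAB, hCD] at this
    have hne : |Q.A 0 - Q.B 0| - |Q.C 0 - Q.D 0| ≠ 0 := by linarith
    unfold apex
    rw [hAB, hCD]
    ext i
    fin_cases i
    · simp
      field_simp
      rcases le_total (Q.A 0) (Q.B 0) with hle | hle
      · have h4 : 0 ≤ Q.C 0 - Q.D 0 := by nlinarith
        rw [abs_of_nonpos (by linarith : Q.A 0 - Q.B 0 ≤ 0), abs_of_nonneg h4]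
        ring
      · have h4 : Q.C 0 - Q.D 0 ≤ 0 := by nlinarith
        rw [abs_of_nonneg (by linarith : 0 ≤ Q.A 0 - Q.B 0), abs_of_nonpos h4]
        ring
    · simp [h1, h2]

end Quad

/-- The finite signed Borel measure `lam` on `Ω` is the distributional divergence of the bounded
vector field `V` in `Ω`. -/
structure HasDivergence (Ω : Set Plane) (V : Plane → Plane) (lam : SignedMeasure Plane) :
    Prop where
  bounded : MemLp V ⊤ (volume.restrict Ω)
  concentrated : lam.totalVariation Ωᶜ = 0
  divergence : ∀ φ : Plane → ℝ, ContDiff ℝ ∞ φ → HasCompactSupport φ → tsupport φ ⊆ Ω →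
    ∫ x in Ω, fderiv ℝ φ x (V x) =
      -(∫ x, φ x ∂lam.toJordanDecomposition.posPart -
        ∫ x, φ x ∂lam.toJordanDecomposition.negPart)

/-- The decomposition of a signed measure on the plane into its absolutely continuous, jump and
Cantor parts. -/
structure IsDecomposition (lam lamA lamJ lamC : SignedMeasure Plane) : Prop where
  sum_eq : lam = lamA + lamJ + lamC
  ac : lamA.totalVariation ≪ volume
  singular : (lamJ + lamC).totalVariation ⟂ₘ volume
  cantor : ∀ E : Set Plane, MeasurableSet E → Measure.hausdorffMeasure 1 E < ⊤ → lamC E = 0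
  jump_ac : lamJ.totalVariation ≪ Measure.hausdorffMeasure 1
  jump_concentrated : ∃ E : Set Plane, MeasurableSet E ∧
    SigmaFinite ((Measure.hausdorffMeasure 1).restrict E) ∧ lamJ.totalVariation Eᶜ = 0

/-- `lamC` is the Cantor part of `lam`. -/
def IsCantorPart (lam lamC : SignedMeasure Plane) : Prop :=
  ∃ lamA lamJ : SignedMeasure Plane, IsDecomposition lam lamA lamJ lamC

/-- The simple Lipschitz curve `K ⊆ Ω` is a trajectory of `V`, with the injective Lipschitz
parametrization `γ`, defined on the nonempty connected set `I ⊆ ℝ`, which solves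
`γ'(t) = V(γ(t))` for a.e. `t ∈ I`. -/
structure IsTrajectory (Ω : Set Plane) (V : Plane → Plane) (K : Set Plane) (I : Set ℝ)
    (γ : ℝ → Plane) : Prop where
  connected : IsConnected I
  image_eq : γ '' I = K
  subset : K ⊆ Ω
  length_finite : Measure.hausdorffMeasure 1 K < ⊤
  injOn : InjOn γ I
  lipschitz : ∃ c : NNReal, LipschitzOnWith c γ I
  ode : ∀ᵐ t ∂volume.restrict I, HasDerivWithinAt γ (V (γ t)) I t

/-- `γ` parametrizes the trajectory `K` of the limit field in `Ω` over the time interval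
`(0, dist(AB, CD))`, so that at time `t` the curve is at height `t` above the base `AB`. -/
def IsCrossing (Q : Quad) (K : Set Plane) (γ : ℝ → Plane) : Prop :=
  IsTrajectory Q.domain Q.limitField K (Ioo 0 Q.height) γ ∧
    ∀ t ∈ Ioo 0 Q.height, γ t 1 = Q.A 1 + t

end

/-!
The limit flow can be written down in closed form. Parametrize the lower base `AB` by `s ∈ (0, 1)`
and rescale heights to `τ ∈ (0, 1)`; let `κ = |CD| / |AB|`. Follow the trajectory that starts at
parameter `s`. In each generation it passes through one compressible cell (generically only one),
and Patch decides from the parity of the next base-4 digit of `s` whether the compressible child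
lies in the upper half (even digit) or in the lower half (odd digit) of its parent. The nested
compressible cells therefore close down on the height `T s = crossHeight s` whose binary digits are
these parities. Below that height nearby trajectories keep their distance, above it distances have
shrunk by the factor `κ`. Hence, in the affine coordinates `(u, τ) ↦ A + u (B - A) + τ (D - A)`,
the trajectory is `u = s - (1 - κ) G(s, τ)` with `G(s, τ) = |{s' ∈ [0, s) : T s' ≤ τ}|`. Everything
is derived from this formula (`Quad.flow`).

* *Combinatorics.* `T` is uniformly distributed (`lowMass_zero_one`), so `G` at base-4 grid points
  is piecewise affine in `τ`, and the images under the flow of the grid rectangles of side lengths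
  `4⁻ᴺ` and `2⁻ᴺ` are trapezia. Those occurring in `P_n` are identified in `IsCell.mem_cells`. It
  follows that a trajectory with generic `s` meets the Cantor set exactly at height `T s`, is
  covered by lower cells below that height and by upper cells above it.
* *Convergence.* On a cell of generation `N` the field is the velocity `∂_τ` of the flow, up to an
  error `O(2⁻ᴺ)` that is present on compressible cells only (`IsCell.field_gridCell`). This gives
  uniform convergence off the dyadic lines and shows that the flow lines solve the limit equation.
* *Divergence.* Planar Lebesgue measure is the image under the flow of `j ds dτ`, up to a constant,
  where `j = 1` for `τ < T s` and `j = κ` for `τ ≥ T s` (`IsCell.volume_restrict_domain`).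
  Integrating the derivative of a test function along each flow line leaves only the contribution
  of the jump of `j`, so `div B` is `-(1 - κ) |AB|` times the image of `ds` under `s ↦ flow s (T
  s)` (`IsCell.integral_divergence`).
* *Cantor part.* A set of diameter `d ≲ 4⁻ⁿ` meets the crossing points of at most three base-4
  pieces of generation `n`, in a band of height `O(d)`; each piece contributes at most `O(2⁻ⁿ d)`.
  Hence the measure is at most `O(2⁻ⁿ)` times the one-dimensional Hausdorff measure for every `n`,
  and vanishes on sets of finite length (`IsCell.crossingMeasure_eq_zero`). Being concentrated on
  the Lebesgue null set `S`, it is its own Cantor part.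
-/

noncomputable section

/-! ### The crossing height and its uniform law -/

namespace CantorFlow

/-- The position, counted from below and from `0`, of the dyadic strip of height `2⁻ⁿ` that
contains the `K`-th compressible cell of generation `n`. The quarters `0` and `2` of a compressible
cell have their compressible child in the upper half, the quarters `1` and `3` in the lower half.
-/
def heightIndex : ℕ → ℕ → ℕ
  | 0, _ => 0
  | n + 1, K => 2 * heightIndex n (K / 4) + if Even K then 1 else 0

/-- The `n`-th binary digit of the crossing height: `1` if the digit number `n + 1` of `s` in base
`4` is even, `0` if it is odd. -/
def bit (n : ℕ) (s : ℝ) : ℝ := if Even ⌊4 ^ (n + 1) * s⌋₊ then 1 else 0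

/-- The height, as a fraction of the height of the cell, at which the trajectory starting at the
parameter `s` of the lower base meets the Cantor set. -/
def crossHeight (s : ℝ) : ℝ := ∑' n : ℕ, bit n s / 2 ^ (n + 1)

lemma bit_nonneg (n : ℕ) (s : ℝ) : 0 ≤ bit n s := by unfold bit; split_ifs <;> norm_num

lemma bit_le_one (n : ℕ) (s : ℝ) : bit n s ≤ 1 := by unfold bit; split_ifs <;> norm_num

lemma hasSum_half : HasSum (fun n : ℕ => (1 : ℝ) / 2 ^ (n + 1)) 1 := by
  convert hasSum_geometric_two' (1 : ℝ) using 2 with n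
  rw [pow_succ', div_div]

lemma summable_bit (s : ℝ) : Summable fun n : ℕ => bit n s / 2 ^ (n + 1) :=
  Summable.of_nonneg_of_le (fun n => div_nonneg (bit_nonneg n s) (by positivity))
    (fun n => by gcongr; exact bit_le_one n s) hasSum_half.summable

lemma crossHeight_nonneg (s : ℝ) : 0 ≤ crossHeight s :=
  tsum_nonneg fun n => div_nonneg (bit_nonneg n s) (by positivity)

lemma crossHeight_le_one (s : ℝ) : crossHeight s ≤ 1 := by
  rw [← hasSum_half.tsum_eq]
  exact (summable_bit s).tsum_le_tsum (fun n => by gcongr; exact bit_le_one n s)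
    hasSum_half.summable

lemma measurable_crossHeight : Measurable crossHeight := by
  refine measurable_of_tendsto_metrizable (f := fun n s => ∑ i ∈ Finset.range n, bit i s / 2 ^
      (i + 1))
    (fun n => Finset.measurable_fun_sum _ fun i _ => Measurable.div_const ?_ _) ?_
  · exact (measurable_from_nat (f := fun k => if Even k then (1 : ℝ) else 0)).comp
      (Nat.measurable_floor.comp (measurable_const.mul measurable_id))
  · rw [tendsto_pi_nhds]
    exact fun s => (summable_bit s).hasSum.tendsto_sum_nat

lemma floor_four_pow_succ_div (n : ℕ) (s : ℝ) : ⌊4 ^ (n + 1) * s⌋₊ / 4 = ⌊4 ^ n * s⌋₊ := by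
  rw [← Nat.floor_div_ofNat]
  congr 1
  ring

lemma sum_bit (n : ℕ) (s : ℝ) :
    ∑ i ∈ Finset.range n, bit i s / 2 ^ (i + 1) = heightIndex n ⌊4 ^ n * s⌋₊ / 2 ^ n := by
  induction n with
  | zero => simp [heightIndex]
  | succ n ih =>
    rw [Finset.sum_range_succ, ih, heightIndex, floor_four_pow_succ_div, bit]
    push_cast
    split_ifs <;> (rw [pow_succ]; field_simp)

/-- Self-similarity: on the `k`-th base-4 interval of generation `n`, the crossing height is a copy
of itself scaled by `2⁻ⁿ` and moved to the strip of index `heightIndex n k`. -/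
lemma crossHeight_add_div (n k : ℕ) {s : ℝ} (h0 : 0 ≤ s) (h1 : s < 1) :
    crossHeight ((k + s) / 4 ^ n) = (heightIndex n k + crossHeight s) / 2 ^ n := by
  have hfl : ⌊4 ^ n * ((k + s) / 4 ^ n)⌋₊ = k := by
    rw [mul_div_cancel₀ _ (by positivity), Nat.floor_eq_iff (by positivity)]
    constructor <;> linarith
  have htail : ∀ i, bit (i + n) ((k + s) / 4 ^ n) / 2 ^ (i + n + 1)
      = bit i s / 2 ^ (i + 1) / 2 ^ n := by
    intro i
    have : ⌊(4 : ℝ) ^ (i + n + 1) * ((k + s) / 4 ^ n)⌋₊ = ⌊(4 : ℝ) ^ (i + 1) * s⌋₊ + 4 ^ (i + 1) *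
        k := by
      rw [← Nat.floor_add_natCast (by positivity)]
      congr 1
      push_cast
      field_simp
      ring
    have he : Even (4 ^ (i + 1) * k) := by
      rw [pow_succ]; exact ((by decide : Even 4).mul_left _).mul_right _
    unfold bit
    rw [this]
    simp only [Nat.even_add, he, iff_true]
    rw [div_div, ← pow_add]
    congr 2
    ring
  rw [crossHeight, ← (summable_bit _).sum_add_tsum_nat_add n, sum_bit, hfl]
  simp only [htail]
  rw [tsum_div_const, add_div, crossHeight]

lemma crossHeight_mem {n k : ℕ} {s : ℝ} (h0 : k / 4 ^ n ≤ s) (h1 : s < (k + 1) / 4 ^ n) :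
    heightIndex n k / 2 ^ n ≤ crossHeight s ∧ crossHeight s ≤ (heightIndex n k + 1) / 2 ^ n := by
  have e : s = (k + (4 ^ n * s - k)) / 4 ^ n := by field_simp; ring
  have h4 : (0 : ℝ) < 4 ^ n := by positivity
  rw [div_le_iff₀ h4] at h0
  rw [lt_div_iff₀ h4] at h1
  rw [e, crossHeight_add_div n k (by linarith) (by linarith)]
  have a := crossHeight_nonneg (4 ^ n * s - k)
  have b := crossHeight_le_one (4 ^ n * s - k)
  constructor <;> gcongr <;> linarith

/-- The length of the set of parameters in `[a, b)` whose trajectories cross the Cantor set at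
height at most `τ`. -/
def lowMass (a b τ : ℝ) : ℝ := volume.real (Ico a b ∩ {s | crossHeight s ≤ τ})

lemma measurableSet_crossHeight_le (τ : ℝ) : MeasurableSet {s | crossHeight s ≤ τ} :=
  measurableSet_le measurable_crossHeight measurable_const

lemma lowMass_ne_top (a b τ : ℝ) : volume (Ico a b ∩ {s | crossHeight s ≤ τ}) ≠ ⊤ :=
  measure_ne_top_of_subset inter_subset_left (by simp)

lemma lowMass_nonneg (a b τ : ℝ) : 0 ≤ lowMass a b τ := measureReal_nonneg

lemma lowMass_self (a τ : ℝ) : lowMass a a τ = 0 := by simp [lowMass]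

lemma lowMass_le {a b : ℝ} (h : a ≤ b) (τ : ℝ) : lowMass a b τ ≤ b - a := by
  have := measureReal_mono (μ := volume) (inter_subset_left : Ico a b ∩ {s | crossHeight s ≤ τ} ⊆
      Ico a b)
    (by simp)
  simpa [lowMass, Real.volume_real_Ico_of_le h] using this

lemma lowMass_add {a b c : ℝ} (h : a ≤ b) (h' : b ≤ c) (τ : ℝ) :
    lowMass a b τ + lowMass b c τ = lowMass a c τ := by
  unfold lowMass
  rw [← Ico_union_Ico_eq_Ico h h', union_inter_distrib_right, measureReal_union ?_ ?_
      (lowMass_ne_top _ _ _)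
    (lowMass_ne_top _ _ _)]
  · exact Disjoint.mono inter_subset_left inter_subset_left (Ico_disjoint_Ico_same)
  · exact measurableSet_Ico.inter (measurableSet_crossHeight_le τ)

lemma lowMass_mono (a b : ℝ) {τ τ' : ℝ} (h : τ ≤ τ') : lowMass a b τ ≤ lowMass a b τ' :=
  measureReal_mono (inter_subset_inter_right _ fun _ hs => le_trans hs h) (lowMass_ne_top _ _ _)

/-- The mass of a band of crossing heights grows with the interval of parameters. -/
lemma lowMass_sub_le {a b c d : ℝ} (h1 : a ≤ b) (h2 : b ≤ c) (h3 : c ≤ d) {τ τ' : ℝ} (h : τ ≤ τ') :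
    lowMass b c τ' - lowMass b c τ ≤ lowMass a d τ' - lowMass a d τ := by
  have e1 := lowMass_add h1 (h2.trans h3) τ
  have e2 := lowMass_add h1 (h2.trans h3) τ'
  have e3 := lowMass_add h2 h3 τ
  have e4 := lowMass_add h2 h3 τ'
  have e5 := lowMass_mono a b h
  have e6 := lowMass_mono c d h
  linarith

lemma lowMass_piece_eq (n k : ℕ) (τ : ℝ) :
    lowMass (k / 4 ^ n) ((k + 1) / 4 ^ n) τ = lowMass 0 1 (2 ^ n * τ - heightIndex n k) / 4 ^ n :=
        by
  have hset : Ico ((k : ℝ) / 4 ^ n) ((k + 1) / 4 ^ n) ∩ {s | crossHeight s ≤ τ} =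
      (fun s => (4 : ℝ) ^ n * s) ⁻¹' ((fun s => s + (-k : ℝ)) ⁻¹'
        (Ico 0 1 ∩ {s | crossHeight s ≤ 2 ^ n * τ - heightIndex n k})) := by
    ext s
    have h4 : (0 : ℝ) < 4 ^ n := by positivity
    have h2 : (0 : ℝ) < 2 ^ n := by positivity
    simp only [mem_inter_iff, mem_Ico, mem_ofPred_eq, mem_preimage, div_le_iff₀ h4, lt_div_iff₀ h4]
    constructor
    · rintro ⟨⟨a, b⟩, c⟩
      refine ⟨⟨by linarith, by linarith⟩, ?_⟩
      have e : s = (k + (4 ^ n * s + -k)) / 4 ^ n := by field_simp; ring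
      rw [e, crossHeight_add_div n k (by linarith) (by linarith), div_le_iff₀ h2] at c
      linarith
    · rintro ⟨⟨a, b⟩, c⟩
      refine ⟨⟨by linarith, by linarith⟩, ?_⟩
      have e : s = (k + (4 ^ n * s + -k)) / 4 ^ n := by field_simp; ring
      rw [e, crossHeight_add_div n k (by linarith) (by linarith), div_le_iff₀ h2]
      linarith
  unfold lowMass
  rw [hset, measureReal_def, Real.volume_preimage_mul_left (by positivity),
      measure_preimage_add_right,
    ENNReal.toReal_mul, ENNReal.toReal_ofReal (by positivity), abs_of_pos (by positivity),
    measureReal_def]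
  ring

/-- Truncation of a real number to the interval `[0, 1]`. -/
def clamp (x : ℝ) : ℝ := max 0 (min 1 x)

lemma lowMass_zero_one_of_neg {τ : ℝ} (h : τ < 0) : lowMass 0 1 τ = 0 := by
  have : Ico (0 : ℝ) 1 ∩ {s | crossHeight s ≤ τ} = ∅ := by
    ext s
    simp only [mem_inter_iff, mem_ofPred_eq, mem_empty_iff_false, iff_false, not_and, not_le]
    intro _
    linarith [crossHeight_nonneg s]
  simp [lowMass, this]

lemma lowMass_zero_one_of_one_le {τ : ℝ} (h : 1 ≤ τ) : lowMass 0 1 τ = 1 := by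
  have : Ico (0 : ℝ) 1 ∩ {s | crossHeight s ≤ τ} = Ico 0 1 := by
    ext s
    simp only [mem_inter_iff, mem_ofPred_eq, and_iff_left_iff_imp]
    intro _
    linarith [crossHeight_le_one s]
  simp [lowMass, this]

/-- The four quarters of `[0, 1)` give this functional equation: two of them are scaled copies
placed in the lower half of the heights, the other two in the upper half. -/
lemma lowMass_zero_one_rec (τ : ℝ) :
    lowMass 0 1 τ = (lowMass 0 1 (2 * τ - 1) + lowMass 0 1 (2 * τ)) / 2 := by
  have e0 := lowMass_piece_eq 1 0 τ
  have e1 := lowMass_piece_eq 1 1 τ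
  have e2 := lowMass_piece_eq 1 2 τ
  have e3 := lowMass_piece_eq 1 3 τ
  simp only [heightIndex, (by decide : Even 0), (by decide : ¬ Even 1), (by decide : Even 2),
    (by decide : ¬ Even 3), if_true, if_false] at e0 e1 e2 e3
  norm_num at e0 e1 e2 e3
  have a1 := lowMass_add (a := 0) (b := 1/4) (c := 1/2) (by norm_num) (by norm_num) τ
  have a2 := lowMass_add (a := 0) (b := 1/2) (c := 3/4) (by norm_num) (by norm_num) τ
  have a3 := lowMass_add (a := 0) (b := 3/4) (c := 1) (by norm_num) (by norm_num) τ
  linarith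

/-- The crossing height of a uniformly distributed parameter is uniformly distributed on `[0, 1]`.
The functional equation halves the distance to the uniform distribution function. -/
lemma lowMass_zero_one (τ : ℝ) : lowMass 0 1 τ = clamp τ := by
  rcases lt_or_ge τ 0 with h | h
  · rw [lowMass_zero_one_of_neg h, clamp, max_eq_left ((min_le_right _ _).trans h.le)]
  rcases le_or_gt 1 τ with h' | h'
  · rw [lowMass_zero_one_of_one_le h', clamp, min_eq_left h']; simp
  -- In each half of the heights one of the two terms of the functional equation is constant, and
  -- the error halves.
  have key : ∀ n : ℕ, ∀ τ : ℝ, 0 ≤ τ → τ ≤ 1 → |lowMass 0 1 τ - τ| ≤ 1 / 2 ^ n := by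
    intro n
    induction n with
    | zero =>
      intro τ h0 h1
      have := lowMass_nonneg 0 1 τ
      have := lowMass_le (zero_le_one' ℝ) τ
      rw [abs_le]; constructor <;> norm_num <;> linarith
    | succ n ih =>
      intro τ h0 h1
      rw [lowMass_zero_one_rec]
      rcases lt_or_ge τ (1 / 2) with hh | hh
      · rw [lowMass_zero_one_of_neg (by linarith : 2 * τ - 1 < 0)]
        have := ih (2 * τ) (by linarith) (by linarith)
        rw [show (0 + lowMass 0 1 (2 * τ)) / 2 - τ = (lowMass 0 1 (2 * τ) - 2 * τ) / 2 by ring,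
          abs_div, pow_succ, ← div_div]
        simpa using div_le_div_of_nonneg_right this (by norm_num : (0 : ℝ) ≤ 2)
      · rw [lowMass_zero_one_of_one_le (by linarith : 1 ≤ 2 * τ)]
        have := ih (2 * τ - 1) (by linarith) (by linarith)
        rw [show (lowMass 0 1 (2 * τ - 1) + 1) / 2 - τ =
            (lowMass 0 1 (2 * τ - 1) - (2 * τ - 1)) / 2 by ring,
          abs_div, pow_succ, ← div_div]
        simpa using div_le_div_of_nonneg_right this (by norm_num : (0 : ℝ) ≤ 2)
  have hz : |lowMass 0 1 τ - τ| ≤ 0 := by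
    refine ge_of_tendsto' (x := atTop) (f := fun n : ℕ => (1 : ℝ) / 2 ^ n) ?_ fun n => key n τ h
        h'.le
    simpa using tendsto_pow_atTop_nhds_zero_of_lt_one (r := (1 / 2 : ℝ)) (by norm_num) (by norm_num)
  rw [clamp, min_eq_right h'.le, max_eq_right h]
  linarith [abs_nonpos_iff.1 hz]

lemma lowMass_piece (n k : ℕ) (τ : ℝ) :
    lowMass (k / 4 ^ n) ((k + 1) / 4 ^ n) τ = clamp (2 ^ n * τ - heightIndex n k) / 4 ^ n := by
  rw [lowMass_piece_eq, lowMass_zero_one]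

lemma clamp_of_nonpos {x : ℝ} (h : x ≤ 0) : clamp x = 0 := by
  rw [clamp, max_eq_left ((min_le_right _ _).trans h)]

lemma clamp_of_one_le {x : ℝ} (h : 1 ≤ x) : clamp x = 1 := by
  rw [clamp, min_eq_left h]; simp

lemma clamp_of_mem {x : ℝ} (h0 : 0 ≤ x) (h1 : x ≤ 1) : clamp x = x := by
  rw [clamp, min_eq_right h1, max_eq_right h0]

lemma clamp_nonneg (x : ℝ) : 0 ≤ clamp x := le_max_left _ _

lemma clamp_le_one (x : ℝ) : clamp x ≤ 1 := max_le zero_le_one (min_le_left _ _)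

lemma clamp_sub_le {x y : ℝ} (h : x ≤ y) : clamp y - clamp x ≤ y - x := by
  unfold clamp
  rcases le_total 1 x with a | a <;> rcases le_total 1 y with b | b <;>
  rcases le_total 0 x with c | c <;> rcases le_total 0 y with d | d <;>
  simp [a, b, c, d] <;> linarith

/-- Inside one base-4 interval of generation `n`, the mass of a band of crossing heights is at most
`2⁻ⁿ` times its width: the mass `4⁻ⁿ` is spread evenly over a strip of height `2⁻ⁿ`. -/
lemma lowMass_sub_le_of_piece {n k : ℕ} {a b : ℝ} (h1 : k / 4 ^ n ≤ a) (h2 : a ≤ b)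
    (h3 : b ≤ (k + 1) / 4 ^ n) {τ τ' : ℝ} (h : τ ≤ τ') :
    lowMass a b τ' - lowMass a b τ ≤ (τ' - τ) / 2 ^ n := by
  refine (lowMass_sub_le h1 h2 h3 h).trans ?_
  rw [lowMass_piece, lowMass_piece, ← sub_div]
  have := clamp_sub_le (x := 2 ^ n * τ - heightIndex n k) (y := 2 ^ n * τ' - heightIndex n k)
    (by gcongr)
  rw [div_le_div_iff₀ (by positivity) (by positivity)]
  have e : (4 : ℝ) ^ n = 2 ^ n * 2 ^ n := by rw [← mul_pow]; norm_num
  rw [e]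
  nlinarith [pow_pos (two_pos : (0 : ℝ) < 2) n]

/-- Below its strip, a base-4 interval has no crossings. -/
lemma lowMass_eq_zero {n k : ℕ} {a b : ℝ} (h1 : k / 4 ^ n ≤ a) (h2 : a ≤ b)
    (h3 : b ≤ (k + 1) / 4 ^ n) {τ : ℝ} (h : τ ≤ heightIndex n k / 2 ^ n) :
    lowMass a b τ = 0 := by
  have e1 := lowMass_add h1 (h2.trans h3) τ
  have e3 := lowMass_add h2 h3 τ
  rw [lowMass_piece, clamp_of_nonpos, zero_div] at e1
  · linarith [lowMass_nonneg (k / 4 ^ n) a τ, lowMass_nonneg a b τ, lowMass_nonneg b ((k+1)/4^n) τ]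
  · rw [le_div_iff₀ (by positivity)] at h; linarith

/-- Above its strip, all trajectories of a base-4 interval have crossed. -/
lemma lowMass_eq_sub {n k : ℕ} {a b : ℝ} (h1 : k / 4 ^ n ≤ a) (h2 : a ≤ b)
    (h3 : b ≤ (k + 1) / 4 ^ n) {τ : ℝ} (h : (heightIndex n k + 1) / 2 ^ n ≤ τ) :
    lowMass a b τ = b - a := by
  have e1 := lowMass_add h1 (h2.trans h3) τ
  have e3 := lowMass_add h2 h3 τ
  rw [lowMass_piece, clamp_of_one_le] at e1
  · have e : (1 : ℝ) / 4 ^ n = (k + 1) / 4 ^ n - k / 4 ^ n := by ring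
    rw [e] at e1
    linarith [lowMass_le h1 τ, lowMass_le h2 τ, lowMass_le h3 τ]
  · rw [div_le_iff₀ (by positivity)] at h; linarith

/-- The joint distribution function of a uniform parameter and its crossing height. -/
def cdf (s τ : ℝ) : ℝ := lowMass 0 s τ

lemma cdf_add {s s' : ℝ} (h : 0 ≤ s) (h' : s ≤ s') (τ : ℝ) :
    cdf s' τ = cdf s τ + lowMass s s' τ := (lowMass_add h h' τ).symm

lemma cdf_zero (τ : ℝ) : cdf 0 τ = 0 := lowMass_self 0 τ

lemma cdf_one (τ : ℝ) : cdf 1 τ = clamp τ := lowMass_zero_one τ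

lemma cdf_mono_right (s : ℝ) {τ τ' : ℝ} (h : τ ≤ τ') : cdf s τ ≤ cdf s τ' := lowMass_mono 0 s h

lemma cdf_sub_le {s : ℝ} (h0 : 0 ≤ s) (h1 : s ≤ 1) {τ τ' : ℝ} (h : τ ≤ τ') :
    cdf s τ' - cdf s τ ≤ τ' - τ := by
  have := lowMass_sub_le_of_piece (n := 0) (k := 0) (a := 0) (b := s) (by simp) h0 (by simpa) h
  simpa [cdf] using this

lemma abs_cdf_sub_le {s : ℝ} (h0 : 0 ≤ s) (h1 : s ≤ 1) (τ τ' : ℝ) :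
    |cdf s τ' - cdf s τ| ≤ |τ' - τ| := by
  rcases le_total τ τ' with h | h
  · rw [abs_of_nonneg (sub_nonneg.2 (cdf_mono_right s h)), abs_of_nonneg (sub_nonneg.2 h)]
    exact cdf_sub_le h0 h1 h
  · rw [abs_of_nonpos (sub_nonpos.2 (cdf_mono_right s h)), abs_of_nonpos (sub_nonpos.2 h)]
    linarith [cdf_sub_le h0 h1 h]

lemma cdf_succ (n k : ℕ) (τ : ℝ) :
    cdf ((k + 1 : ℕ) / 4 ^ n) τ = cdf (k / 4 ^ n) τ + clamp (2 ^ n * τ - heightIndex n k) / 4 ^ n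
        := by
  rw [← lowMass_piece, ← cdf_add (by positivity) (by gcongr; linarith)]
  push_cast; rfl

/-- At a base-4 grid point, the distribution function is affine in `τ` on every dyadic strip of the
same generation. This is the reason why the cells have straight sides. -/
lemma exists_slope (n M k : ℕ) : ∃ p : ℝ, ∀ τ : ℝ, M / 2 ^ n ≤ τ → τ ≤ (M + 1) / 2 ^ n →
    cdf (k / 4 ^ n) τ = cdf (k / 4 ^ n) (M / 2 ^ n) + p * (τ - M / 2 ^ n) := by
  have h2 : (0 : ℝ) < 2 ^ n := by positivity
  induction k with
  | zero => exact ⟨0, fun τ _ _ => by simp [cdf_zero]⟩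
  | succ k ih =>
    obtain ⟨p, hp⟩ := ih
    have hc : ∃ q : ℝ, ∀ τ : ℝ, M / 2 ^ n ≤ τ → τ ≤ (M + 1) / 2 ^ n →
        clamp (2 ^ n * τ - heightIndex n k) =
          clamp (2 ^ n * (M / 2 ^ n) - heightIndex n k) + q * (τ - M / 2 ^ n) := by
      have hM : (2 : ℝ) ^ n * (M / 2 ^ n) = M := by field_simp
      rw [hM]
      simp only [div_le_iff₀ h2, le_div_iff₀ h2]
      rcases lt_trichotomy M (heightIndex n k) with h | h | h
      · have h' : (M : ℝ) + 1 ≤ heightIndex n k := by exact_mod_cast h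
        refine ⟨0, fun τ a b => ?_⟩
        rw [clamp_of_nonpos (by linarith), clamp_of_nonpos (by linarith)]; simp
      · refine ⟨2 ^ n, fun τ a b => ?_⟩
        rw [← h, clamp_of_mem (by linarith) (by linarith), sub_self, clamp_of_nonpos le_rfl]
        field_simp; ring
      · have h' : (heightIndex n k : ℝ) + 1 ≤ M := by exact_mod_cast h
        refine ⟨0, fun τ a b => ?_⟩
        rw [clamp_of_one_le (by linarith), clamp_of_one_le (by linarith)]; simp
    obtain ⟨q, hq⟩ := hc
    refine ⟨p + q / 4 ^ n, fun τ a b => ?_⟩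
    rw [cdf_succ, cdf_succ, hp τ a b, hq τ a b]
    ring

end CantorFlow

/-! ### Affine coordinates and the flow -/

namespace Quad

variable {Q : Quad}

/-- The ratio `|CD| / |AB|`, written as a quotient of signed lengths so that `chart κ 1 = C` holds
whichever direction the bases point in. -/
def contraction (Q : Quad) : ℝ := (Q.C 0 - Q.D 0) / (Q.B 0 - Q.A 0)

/-- The affine coordinates with origin `A` and axes `AB` and `AD`. -/
def chart (Q : Quad) (u τ : ℝ) : Plane := Q.A + u • (Q.B - Q.A) + τ • (Q.D - Q.A)

/-- The second affine coordinate: the height above `AB` as a fraction of the height of the cell. -/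
def coordT (Q : Quad) (x : Plane) : ℝ := (x 1 - Q.A 1) / Q.height

/-- The first affine coordinate, measured along `AB`. -/
def coordU (Q : Quad) (x : Plane) : ℝ :=
  (x 0 - Q.A 0 - Q.coordT x * (Q.D 0 - Q.A 0)) / (Q.B 0 - Q.A 0)

lemma IsCell.width_ne (hQ : Q.IsCell) : Q.B 0 - Q.A 0 ≠ 0 := fun h => by
  have := hQ.same_direction
  rw [h, zero_mul] at this
  exact lt_irrefl _ this

lemma IsCell.height_pos' (hQ : Q.IsCell) : 0 < Q.height := sub_pos.2 hQ.height_pos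

lemma dist_of_horizontal {x y : Plane} (h : x 1 = y 1) : dist x y = |x 0 - y 0| := by
  rw [EuclideanSpace.dist_eq]
  simp [Fin.sum_univ_two, h, Real.sqrt_sq_eq_abs, Real.dist_eq]

lemma IsCell.abs_contraction (hQ : Q.IsCell) :
    |Q.contraction| = dist Q.C Q.D / dist Q.A Q.B := by
  rw [dist_of_horizontal hQ.lower_base, dist_of_horizontal hQ.upper_base.symm, contraction, abs_div,
    abs_sub_comm (Q.A 0)]

lemma IsCell.contraction_pos (hQ : Q.IsCell) : 0 < Q.contraction := by
  have h := hQ.same_direction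
  have hw := hQ.width_ne
  have : Q.contraction = (Q.B 0 - Q.A 0) * (Q.C 0 - Q.D 0) / (Q.B 0 - Q.A 0) ^ 2 := by
    rw [contraction]; field_simp
  rw [this]
  positivity

lemma IsCell.dist_pos (hQ : Q.IsCell) : 0 < dist Q.A Q.B := by
  rw [dist_of_horizontal hQ.lower_base, abs_sub_comm]
  exact abs_pos.2 hQ.width_ne

lemma IsCell.contraction_lt_one (hQ : Q.IsCell) (hc : Q.Compressible) : Q.contraction < 1 := by
  rw [← abs_of_pos hQ.contraction_pos, hQ.abs_contraction, div_lt_one hQ.dist_pos]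
  exact hc

lemma chart_apply_zero (u τ : ℝ) :
    Q.chart u τ 0 = Q.A 0 + u * (Q.B 0 - Q.A 0) + τ * (Q.D 0 - Q.A 0) := by
  simp [chart]

lemma IsCell.chart_apply_one (hQ : Q.IsCell) (u τ : ℝ) :
    Q.chart u τ 1 = Q.A 1 + τ * Q.height := by
  simp [chart, height, hQ.lower_base]

lemma IsCell.coordT_chart (hQ : Q.IsCell) (u τ : ℝ) : Q.coordT (Q.chart u τ) = τ := by
  have := hQ.height_pos'.ne'
  rw [coordT, hQ.chart_apply_one]; field_simp; ring

lemma IsCell.coordU_chart (hQ : Q.IsCell) (u τ : ℝ) : Q.coordU (Q.chart u τ) = u := by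
  have := hQ.width_ne
  rw [coordU, hQ.coordT_chart, chart_apply_zero]; field_simp; ring

lemma IsCell.chart_coord (hQ : Q.IsCell) (x : Plane) : Q.chart (Q.coordU x) (Q.coordT x) = x := by
  have h1 := hQ.height_pos'.ne'
  have h2 := hQ.width_ne
  ext i
  fin_cases i
  · change Q.chart (Q.coordU x) (Q.coordT x) 0 = x 0
    rw [chart_apply_zero, coordU]; field_simp; ring
  · change Q.chart (Q.coordU x) (Q.coordT x) 1 = x 1
    rw [hQ.chart_apply_one, coordT]; field_simp; ring

lemma IsCell.chart_inj (hQ : Q.IsCell) {u τ u' τ' : ℝ} (h : Q.chart u τ = Q.chart u' τ') :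
    u = u' ∧ τ = τ' :=
  ⟨by rw [← hQ.coordU_chart u τ, h, hQ.coordU_chart], by
    rw [← hQ.coordT_chart u τ, h, hQ.coordT_chart]⟩

lemma continuous_coordT (Q : Quad) : Continuous Q.coordT := by unfold coordT; fun_prop

lemma continuous_coordU (Q : Quad) : Continuous Q.coordU := by
  have := Q.continuous_coordT
  unfold coordU; fun_prop

lemma coordT_combo {a b : ℝ} (h : a + b = 1) (x y : Plane) :
    Q.coordT (a • x + b • y) = a * Q.coordT x + b * Q.coordT y := by
  obtain rfl : b = 1 - a := by linarith
  simp only [coordT, PiLp.add_apply, PiLp.smul_apply, smul_eq_mul]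
  ring

lemma coordU_combo {a b : ℝ} (h : a + b = 1) (x y : Plane) :
    Q.coordU (a • x + b • y) = a * Q.coordU x + b * Q.coordU y := by
  simp only [coordU, coordT_combo h]
  obtain rfl : b = 1 - a := by linarith
  simp only [PiLp.add_apply, PiLp.smul_apply, smul_eq_mul]
  ring

lemma chart_add_sub (a t b t' d t'' : ℝ) :
    Q.chart a t + (Q.chart b t' - Q.chart d t'') = Q.chart (a + (b - d)) (t + (t' - t'')) := by
  simp only [chart]; module

lemma chart_add_smul_sub (c a t b t' d t'' : ℝ) :
    Q.chart a t + c • (Q.chart b t' - Q.chart d t'') =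
      Q.chart (a + c * (b - d)) (t + c * (t' - t'')) := by
  simp only [chart]; module

lemma midpoint_chart (a t b t' : ℝ) :
    midpoint ℝ (Q.chart a t) (Q.chart b t') = Q.chart ((a + b) / 2) ((t + t') / 2) := by
  rw [midpoint_eq_smul_add]
  simp only [chart, invOf_eq_inv]; module

lemma chart_sub_chart (a t b t' : ℝ) :
    Q.chart a t - Q.chart b t' = (a - b) • (Q.B - Q.A) + (t - t') • (Q.D - Q.A) := by
  simp only [chart]; module

lemma dist_chart (a b t : ℝ) : dist (Q.chart a t) (Q.chart b t) = |a - b| * dist Q.A Q.B := by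
  rw [dist_eq_norm, chart_sub_chart, sub_self, zero_smul, add_zero, norm_smul, Real.norm_eq_abs,
    dist_comm, dist_eq_norm]

/-- A trapezium with horizontal bases is described by two inequalities for the height and one for
each of the other two sides. -/
lemma IsCell.mem_conv_chart (hQ : Q.IsCell) {a b a' b' t t' : ℝ} (hab : a < b) (hab' : a' < b')
    (ht : t < t') (x : Plane) :
    x ∈ (Quad.mk (Q.chart a t) (Q.chart b t) (Q.chart b' t') (Q.chart a' t')).conv ↔
      t ≤ Q.coordT x ∧ Q.coordT x ≤ t' ∧
      a + (a' - a) / (t' - t) * (Q.coordT x - t) ≤ Q.coordU x ∧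
      Q.coordU x ≤ b + (b' - b) / (t' - t) * (Q.coordT x - t) := by
  have htt : t' - t ≠ 0 := (sub_pos.2 ht).ne'
  constructor
  · intro hx
    have hsub : convexHull ℝ {Q.chart a t, Q.chart b t, Q.chart b' t', Q.chart a' t'} ⊆
        {x | t ≤ Q.coordT x ∧ Q.coordT x ≤ t' ∧
          a + (a' - a) / (t' - t) * (Q.coordT x - t) ≤ Q.coordU x ∧
          Q.coordU x ≤ b + (b' - b) / (t' - t) * (Q.coordT x - t)} := by
      refine convexHull_min ?_ ?_
      · have e1 : a + (a' - a) / (t' - t) * (t' - t) = a' := by field_simp; ring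
        have e2 : b + (b' - b) / (t' - t) * (t' - t) = b' := by field_simp; ring
        rintro y (rfl | rfl | rfl | rfl) <;>
          simp only [mem_ofPred_eq, hQ.coordT_chart, hQ.coordU_chart, e1, e2, sub_self, mul_zero,
            add_zero] <;> refine ⟨?_, ?_, ?_, ?_⟩ <;> linarith
      · rintro x ⟨x1, x2, x3, x4⟩ y ⟨y1, y2, y3, y4⟩ c d hc hd hcd
        simp only [mem_ofPred_eq, coordT_combo hcd, coordU_combo hcd]
        have := mul_le_mul_of_nonneg_left x1 hc
        have := mul_le_mul_of_nonneg_left x2 hc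
        have := mul_le_mul_of_nonneg_left x3 hc
        have := mul_le_mul_of_nonneg_left x4 hc
        have := mul_le_mul_of_nonneg_left y1 hd
        have := mul_le_mul_of_nonneg_left y2 hd
        have := mul_le_mul_of_nonneg_left y3 hd
        have := mul_le_mul_of_nonneg_left y4 hd
        obtain rfl : d = 1 - c := by linarith
        refine ⟨?_, ?_, ?_, ?_⟩ <;> linarith
    exact hsub hx
  · rintro ⟨h1, h2, h3, h4⟩
    set u := Q.coordU x with hu
    set τ := Q.coordT x with hτ
    -- The point is the combination with weight `θ` of a point of the lower base and a point of the
    -- upper base, both taken at the same proportion `c` of their bases.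
    set θ := (τ - t) / (t' - t) with hθ
    have hθ0 : 0 ≤ θ := div_nonneg (by linarith) (by linarith)
    have hθ1 : θ ≤ 1 := (div_le_one (by linarith)).2 (by linarith)
    have e3 : a + (a' - a) / (t' - t) * (τ - t) = (1 - θ) * a + θ * a' := by
      rw [hθ]; field_simp; ring
    have e4 : b + (b' - b) / (t' - t) * (τ - t) = (1 - θ) * b + θ * b' := by
      rw [hθ]; field_simp; ring
    have e5 : τ = (1 - θ) * t + θ * t' := by rw [hθ]; field_simp; ring
    rw [e3] at h3
    rw [e4] at h4
    set l := (1 - θ) * a + θ * a' with hl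
    set r := (1 - θ) * b + θ * b' with hr
    have hlr : 0 < r - l := by
      rw [hl, hr]
      rcases hθ0.eq_or_lt with h | h
      · rw [← h]; linarith
      · have := mul_le_mul_of_nonneg_left hab.le (sub_nonneg.2 hθ1)
        have := mul_lt_mul_of_pos_left hab' h
        linarith
    set c := (u - l) / (r - l) with hcdef
    have hc0 : 0 ≤ c := div_nonneg (by linarith) hlr.le
    have hc1 : c ≤ 1 := (div_le_one hlr).2 (by linarith)
    have e6 : u = l + c * (r - l) := by rw [hcdef]; field_simp; ring
    have hconv : Convex ℝ (Quad.mk (Q.chart a t) (Q.chart b t) (Q.chart b' t')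
        (Q.chart a' t')).conv :=
      convex_convexHull _ _
    have hv := subset_convexHull ℝ {Q.chart a t, Q.chart b t, Q.chart b' t', Q.chart a' t'}
    have hlow := hconv (hv (by simp : Q.chart a t ∈ _)) (hv (by simp : Q.chart b t ∈ _))
      (sub_nonneg.2 hc1) hc0 (by ring)
    have hup := hconv (hv (by simp : Q.chart a' t' ∈ _)) (hv (by simp : Q.chart b' t' ∈ _))
      (sub_nonneg.2 hc1) hc0 (by ring)
    have hfin := hconv hlow hup (sub_nonneg.2 hθ1) hθ0 (by ring)
    convert hfin using 1
    rw [← hQ.chart_coord x, ← hu, ← hτ, e5, e6, hl, hr]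
    simp only [chart]
    module

/-- The horizontal affine coordinate, at height `τ`, of the trajectory that starts at the parameter
`s` of the lower base. -/
def flowCoord (κ s τ : ℝ) : ℝ := s - (1 - κ) * CantorFlow.cdf s τ

/-- The point at relative height `τ` of the trajectory that starts at the parameter `s` of the
lower base. -/
def flow (Q : Quad) (s τ : ℝ) : Plane := Q.chart (flowCoord Q.contraction s τ) τ

/-- The quadrilateral whose vertices are the images under the flow of the vertices of the rectangle
`[K / 4ᴺ, (K + 1) / 4ᴺ] × [M / 2ᴺ, (M + 1) / 2ᴺ]`. -/
def gridCell (Q : Quad) (N K M : ℕ) : Quad :=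
  ⟨Q.flow (K / 4 ^ N) (M / 2 ^ N), Q.flow ((K + 1) / 4 ^ N) (M / 2 ^ N),
    Q.flow ((K + 1) / 4 ^ N) ((M + 1) / 2 ^ N), Q.flow (K / 4 ^ N) ((M + 1) / 2 ^ N)⟩

lemma flowCoord_sub_le {κ : ℝ} (hκ : κ ≤ 1) {s s' : ℝ} (h0 : 0 ≤ s) (h : s ≤ s') (τ : ℝ) :
    flowCoord κ s' τ - flowCoord κ s τ ≤ s' - s := by
  simp only [flowCoord, CantorFlow.cdf_add h0 h]
  nlinarith [CantorFlow.lowMass_nonneg s s' τ]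

lemma le_flowCoord_sub {κ : ℝ} (hκ : κ ≤ 1) {s s' : ℝ} (h0 : 0 ≤ s) (h : s ≤ s') (τ : ℝ) :
    κ * (s' - s) ≤ flowCoord κ s' τ - flowCoord κ s τ := by
  simp only [flowCoord, CantorFlow.cdf_add h0 h]
  nlinarith [CantorFlow.lowMass_le h τ]

lemma flowCoord_strictMonoOn {κ : ℝ} (h0 : 0 < κ) (h1 : κ ≤ 1) (τ : ℝ) :
    StrictMonoOn (fun s => flowCoord κ s τ) (Ici 0) := fun s hs s' _ h => by
  have := le_flowCoord_sub h1 hs h.le τ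
  have : 0 < κ * (s' - s) := mul_pos h0 (sub_pos.2 h)
  change flowCoord κ s τ < flowCoord κ s' τ
  linarith

lemma flowCoord_grid_affine (κ : ℝ) (N K M : ℕ) {τ : ℝ} (h0 : M / 2 ^ N ≤ τ)
    (h1 : τ ≤ (M + 1) / 2 ^ N) :
    flowCoord κ (K / 4 ^ N) τ = flowCoord κ (K / 4 ^ N) (M / 2 ^ N) +
      (flowCoord κ (K / 4 ^ N) ((M + 1) / 2 ^ N) - flowCoord κ (K / 4 ^ N) (M / 2 ^ N)) /
        ((M + 1) / 2 ^ N - M / 2 ^ N) * (τ - M / 2 ^ N) := by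
  obtain ⟨p, hp⟩ := CantorFlow.exists_slope N M K
  have hd : (M : ℝ) / 2 ^ N < (M + 1) / 2 ^ N := by gcongr; linarith
  simp only [flowCoord]
  have : ((M : ℝ) + 1) / 2 ^ N - M / 2 ^ N ≠ 0 := (sub_pos.2 hd).ne'
  rw [hp τ h0 h1, hp _ hd.le le_rfl]
  field_simp
  ring

lemma IsCell.mem_conv_gridCell (hQ : Q.IsCell) (hc : Q.Compressible) {N K M : ℕ} {x : Plane} :
    x ∈ (Q.gridCell N K M).conv ↔ M / 2 ^ N ≤ Q.coordT x ∧ Q.coordT x ≤ (M + 1) / 2 ^ N ∧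
      flowCoord Q.contraction (K / 4 ^ N) (Q.coordT x) ≤ Q.coordU x ∧
      Q.coordU x ≤ flowCoord Q.contraction ((K + 1) / 4 ^ N) (Q.coordT x) := by
  have hκ := hQ.contraction_lt_one hc
  have hm := fun τ => flowCoord_strictMonoOn hQ.contraction_pos hκ.le τ
  have hd : (M : ℝ) / 2 ^ N < (M + 1) / 2 ^ N := by gcongr; linarith
  have hk : (K : ℝ) / 4 ^ N < (K + 1) / 4 ^ N := by gcongr; linarith
  have hk0 : (0 : ℝ) ≤ K / 4 ^ N := by positivity
  unfold gridCell flow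
  rw [hQ.mem_conv_chart (hm _ hk0 (hk0.trans hk.le) hk) (hm _ hk0 (hk0.trans hk.le) hk) hd]
  refine and_congr_right fun h1 => and_congr_right fun h2 => ?_
  have e := flowCoord_grid_affine Q.contraction N (K + 1) M h1 h2
  push_cast at e
  rw [flowCoord_grid_affine Q.contraction N K M h1 h2, e]

/-- A grid cell is the image under the flow of the corresponding rectangle. -/
lemma IsCell.flow_mem_conv_gridCell (hQ : Q.IsCell) (hc : Q.Compressible) {N K M : ℕ} {s τ : ℝ}
    (hs : 0 ≤ s) :
    Q.flow s τ ∈ (Q.gridCell N K M).conv ↔ (K / 4 ^ N ≤ s ∧ s ≤ (K + 1) / 4 ^ N) ∧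
      M / 2 ^ N ≤ τ ∧ τ ≤ (M + 1) / 2 ^ N := by
  have hm := flowCoord_strictMonoOn hQ.contraction_pos (hQ.contraction_lt_one hc).le τ
  have hk0 : (0 : ℝ) ≤ K / 4 ^ N := by positivity
  have hk1 : (0 : ℝ) ≤ (K + 1) / 4 ^ N := by positivity
  rw [hQ.mem_conv_gridCell hc, flow, hQ.coordT_chart, hQ.coordU_chart]
  rw [hm.le_iff_le hk0 hs, hm.le_iff_le hs hk1]
  tauto

lemma IsCell.flow_mem_interior_gridCell (hQ : Q.IsCell) (hc : Q.Compressible) {N K M : ℕ} {s τ : ℝ}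
    (h1 : K / 4 ^ N < s) (h2 : s < (K + 1) / 4 ^ N) (h3 : M / 2 ^ N < τ)
    (h4 : τ < (M + 1) / 2 ^ N) : Q.flow s τ ∈ interior (Q.gridCell N K M).conv := by
  have hκ := hQ.contraction_lt_one hc
  have hm := fun τ => flowCoord_strictMonoOn hQ.contraction_pos hκ.le τ
  have hk0 : (0 : ℝ) ≤ K / 4 ^ N := by positivity
  obtain ⟨p, hp⟩ := CantorFlow.exists_slope N M K
  obtain ⟨q, hq⟩ := CantorFlow.exists_slope N M (K + 1)
  push_cast at hq
  have hc1 := Q.continuous_coordT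
  have hc2 := Q.continuous_coordU
  set κ := Q.contraction
  rw [mem_interior]
  refine ⟨{x | M / 2 ^ N < Q.coordT x ∧ Q.coordT x < (M + 1) / 2 ^ N ∧
    (K : ℝ) / 4 ^ N - (1 - κ) * (CantorFlow.cdf (K / 4 ^ N) (M / 2 ^ N)
      + p * (Q.coordT x - M / 2 ^ N)) < Q.coordU x ∧
    Q.coordU x < ((K : ℝ) + 1) / 4 ^ N - (1 - κ) * (CantorFlow.cdf ((K + 1) / 4 ^ N) (M / 2 ^ N)
      + q * (Q.coordT x - M / 2 ^ N))}, ?_, ?_, ?_⟩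
  · rintro x ⟨a, b, c, d⟩
    rw [hQ.mem_conv_gridCell hc, flowCoord, flowCoord, hp _ a.le b.le, hq _ a.le b.le]
    exact ⟨a.le, b.le, c.le, d.le⟩
  · refine IsOpen.and ?_ (IsOpen.and ?_ (IsOpen.and ?_ ?_)) <;> refine isOpen_lt ?_ ?_ <;> fun_prop
  · simp only [mem_ofPred_eq, flow, hQ.coordT_chart, hQ.coordU_chart]
    rw [← hp _ h3.le h4.le, ← hq _ h3.le h4.le]
    exact ⟨h3, h4, hm τ hk0 (hk0.trans h1.le) h1,
      hm τ (hk0.trans h1.le) (hk0.trans (h1.trans h2).le) h2⟩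

lemma IsCell.chart_contraction_one (hQ : Q.IsCell) : Q.chart Q.contraction 1 = Q.C := by
  have := hQ.width_ne
  ext i
  fin_cases i
  · change Q.chart Q.contraction 1 0 = Q.C 0
    rw [chart_apply_zero, contraction]; field_simp; ring
  · change Q.chart Q.contraction 1 1 = Q.C 1
    rw [hQ.chart_apply_one, height, hQ.upper_base]; ring

lemma IsCell.gridCell_zero (hQ : Q.IsCell) : Q.gridCell 0 0 0 = Q := by
  have hC : Q.flow 1 1 = Q.C := by
    rw [flow, flowCoord, CantorFlow.cdf_one, CantorFlow.clamp_of_one_le le_rfl,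
      ← hQ.chart_contraction_one]
    congr 1; ring
  have hA : Q.flow 0 0 = Q.A := by simp [flow, flowCoord, chart, CantorFlow.cdf_zero]
  have hB : Q.flow 1 0 = Q.B := by
    simp [flow, flowCoord, chart, CantorFlow.cdf_one, CantorFlow.clamp_of_nonpos le_rfl]
  have hD : Q.flow 0 1 = Q.D := by simp [flow, flowCoord, chart, CantorFlow.cdf_zero]
  simp [gridCell, hA, hB, hC, hD]

lemma continuousOn_flowCoord {κ : ℝ} (τ : ℝ) (hκ : κ ≤ 1) (h0 : 0 ≤ κ) :
    ContinuousOn (fun s => flowCoord κ s τ) (Ici 0) := by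
  refine (LipschitzOnWith.of_dist_le_mul (K := 1) fun s hs s' hs' => ?_).continuousOn
  wlog h : s ≤ s' generalizing s s'
  · rw [dist_comm, dist_comm s]; exact this _ hs' _ hs (le_of_not_ge h)
  have h1 := flowCoord_sub_le hκ hs h τ
  have h2 := le_flowCoord_sub hκ hs h τ
  have : 0 ≤ κ * (s' - s) := mul_nonneg h0 (sub_nonneg.2 h)
  rw [dist_comm, dist_comm s, Real.dist_eq, Real.dist_eq, abs_of_nonneg (by linarith),
    abs_of_nonneg (by linarith)]
  simpa using h1

/-- The flow maps the open unit square onto the domain. -/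
lemma IsCell.mem_domain_iff (hQ : Q.IsCell) (hc : Q.Compressible) {x : Plane} :
    x ∈ Q.domain ↔ ∃ s ∈ Ioo (0 : ℝ) 1, ∃ τ ∈ Ioo (0 : ℝ) 1, Q.flow s τ = x := by
  constructor
  · intro hx
    have hx' := hx
    rw [domain, mem_interior_iff_mem_nhds, ← hQ.gridCell_zero] at hx
    have hv : ∀ v : Plane, ∃ δ > 0, ∀ ε : ℝ, |ε| < δ → x + ε • v ∈ (Q.gridCell 0 0 0).conv := by
      intro v
      have hcont : Tendsto (fun ε : ℝ => x + ε • v) (𝓝 0) (𝓝 x) :=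
        Continuous.tendsto' (by fun_prop) _ _ (by simp)
      obtain ⟨δ, hδ, h⟩ := Metric.eventually_nhds_iff.1 (hcont hx)
      exact ⟨δ, hδ, fun ε hε => h (by simpa [Real.dist_eq] using hε)⟩
    have hκ := hQ.contraction_lt_one hc
    have e1 : ∀ τ, flowCoord Q.contraction 0 τ = 0 := fun τ => by simp
        [flowCoord, CantorFlow.cdf_zero]
    simp only [hQ.mem_conv_gridCell hc] at hv
    norm_num [e1] at hv
    have hx2 := hQ.chart_coord x
    have hT : ∀ a b : ℝ, Q.coordT (x + a • (Q.B - Q.A) + b • (Q.D - Q.A)) = Q.coordT x + b := by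
      intro a b
      conv_lhs => rw [← hx2]
      rw [show Q.chart (Q.coordU x) (Q.coordT x) + a • (Q.B - Q.A) + b • (Q.D - Q.A) =
        Q.chart (Q.coordU x + a) (Q.coordT x + b) by simp only [chart]; module, hQ.coordT_chart]
    have hU : ∀ a b : ℝ, Q.coordU (x + a • (Q.B - Q.A) + b • (Q.D - Q.A)) = Q.coordU x + a := by
      intro a b
      conv_lhs => rw [← hx2]
      rw [show Q.chart (Q.coordU x) (Q.coordT x) + a • (Q.B - Q.A) + b • (Q.D - Q.A) =
        Q.chart (Q.coordU x + a) (Q.coordT x + b) by simp only [chart]; module, hQ.coordU_chart]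
    -- Moving the point slightly along `AD` and along `AB` within the closed cell makes the four
    -- inequalities strict.
    obtain ⟨δ, hδ, h⟩ := hv (Q.D - Q.A)
    have h1 := h (δ / 2) (by rw [abs_of_pos (by linarith)]; linarith)
    have h2 := h (-(δ / 2)) (by rw [abs_neg, abs_of_pos (by linarith)]; linarith)
    have t1 := hT 0 (δ / 2)
    have t2 := hT 0 (-(δ / 2))
    simp only [zero_smul, add_zero] at t1 t2
    obtain ⟨δ', hδ', h'⟩ := hv (Q.B - Q.A)
    have h3 := h' (δ' / 2) (by rw [abs_of_pos (by linarith)]; linarith)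
    have h4 := h' (-(δ' / 2)) (by rw [abs_neg, abs_of_pos (by linarith)]; linarith)
    have t3 := hT (δ' / 2) 0
    have t4 := hT (-(δ' / 2)) 0
    have u3 := hU (δ' / 2) 0
    have u4 := hU (-(δ' / 2)) 0
    simp only [zero_smul, add_zero] at t3 t4 u3 u4
    rw [t1] at h1
    rw [t2] at h2
    rw [t3, u3] at h3
    rw [t4, u4] at h4
    have hT0 : Q.coordT x ∈ Ioo (0 : ℝ) 1 := ⟨by linarith [h2.1], by linarith [h1.2.1]⟩
    have hiv := intermediate_value_Ioo (zero_le_one' ℝ)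
      ((continuousOn_flowCoord (Q.coordT x) hκ.le hQ.contraction_pos.le).mono Icc_subset_Ici_self)
    obtain ⟨s, hs, hsu⟩ := hiv (a := Q.coordU x)
        ⟨by rw [e1]; linarith [h4.2.2.1], by linarith [h3.2.2.2]⟩
    change flowCoord _ s _ = _ at hsu
    exact ⟨s, hs, _, hT0, by rw [flow, hsu, hx2]⟩
  · rintro ⟨s, hs, τ, hτ, rfl⟩
    have := hQ.flow_mem_interior_gridCell hc (N := 0) (K := 0) (M := 0) (s := s) (τ := τ)
      (by simpa using hs.1) (by simpa using hs.2) (by simpa using hτ.1) (by simpa using hτ.2)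
    rwa [hQ.gridCell_zero] at this

lemma IsCell.flow_inj (hQ : Q.IsCell) (hc : Q.Compressible) {s s' τ τ' : ℝ} (hs : 0 ≤ s)
    (hs' : 0 ≤ s') (h : Q.flow s τ = Q.flow s' τ') : s = s' ∧ τ = τ' := by
  obtain ⟨h1, rfl⟩ := hQ.chart_inj h
  exact ⟨(flowCoord_strictMonoOn hQ.contraction_pos (hQ.contraction_lt_one hc).le τ).injOn hs hs'
      h1,
    rfl⟩

end Quad

/-! ### The subdivision as the image of a grid -/

namespace Quad

open CantorFlow

variable {Q : Quad}

lemma heightIndex_child (n K j : ℕ) (hj : j < 4) :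
    heightIndex (n + 1) (4 * K + j) = 2 * heightIndex n K + if Even j then 1 else 0 := by
  have h1 : (4 * K + j) / 4 = K := by omega
  have h2 : Even (4 * K + j) ↔ Even j := by
    simp only [Nat.even_add, (((by decide : Even 4).mul_right K)), true_iff]
  rw [heightIndex, h1]
  simp only [h2]

/-- The values of the flow at the nodes of the `4 × 2` subdivision of a compressible cell: the left
side is halved, and to the right of it every quarter has been crossed fully, or not at all, at each
of the three heights. At half height the `j / 2` odd quarters among the first `j` have been
crossed. -/
lemma flowCoord_child (κ : ℝ) (n K j e : ℕ) (hj : j ≤ 4) (he : e ≤ 2) :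
    flowCoord κ ((4 * K + j : ℕ) / 4 ^ (n + 1)) ((2 * heightIndex n K + e : ℕ) / 2 ^ (n + 1)) =
      (1 - e / 2) * flowCoord κ (K / 4 ^ n) (heightIndex n K / 2 ^ n) +
        e / 2 * flowCoord κ (K / 4 ^ n) ((heightIndex n K + 1) / 2 ^ n) +
        (j - (1 - κ) * if e = 0 then 0 else if e = 1 then (j / 2 : ℕ) else j) / 4 ^ (n + 1) := by
  obtain ⟨p, hp⟩ := exists_slope n (heightIndex n K) K
  set m := heightIndex n K with hm
  have h2 : (0 : ℝ) < 2 ^ n := by positivity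
  have e0 : ((4 * K : ℕ) : ℝ) / 4 ^ (n + 1) = K / 4 ^ n := by push_cast; rw [pow_succ]; field_simp
  have step : ∀ i, i < 4 → cdf ((4 * K + (i + 1) : ℕ) / 4 ^ (n + 1))
      ((2 * m + e : ℕ) / 2 ^ (n + 1)) =
      cdf ((4 * K + i : ℕ) / 4 ^ (n + 1)) ((2 * m + e : ℕ) / 2 ^ (n + 1)) +
        clamp (e - if Even i then 1 else 0) / 4 ^ (n + 1) := by
    intro i hi
    have := cdf_succ (n + 1) (4 * K + i) ((2 * m + e : ℕ) / 2 ^ (n + 1))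
    rw [heightIndex_child n K i hi, ← hm] at this
    rw [← add_assoc, this]
    congr 3
    rw [mul_div_cancel₀ _ (by positivity)]
    push_cast
    ring
  have eτ : ((2 * m + e : ℕ) : ℝ) / 2 ^ (n + 1) = m / 2 ^ n + e / 2 / 2 ^ n := by
    push_cast; rw [pow_succ]; field_simp
  have he' : (e : ℝ) / 2 ≤ 1 := by
    have : (e : ℝ) ≤ 2 := by exact_mod_cast he
    linarith
  have hmid : cdf (K / 4 ^ n) ((2 * m + e : ℕ) / 2 ^ (n + 1)) =
      (1 - e / 2) * cdf (K / 4 ^ n) (m / 2 ^ n) + e / 2 * cdf (K / 4 ^ n) ((m + 1) / 2 ^ n) := by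
    rw [eτ, hp ((m + 1) / 2 ^ n) (by gcongr; linarith) le_rfl, hp]
    · field_simp; ring
    · have : (0 : ℝ) ≤ e / 2 / 2 ^ n := by positivity
      linarith
    · rw [← add_div]; gcongr
  have s0 := step 0 (by norm_num)
  have s1 := step 1 (by norm_num)
  have s2 := step 2 (by norm_num)
  have s3 := step 3 (by norm_num)
  simp only [add_zero, zero_add, Nat.reduceAdd] at s0 s1 s2 s3
  rw [e0, hmid] at s0
  have ej : ((4 * K + j : ℕ) : ℝ) / 4 ^ (n + 1) = K / 4 ^ n + j / 4 ^ (n + 1) := by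
    push_cast; rw [pow_succ]; field_simp
  have c0 : clamp 0 = 0 := clamp_of_nonpos le_rfl
  have c1 : clamp 1 = 1 := clamp_of_one_le le_rfl
  have c2 : clamp 2 = 1 := clamp_of_one_le (by norm_num)
  have c3 : clamp (-1) = 0 := clamp_of_nonpos (by norm_num)
  have f1 : clamp (2 - 1) = 1 := clamp_of_one_le (by norm_num)
  have n1 : ¬ Even 1 := by decide
  have n3 : ¬ Even 3 := by decide
  have n2 : Even 2 := by decide
  simp only [flowCoord]
  interval_cases e <;> interval_cases j <;>
    simp [n1, n2, n3, c0, c1, c2, c3, f1] at s0 s1 s2 s3 hmid e0 ⊢ <;>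
    simp only [s0, s1, s2, s3, hmid, e0] <;> (try simp only [pow_succ]) <;> field_simp <;> ring

/-- The image under the flow of the node `(j, e)`, with `j ≤ 4` and `e ≤ 2`, of the `4 × 2`
subdivision of the `K`-th compressible cell of generation `n`. -/
def node (Q : Quad) (n K j e : ℕ) : Plane :=
  Q.flow ((4 * K + j : ℕ) / 4 ^ (n + 1)) ((2 * heightIndex n K + e : ℕ) / 2 ^ (n + 1))

lemma node_eq_chart (n K j e : ℕ) (hj : j ≤ 4) (he : e ≤ 2) : Q.node n K j e =
    Q.chart ((1 - e / 2) * flowCoord Q.contraction (K / 4 ^ n) (heightIndex n K / 2 ^ n) +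
        e / 2 * flowCoord Q.contraction (K / 4 ^ n) ((heightIndex n K + 1) / 2 ^ n) +
        (j - (1 - Q.contraction) * if e = 0 then 0 else if e = 1 then (j / 2 : ℕ) else j) *
          (1 / 4 ^ (n + 1))) (heightIndex n K / 2 ^ n + e * (1 / 2 ^ (n + 1))) := by
  rw [node, flow, flowCoord_child _ _ _ _ _ hj he, ← div_eq_mul_one_div]
  congr 1
  push_cast; rw [pow_succ]; field_simp

lemma gridCell_eq_node (n K : ℕ) : Q.gridCell n K (heightIndex n K) =
    ⟨Q.node n K 0 0, Q.node n K 4 0, Q.node n K 4 2, Q.node n K 0 2⟩ := by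
  have e0 : ((4 * K + 0 : ℕ) : ℝ) / 4 ^ (n + 1) = K / 4 ^ n := by
    push_cast; rw [pow_succ]; field_simp; ring
  have e4 : ((4 * K + 4 : ℕ) : ℝ) / 4 ^ (n + 1) = (K + 1) / 4 ^ n := by
    push_cast; rw [pow_succ]; field_simp
  have f0 : ((2 * heightIndex n K + 0 : ℕ) : ℝ) / 2 ^ (n + 1) = heightIndex n K / 2 ^ n := by
    push_cast; rw [pow_succ]; field_simp; ring
  have f2 : ((2 * heightIndex n K + 2 : ℕ) : ℝ) / 2 ^ (n + 1) = (heightIndex n K + 1) / 2 ^ n := by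
    push_cast; rw [pow_succ]; field_simp
  simp only [node, gridCell, e0, e4, f0, f2]

lemma gridCell_child_eq_node (n K j e : ℕ) :
    Q.gridCell (n + 1) (4 * K + j) (2 * heightIndex n K + e) =
    ⟨Q.node n K j e, Q.node n K (j + 1) e, Q.node n K (j + 1) (e + 1), Q.node n K j (e + 1)⟩ := by
  simp only [node, gridCell]
  push_cast
  simp only [add_assoc]

section Points
variable (n K : ℕ)

lemma ptL_gridCell : (Q.gridCell n K (heightIndex n K)).ptL = Q.node n K 1 0 := by
  rw [gridCell_eq_node, ptL]
  simp only [node_eq_chart, chart_add_smul_sub, Nat.reduceLeDiff, zero_le]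
  norm_num
  congr 1; ring

lemma ptM_gridCell : (Q.gridCell n K (heightIndex n K)).ptM = Q.node n K 2 0 := by
  rw [gridCell_eq_node, ptM]
  simp only [node_eq_chart, chart_add_smul_sub, Nat.reduceLeDiff, zero_le]
  norm_num
  congr 1; ring

lemma ptN_gridCell : (Q.gridCell n K (heightIndex n K)).ptN = Q.node n K 3 0 := by
  rw [gridCell_eq_node, ptN]
  simp only [node_eq_chart, chart_add_smul_sub, Nat.reduceLeDiff, zero_le]
  norm_num
  congr 1; ring

lemma ptE_gridCell : (Q.gridCell n K (heightIndex n K)).ptE = Q.node n K 1 2 := by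
  rw [gridCell_eq_node, ptE]
  simp only [node_eq_chart, chart_add_smul_sub, Nat.reduceLeDiff, zero_le]
  norm_num
  congr 1; ring

lemma ptF_gridCell : (Q.gridCell n K (heightIndex n K)).ptF = Q.node n K 2 2 := by
  rw [gridCell_eq_node, ptF]
  simp only [node_eq_chart, chart_add_smul_sub, Nat.reduceLeDiff, zero_le]
  norm_num
  congr 1; ring

lemma ptG_gridCell : (Q.gridCell n K (heightIndex n K)).ptG = Q.node n K 3 2 := by
  rw [gridCell_eq_node, ptG]
  simp only [node_eq_chart, chart_add_smul_sub, Nat.reduceLeDiff, zero_le]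
  norm_num
  congr 1; ring

lemma ptU_gridCell : (Q.gridCell n K (heightIndex n K)).ptU = Q.node n K 0 1 := by
  rw [gridCell_eq_node, ptU]
  simp only [node_eq_chart, midpoint_chart, Nat.reduceLeDiff, zero_le]
  norm_num
  congr 1 <;> ring

lemma ptV_gridCell : (Q.gridCell n K (heightIndex n K)).ptV = Q.node n K 4 1 := by
  rw [gridCell_eq_node, ptV]
  simp only [node_eq_chart, midpoint_chart, Nat.reduceLeDiff, zero_le]
  norm_num
  congr 1 <;> ring

lemma ptX_gridCell : (Q.gridCell n K (heightIndex n K)).ptX = Q.node n K 1 1 := by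
  rw [ptX, ptU_gridCell, ptL_gridCell, gridCell_eq_node]
  simp only [node_eq_chart, chart_add_sub, Nat.reduceLeDiff, zero_le]; norm_num

lemma ptY_gridCell : (Q.gridCell n K (heightIndex n K)).ptY = Q.node n K 2 1 := by
  rw [ptY, ptX_gridCell, ptF_gridCell, ptE_gridCell]
  simp only [node_eq_chart, chart_add_sub, Nat.reduceLeDiff]; norm_num
  congr 1; ring

lemma ptZ_gridCell : (Q.gridCell n K (heightIndex n K)).ptZ = Q.node n K 3 1 := by
  rw [ptZ, ptY_gridCell, ptN_gridCell, ptM_gridCell]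
  simp only [node_eq_chart, chart_add_sub, Nat.reduceLeDiff, zero_le]; norm_num
  congr 1; ring

lemma lowerParts_gridCell : (Q.gridCell n K (heightIndex n K)).lowerParts =
    [Q.gridCell (n + 1) (4 * K + 0) (2 * heightIndex n K + 0),
      Q.gridCell (n + 1) (4 * K + 2) (2 * heightIndex n K + 0)] := by
  simp only [lowerParts, ptL_gridCell, ptX_gridCell, ptU_gridCell, ptM_gridCell, ptN_gridCell,
    ptZ_gridCell, ptY_gridCell, gridCell_child_eq_node]
  rw [gridCell_eq_node]

lemma upperParts_gridCell : (Q.gridCell n K (heightIndex n K)).upperParts =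
    [Q.gridCell (n + 1) (4 * K + 1) (2 * heightIndex n K + 1),
      Q.gridCell (n + 1) (4 * K + 3) (2 * heightIndex n K + 1)] := by
  simp only [upperParts, ptX_gridCell, ptE_gridCell, ptF_gridCell, ptG_gridCell, ptV_gridCell,
    ptZ_gridCell, ptY_gridCell, gridCell_child_eq_node]
  rw [gridCell_eq_node]

lemma compressibleParts_gridCell : (Q.gridCell n K (heightIndex n K)).compressibleParts =
    [Q.gridCell (n + 1) (4 * K + 0) (heightIndex (n + 1) (4 * K + 0)),
      Q.gridCell (n + 1) (4 * K + 1) (heightIndex (n + 1) (4 * K + 1)),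
      Q.gridCell (n + 1) (4 * K + 2) (heightIndex (n + 1) (4 * K + 2)),
      Q.gridCell (n + 1) (4 * K + 3) (heightIndex (n + 1) (4 * K + 3))] := by
  rw [heightIndex_child n K 0 (by norm_num), heightIndex_child n K 1 (by norm_num),
    heightIndex_child n K 2 (by norm_num), heightIndex_child n K 3 (by norm_num),
    if_pos (by decide), if_neg (by decide), if_pos (by decide), if_neg (by decide)]
  simp only [compressibleParts, ptX_gridCell, ptE_gridCell, ptF_gridCell, ptG_gridCell,
      ptV_gridCell,
    ptZ_gridCell, ptY_gridCell, ptL_gridCell, ptM_gridCell, ptN_gridCell, ptU_gridCell,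
    gridCell_child_eq_node]
  rw [gridCell_eq_node]

end Points

lemma flowCoord_grid_succ (κ : ℝ) (N K : ℕ) (τ : ℝ) :
    flowCoord κ ((K + 1) / 4 ^ N) τ - flowCoord κ (K / 4 ^ N) τ =
      (1 - (1 - κ) * clamp (2 ^ N * τ - heightIndex N K)) / 4 ^ N := by
  have := cdf_succ N K τ
  push_cast at this
  rw [flowCoord, flowCoord, this]
  ring

lemma dist_lower_gridCell (N K M : ℕ) (hκ : Q.contraction ≤ 1) (hκ0 : 0 ≤ Q.contraction) :
    dist (Q.gridCell N K M).A (Q.gridCell N K M).B =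
      (1 - (1 - Q.contraction) * clamp ((M : ℝ) - heightIndex N K)) / 4 ^ N * dist Q.A Q.B := by
  have h0 := clamp_nonneg ((M : ℝ) - heightIndex N K)
  have h1 := clamp_le_one ((M : ℝ) - heightIndex N K)
  rw [gridCell, dist_comm]
  dsimp only
  rw [flow, flow, dist_chart, flowCoord_grid_succ, mul_div_cancel₀ _ (by positivity), abs_of_nonneg]
  refine div_nonneg ?_ (by positivity)
  nlinarith

lemma dist_upper_gridCell (N K M : ℕ) (hκ : Q.contraction ≤ 1) (hκ0 : 0 ≤ Q.contraction) :
    dist (Q.gridCell N K M).C (Q.gridCell N K M).D =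
      (1 - (1 - Q.contraction) * clamp ((M : ℝ) + 1 - heightIndex N K)) / 4 ^ N * dist Q.A Q.B := by
  have h0 := clamp_nonneg ((M : ℝ) + 1 - heightIndex N K)
  have h1 := clamp_le_one ((M : ℝ) + 1 - heightIndex N K)
  rw [gridCell]
  dsimp only
  rw [flow, flow, dist_chart, flowCoord_grid_succ, mul_div_cancel₀ _ (by positivity), abs_of_nonneg]
  refine div_nonneg ?_ (by positivity)
  nlinarith

/-- A grid cell is compressible precisely when its strip is the one in which the crossings of its
base-4 interval take place. -/
lemma IsCell.compressible_gridCell (hQ : Q.IsCell) (hc : Q.Compressible) (N K M : ℕ) :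
    (Q.gridCell N K M).Compressible ↔ M = heightIndex N K := by
  have hκ := hQ.contraction_lt_one hc
  have hκ0 := hQ.contraction_pos
  have hd := hQ.dist_pos
  rw [Compressible, dist_lower_gridCell _ _ _ hκ.le hκ0.le, dist_upper_gridCell _ _ _ hκ.le hκ0.le]
  rcases lt_trichotomy M (heightIndex N K) with h | h | h
  · have h' : (M : ℝ) + 1 ≤ heightIndex N K := by exact_mod_cast h
    rw [clamp_of_nonpos (by linarith), clamp_of_nonpos (by linarith)]
    simp [h.ne]
  · rw [← h, sub_self, add_sub_cancel_left, clamp_of_nonpos le_rfl, clamp_of_one_le le_rfl]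
    simp only [iff_true]
    have : (0 : ℝ) < 4 ^ N := by positivity
    rw [mul_lt_mul_iff_left₀ hd, div_lt_div_iff_of_pos_right this]
    linarith
  · have h' : (heightIndex N K : ℝ) + 1 ≤ M := by exact_mod_cast h
    rw [clamp_of_one_le (by linarith), clamp_of_one_le (by linarith)]
    simp [h.ne']

/-- The grid cell of index `(N, K, M)` is a lower incompressible cell created in generation `N`: it
lies in an even quarter, just below the compressible cell of that quarter. -/
def IsLowerIndex (N K M : ℕ) : Prop := 1 ≤ N ∧ K < 4 ^ N ∧ Even K ∧ M + 1 = heightIndex N K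

/-- The grid cell of index `(N, K, M)` is an upper incompressible cell created in generation `N`:
it lies in an odd quarter, just above the compressible cell of that quarter. -/
def IsUpperIndex (N K M : ℕ) : Prop := 1 ≤ N ∧ K < 4 ^ N ∧ ¬ Even K ∧ M = heightIndex N K + 1

lemma exists_lowerIndex_succ (n : ℕ) (R : Quad) :
    (∃ N ≤ n + 1, ∃ K M, IsLowerIndex N K M ∧ R = Q.gridCell N K M) ↔
    (∃ N ≤ n, ∃ K M, IsLowerIndex N K M ∧ R = Q.gridCell N K M) ∨
      ∃ K < 4 ^ n, R ∈ (Q.gridCell n K (heightIndex n K)).lowerParts := by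
  simp only [lowerParts_gridCell, List.mem_cons, List.not_mem_nil, or_false]
  constructor
  · rintro ⟨N, hN, K, M, h, rfl⟩
    rcases Nat.lt_or_ge n N with hn | hn
    · obtain rfl : N = n + 1 := by omega
      obtain ⟨-, h2, h3, h4⟩ := h
      refine Or.inr ⟨K / 4, by rw [pow_succ] at h2; omega, ?_⟩
      rw [heightIndex, if_pos h3] at h4
      obtain rfl : M = 2 * heightIndex n (K / 4) := by omega
      have : K = 4 * (K / 4) + 0 ∨ K = 4 * (K / 4) + 2 := by rw [Nat.even_iff] at h3; omega
      rcases this with h | h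
      · left; rw [← h, add_zero]
      · right; rw [← h, add_zero]
    · exact Or.inl ⟨N, hn, K, M, h, rfl⟩
  · rintro (⟨N, hN, K, M, h, rfl⟩ | ⟨K, hK, rfl | rfl⟩)
    · exact ⟨N, by omega, K, M, h, rfl⟩
    · exact ⟨n + 1, le_rfl, _, _, ⟨by omega, by rw [pow_succ]; omega, by rw [Nat.even_iff]; omega,
        by rw [heightIndex_child n K 0 (by norm_num)]; simp⟩, rfl⟩
    · exact ⟨n + 1, le_rfl, _, _, ⟨by omega, by rw [pow_succ]; omega, by rw [Nat.even_iff]; omega,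
        by rw [heightIndex_child n K 2 (by norm_num)]; simp⟩, rfl⟩

lemma exists_upperIndex_succ (n : ℕ) (R : Quad) :
    (∃ N ≤ n + 1, ∃ K M, IsUpperIndex N K M ∧ R = Q.gridCell N K M) ↔
    (∃ N ≤ n, ∃ K M, IsUpperIndex N K M ∧ R = Q.gridCell N K M) ∨
      ∃ K < 4 ^ n, R ∈ (Q.gridCell n K (heightIndex n K)).upperParts := by
  simp only [upperParts_gridCell, List.mem_cons, List.not_mem_nil, or_false]
  constructor
  · rintro ⟨N, hN, K, M, h, rfl⟩
    rcases Nat.lt_or_ge n N with hn | hn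
    · obtain rfl : N = n + 1 := by omega
      obtain ⟨-, h2, h3, h4⟩ := h
      refine Or.inr ⟨K / 4, by rw [pow_succ] at h2; omega, ?_⟩
      rw [heightIndex, if_neg h3] at h4
      obtain rfl : M = 2 * heightIndex n (K / 4) + 1 := by omega
      have : K = 4 * (K / 4) + 1 ∨ K = 4 * (K / 4) + 3 := by rw [Nat.even_iff] at h3; omega
      rcases this with h | h
      · left; rw [← h]
      · right; rw [← h]
    · exact Or.inl ⟨N, hn, K, M, h, rfl⟩
  · rintro (⟨N, hN, K, M, h, rfl⟩ | ⟨K, hK, rfl | rfl⟩)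
    · exact ⟨N, by omega, K, M, h, rfl⟩
    · exact ⟨n + 1, le_rfl, _, _, ⟨by omega, by rw [pow_succ]; omega, by rw [Nat.even_iff]; omega,
        by rw [heightIndex_child n K 1 (by norm_num)]; simp⟩, rfl⟩
    · exact ⟨n + 1, le_rfl, _, _, ⟨by omega, by rw [pow_succ]; omega, by rw [Nat.even_iff]; omega,
        by rw [heightIndex_child n K 3 (by norm_num), if_neg (by decide)]⟩, rfl⟩

lemma exists_compressibleIndex_succ (n : ℕ) (R : Quad) :
    (∃ K < 4 ^ (n + 1), R = Q.gridCell (n + 1) K (heightIndex (n + 1) K)) ↔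
      ∃ K < 4 ^ n, R ∈ (Q.gridCell n K (heightIndex n K)).compressibleParts := by
  simp only [compressibleParts_gridCell, List.mem_cons, List.not_mem_nil, or_false]
  constructor
  · rintro ⟨K, hK, rfl⟩
    refine ⟨K / 4, by rw [pow_succ] at hK; omega, ?_⟩
    have : K = 4 * (K / 4) + 0 ∨ K = 4 * (K / 4) + 1 ∨ K = 4 * (K / 4) + 2 ∨ K = 4 * (K / 4) + 3
        := by
      omega
    rcases this with h | h | h | h
    · left; rw [← h]
    · right; left; rw [← h]
    · right; right; left; rw [← h]
    · right; right; right; rw [← h]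
  · have hlt : ∀ K j, K < 4 ^ n → j < 4 → 4 * K + j < 4 ^ (n + 1) := fun K j h h' => by
      rw [pow_succ]; omega
    rintro ⟨K, hK, h | h | h | h⟩
    · exact ⟨_, hlt K 0 hK (by norm_num), h⟩
    · exact ⟨_, hlt K 1 hK (by norm_num), h⟩
    · exact ⟨_, hlt K 2 hK (by norm_num), h⟩
    · exact ⟨_, hlt K 3 hK (by norm_num), h⟩

/-- The cells of `P_n`: the compressible grid cells of generation `n`, and the incompressible ones
created in the generations up to `n`. -/
lemma IsCell.mem_cells (hQ : Q.IsCell) (hc : Q.Compressible) (n : ℕ) (R : Quad) :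
    R ∈ Q.cells n ↔ (∃ K < 4 ^ n, R = Q.gridCell n K (heightIndex n K)) ∨
      (∃ N ≤ n, ∃ K M, IsLowerIndex N K M ∧ R = Q.gridCell N K M) ∨
      ∃ N ≤ n, ∃ K M, IsUpperIndex N K M ∧ R = Q.gridCell N K M := by
  induction n generalizing R with
  | zero =>
    simp only [cells, List.mem_singleton, pow_zero, Nat.lt_one_iff, exists_eq_left, heightIndex,
      hQ.gridCell_zero, IsLowerIndex, IsUpperIndex]
    constructor
    · exact Or.inl
    · rintro (h | ⟨N, hN, K, M, h, -⟩ | ⟨N, hN, K, M, h, -⟩)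
      · exact h
      · omega
      · omega
  | succ n ih =>
    rw [exists_lowerIndex_succ, exists_upperIndex_succ, exists_compressibleIndex_succ]
    simp only [cells, List.mem_flatMap]
    constructor
    · rintro ⟨R', hR', hR⟩
      rcases (ih R').1 hR' with ⟨K, hK, rfl⟩ | ⟨N, hN, K, M, h, rfl⟩ | ⟨N, hN, K, M, h, rfl⟩
      · rw [patch, if_pos ((hQ.compressible_gridCell hc _ _ _).2 rfl), List.mem_append,
          List.mem_append] at hR
        rcases hR with (hR | hR) | hR
        · exact Or.inr (Or.inl (Or.inr ⟨K, hK, hR⟩))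
        · exact Or.inr (Or.inr (Or.inr ⟨K, hK, hR⟩))
        · exact Or.inl ⟨K, hK, hR⟩
      · rw [patch, if_neg (by rw [hQ.compressible_gridCell hc]; have := h.2.2.2; omega),
          List.mem_singleton] at hR
        exact Or.inr (Or.inl (Or.inl ⟨N, hN, K, M, h, hR⟩))
      · rw [patch, if_neg (by rw [hQ.compressible_gridCell hc]; have := h.2.2.2; omega),
          List.mem_singleton] at hR
        exact Or.inr (Or.inr (Or.inl ⟨N, hN, K, M, h, hR⟩))
    · have hcomp : ∀ K < 4 ^ n, R ∈ (Q.gridCell n K (heightIndex n K)).lowerParts ++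
          (Q.gridCell n K (heightIndex n K)).upperParts ++
          (Q.gridCell n K (heightIndex n K)).compressibleParts → ∃ a ∈ Q.cells n, R ∈ a.patch := by
        intro K hK h
        refine ⟨_, (ih _).2 (Or.inl ⟨K, hK, rfl⟩), ?_⟩
        rwa [patch, if_pos ((hQ.compressible_gridCell hc _ _ _).2 rfl)]
      simp only [List.mem_append] at hcomp
      rintro (⟨K, hK, h⟩ | (⟨N, hN, K, M, h, rfl⟩ | ⟨K, hK, h⟩) | ⟨N, hN, K, M, h, rfl⟩ |
          ⟨K, hK, h⟩)
      · exact hcomp K hK (Or.inr h)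
      · refine ⟨_, (ih _).2 (Or.inr (Or.inl ⟨N, hN, K, M, h, rfl⟩)), ?_⟩
        rw [patch, if_neg (by rw [hQ.compressible_gridCell hc]; have := h.2.2.2; omega)]
        simp
      · exact hcomp K hK (Or.inl (Or.inl h))
      · refine ⟨_, (ih _).2 (Or.inr (Or.inr ⟨N, hN, K, M, h, rfl⟩)), ?_⟩
        rw [patch, if_neg (by rw [hQ.compressible_gridCell hc]; have := h.2.2.2; omega)]
        simp
      · exact hcomp K hK (Or.inl (Or.inr h))

lemma IsCell.mem_compressibleCells (hQ : Q.IsCell) (hc : Q.Compressible) (n : ℕ) (R : Quad) :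
    R ∈ Q.compressibleCells n ↔ ∃ K < 4 ^ n, R = Q.gridCell n K (heightIndex n K) := by
  rw [compressibleCells, List.mem_filter, hQ.mem_cells hc]
  simp only [decide_eq_true_eq]
  constructor
  · rintro ⟨h | ⟨N, hN, K, M, h, rfl⟩ | ⟨N, hN, K, M, h, rfl⟩, h'⟩
    · exact h
    · rw [hQ.compressible_gridCell hc] at h'; have := h.2.2.2; omega
    · rw [hQ.compressible_gridCell hc] at h'; have := h.2.2.2; omega
  · rintro ⟨K, hK, rfl⟩
    exact ⟨Or.inl ⟨K, hK, rfl⟩, (hQ.compressible_gridCell hc _ _ _).2 rfl⟩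

lemma IsCell.mem_lowerCells (hQ : Q.IsCell) (hc : Q.Compressible) (n : ℕ) (R : Quad) :
    R ∈ Q.lowerCells n ↔ ∃ N ≤ n, ∃ K M, IsLowerIndex N K M ∧ R = Q.gridCell N K M := by
  induction n with
  | zero =>
    simp only [lowerCells, List.not_mem_nil, false_iff]
    rintro ⟨N, hN, K, M, h, -⟩
    have := h.1
    omega
  | succ n ih =>
    rw [exists_lowerIndex_succ, lowerCells, List.mem_append, ih, List.mem_flatMap]
    simp only [hQ.mem_compressibleCells hc]
    refine or_congr_right ⟨?_, ?_⟩
    · rintro ⟨_, ⟨K, hK, rfl⟩, h⟩; exact ⟨K, hK, h⟩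
    · rintro ⟨K, hK, h⟩; exact ⟨_, ⟨K, hK, rfl⟩, h⟩

lemma IsCell.mem_upperCells (hQ : Q.IsCell) (hc : Q.Compressible) (n : ℕ) (R : Quad) :
    R ∈ Q.upperCells n ↔ ∃ N ≤ n, ∃ K M, IsUpperIndex N K M ∧ R = Q.gridCell N K M := by
  induction n with
  | zero =>
    simp only [upperCells, List.not_mem_nil, false_iff]
    rintro ⟨N, hN, K, M, h, -⟩
    have := h.1
    omega
  | succ n ih =>
    rw [exists_upperIndex_succ, upperCells, List.mem_append, ih, List.mem_flatMap]
    simp only [hQ.mem_compressibleCells hc]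
    refine or_congr_right ⟨?_, ?_⟩
    · rintro ⟨_, ⟨K, hK, rfl⟩, h⟩; exact ⟨K, hK, h⟩
    · rintro ⟨K, hK, h⟩; exact ⟨_, ⟨K, hK, rfl⟩, h⟩

end Quad

/-! ### Slopes of the distribution function -/

namespace CantorFlow

/-- The slope of the distribution function `cdf (K / 4ᴺ)` on the `M`-th strip of generation `N`. -/
def cdfSlope (N K M : ℕ) : ℝ :=
  2 ^ N * (cdf (K / 4 ^ N) ((M + 1) / 2 ^ N) - cdf (K / 4 ^ N) (M / 2 ^ N))

lemma cdf_grid_sub (N K M : ℕ) {τ τ' : ℝ} (h0 : M / 2 ^ N ≤ τ) (h1 : τ ≤ (M + 1) / 2 ^ N)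
    (h0' : M / 2 ^ N ≤ τ') (h1' : τ' ≤ (M + 1) / 2 ^ N) :
    cdf (K / 4 ^ N) τ' - cdf (K / 4 ^ N) τ = cdfSlope N K M * (τ' - τ) := by
  obtain ⟨p, hp⟩ := exists_slope N M K
  rw [cdfSlope, hp _ h0 h1, hp _ h0' h1', hp ((M + 1) / 2 ^ N) (h0.trans h1) le_rfl]
  field_simp
  ring

lemma cdf_sub_eq {N K M : ℕ} {s τ τ' : ℝ} (hs0 : K / 4 ^ N ≤ s)
    (h0 : M / 2 ^ N ≤ τ) (h1 : τ ≤ (M + 1) / 2 ^ N)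
    (h0' : M / 2 ^ N ≤ τ') (h1' : τ' ≤ (M + 1) / 2 ^ N) :
    cdf s τ' - cdf s τ = cdfSlope N K M * (τ' - τ) +
      (lowMass (K / 4 ^ N) s τ' - lowMass (K / 4 ^ N) s τ) := by
  rw [← cdf_grid_sub N K M h0 h1 h0' h1', cdf_add (by positivity) hs0, cdf_add (by positivity) hs0]
  ring

/-- On a grid rectangle of generation `N`, the difference quotients of the distribution function in
`τ` are determined up to `2⁻ᴺ`. -/
lemma slope_cdf_mem {N K M : ℕ} {s τ τ' : ℝ} (hs0 : K / 4 ^ N ≤ s) (hs1 : s ≤ (K + 1) / 4 ^ N)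
    (h0 : M / 2 ^ N ≤ τ) (h1 : τ ≤ (M + 1) / 2 ^ N)
    (h0' : M / 2 ^ N ≤ τ') (h1' : τ' ≤ (M + 1) / 2 ^ N) (hne : τ' ≠ τ) :
    slope (cdf s) τ τ' ∈ Icc (cdfSlope N K M) (cdfSlope N K M + 1 / 2 ^ N) := by
  wlog h : τ < τ' generalizing τ τ'
  · rw [slope_comm]
    exact this h0' h1' h0 h1 hne.symm (lt_of_le_of_ne (not_lt.1 h) hne)
  have hpos : 0 < τ' - τ := sub_pos.2 h
  have e := cdf_sub_eq hs0 h0 h1 h0' h1'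
  have l0 := lowMass_mono (K / 4 ^ N) s h.le
  have l1 := lowMass_sub_le_of_piece le_rfl hs0 hs1 h.le
  rw [slope_def_field, mem_Icc, le_div_iff₀ hpos, div_le_iff₀ hpos, e]
  constructor
  · linarith
  · rw [add_mul, one_div_mul_eq_div]; linarith

/-- On a grid rectangle without crossings, the distribution function is affine in `τ` with a slope
that does not depend on the parameter. -/
lemma slope_cdf_eq {N K M : ℕ} {s τ τ' : ℝ} (hs0 : K / 4 ^ N ≤ s) (hs1 : s ≤ (K + 1) / 4 ^ N)
    (hM : M ≠ heightIndex N K)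
    (h0 : M / 2 ^ N ≤ τ) (h1 : τ ≤ (M + 1) / 2 ^ N)
    (h0' : M / 2 ^ N ≤ τ') (h1' : τ' ≤ (M + 1) / 2 ^ N) (hne : τ' ≠ τ) :
    slope (cdf s) τ τ' = cdfSlope N K M := by
  have e := cdf_sub_eq hs0 h0 h1 h0' h1'
  have hpos : τ' - τ ≠ 0 := sub_ne_zero.2 hne
  have hz : lowMass (K / 4 ^ N) s τ' = lowMass (K / 4 ^ N) s τ := by
    rcases lt_or_gt_of_ne hM with h | h
    · have hle : ((M : ℝ) + 1) / 2 ^ N ≤ heightIndex N K / 2 ^ N := by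
        gcongr; exact_mod_cast h
      rw [lowMass_eq_zero le_rfl hs0 hs1 (h1.trans hle), lowMass_eq_zero le_rfl hs0 hs1
          (h1'.trans hle)]
    · have hle : (heightIndex N K + 1 : ℝ) / 2 ^ N ≤ M / 2 ^ N := by
        gcongr; exact_mod_cast h
      rw [lowMass_eq_sub le_rfl hs0 hs1 (hle.trans h0), lowMass_eq_sub le_rfl hs0 hs1
          (hle.trans h0')]
  rw [slope_def_field, e, hz]
  field_simp
  ring

/-- Nonnegative dyadic rationals. -/
def IsDyadic (τ : ℝ) : Prop := ∃ n m : ℕ, τ = m / 2 ^ n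

lemma countable_isDyadic : {τ | IsDyadic τ}.Countable := by
  have : {τ | IsDyadic τ} ⊆ ⋃ n : ℕ, ⋃ m : ℕ, {(m : ℝ) / 2 ^ n} := by
    rintro τ ⟨n, m, h⟩
    simp only [mem_iUnion, mem_singleton_iff]
    exact ⟨n, m, h⟩
  exact (countable_iUnion fun n => countable_iUnion fun m => countable_singleton _).mono this

lemma exists_strip {τ : ℝ} (h0 : 0 ≤ τ) (hd : ¬ IsDyadic τ) (N : ℕ) :
    ∃ M : ℕ, M / 2 ^ N < τ ∧ τ < (M + 1) / 2 ^ N := by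
  have h2 : (0 : ℝ) < 2 ^ N := by positivity
  refine ⟨⌊2 ^ N * τ⌋₊, lt_of_le_of_ne ?_ fun h => hd ⟨N, _, h.symm⟩, ?_⟩
  · rw [div_le_iff₀ h2, mul_comm τ]; exact Nat.floor_le (by positivity)
  · rw [lt_div_iff₀ h2, mul_comm τ]; exact Nat.lt_floor_add_one _

lemma exists_piece {s : ℝ} (h0 : 0 ≤ s) (h1 : s < 1) (N : ℕ) :
    ⌊4 ^ N * s⌋₊ < 4 ^ N ∧ (⌊4 ^ N * s⌋₊ : ℝ) / 4 ^ N ≤ s ∧ s < (⌊4 ^ N * s⌋₊ + 1 : ℝ) / 4 ^ N := by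
  have h2 : (0 : ℝ) < 4 ^ N := by positivity
  refine ⟨?_, ?_, ?_⟩
  · rw [Nat.floor_lt (by positivity)]
    push_cast
    nlinarith
  · rw [div_le_iff₀ h2, mul_comm s]; exact Nat.floor_le (by positivity)
  · rw [lt_div_iff₀ h2, mul_comm s]; exact Nat.lt_floor_add_one _

/-- At a height that is not dyadic, the distribution function is differentiable in `τ`: it lies in
the interior of a strip of every generation, and these confine the difference quotients to
intervals of length `2⁻ᴺ`. -/
lemma hasDerivAt_cdf {s τ : ℝ} (hs0 : 0 ≤ s) (hs1 : s < 1) (h0 : 0 ≤ τ) (hd : ¬ IsDyadic τ) :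
    HasDerivAt (cdf s) (deriv (cdf s) τ) τ := by
  suffices ∃ g, HasDerivAt (cdf s) g τ from this.choose_spec.differentiableAt.hasDerivAt
  simp only [hasDerivAt_iff_tendsto_slope]
  rw [← cauchy_map_iff_exists_tendsto]
  refine Metric.cauchy_iff.2 ⟨inferInstance, fun ε hε => ?_⟩
  obtain ⟨N, hN⟩ := exists_pow_lt_of_lt_one hε (by norm_num : (1 / 2 : ℝ) < 1)
  obtain ⟨M, hM0, hM1⟩ := exists_strip h0 hd N
  obtain ⟨-, hK0, hK1⟩ := exists_piece hs0 hs1 N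
  refine ⟨Icc (cdfSlope N ⌊4 ^ N * s⌋₊ M) (cdfSlope N ⌊4 ^ N * s⌋₊ M + 1 / 2 ^ N), ?_, ?_⟩
  · rw [mem_map]
    filter_upwards [self_mem_nhdsWithin, nhdsWithin_le_nhds (Ioo_mem_nhds hM0 hM1)] with τ' hne hτ'
    exact slope_cdf_mem hK0 hK1.le hM0.le hM1.le hτ'.1.le hτ'.2.le hne
  · rintro x ⟨hx0, hx1⟩ y ⟨hy0, hy1⟩
    refine lt_of_le_of_lt ?_ hN
    rw [Real.dist_eq, abs_le, one_div_pow]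
    constructor <;> linarith

lemma deriv_cdf_mem {N K M : ℕ} {s τ : ℝ} (h0s : 0 ≤ s) (hs1' : s < 1) (hs0 : K / 4 ^ N ≤ s)
    (hs1 : s ≤ (K + 1) / 4 ^ N) (hd : ¬ IsDyadic τ)
    (h0 : M / 2 ^ N ≤ τ) (h1 : τ ≤ (M + 1) / 2 ^ N) :
    deriv (cdf s) τ ∈ Icc (cdfSlope N K M) (cdfSlope N K M + 1 / 2 ^ N) ∧
      (M ≠ heightIndex N K → deriv (cdf s) τ = cdfSlope N K M) := by
  have h0' : M / 2 ^ N < τ := lt_of_le_of_ne h0 fun h => hd ⟨N, M, h.symm⟩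
  have h1' : τ < (M + 1) / 2 ^ N :=
    lt_of_le_of_ne h1 fun h => hd ⟨N, M + 1, by rw [h]; push_cast; rfl⟩
  have hτ : 0 ≤ τ := le_trans (by positivity) h0
  have ht := hasDerivAt_iff_tendsto_slope.1 (hasDerivAt_cdf h0s hs1' hτ hd)
  have hev : ∀ᶠ τ' in 𝓝[≠] τ, τ' ≠ τ ∧ τ' ∈ Ioo ((M : ℝ) / 2 ^ N) ((M + 1) / 2 ^ N) := by
    filter_upwards [self_mem_nhdsWithin, nhdsWithin_le_nhds (Ioo_mem_nhds h0' h1')] with τ' a b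
    exact ⟨a, b⟩
  constructor
  · refine isClosed_Icc.mem_of_tendsto ht (hev.mono fun τ' h => ?_)
    exact slope_cdf_mem hs0 hs1 h0 h1 h.2.1.le h.2.2.le h.1
  · intro hM
    refine tendsto_nhds_unique ht (tendsto_const_nhds.congr' (hev.mono fun τ' h => ?_))
    exact (slope_cdf_eq hs0 hs1 hM h0 h1 h.2.1.le h.2.2.le h.1).symm

end CantorFlow

/-! ### The approximating fields and their limit -/

namespace Quad

open CantorFlow

variable {Q : Quad}

/-- The velocity, at unit vertical speed, of a trajectory at a point where the `τ`-derivative of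
the distribution function is `g`. -/
def velocity (Q : Quad) (g : ℝ) : Plane :=
  Q.height⁻¹ • ((Q.D - Q.A) - ((1 - Q.contraction) * g) • (Q.B - Q.A))

lemma velocity_sub (g g' : ℝ) : Q.velocity g - Q.velocity g' =
    (Q.height⁻¹ * (1 - Q.contraction) * (g' - g)) • (Q.B - Q.A) := by
  simp only [velocity]; module

lemma smul_combo_eq_velocity {a b c g : ℝ} (h1 : c * b = Q.height⁻¹)
    (h2 : c * a = -(Q.height⁻¹ * ((1 - Q.contraction) * g))) :
    c • (a • (Q.B - Q.A) + b • (Q.D - Q.A)) = Q.velocity g := by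
  rw [smul_add, smul_smul _ a, smul_smul _ b, h1, h2, velocity]
  module

/-- The Lipschitz constant of `velocity` as a function of the slope. -/
def speedGap (Q : Quad) : ℝ := Q.height⁻¹ * (1 - Q.contraction) * ‖Q.B - Q.A‖

lemma IsCell.speedGap_nonneg (hQ : Q.IsCell) (hc : Q.Compressible) : 0 ≤ Q.speedGap := by
  have := hQ.height_pos'
  have := sub_pos.2 (hQ.contraction_lt_one hc)
  unfold speedGap
  positivity

lemma IsCell.norm_velocity_sub (hQ : Q.IsCell) (hc : Q.Compressible) (g g' : ℝ) :
    ‖Q.velocity g - Q.velocity g'‖ = Q.speedGap * |g - g'| := by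
  have := hQ.height_pos'
  have := sub_pos.2 (hQ.contraction_lt_one hc)
  rw [velocity_sub, norm_smul, Real.norm_eq_abs, abs_mul, abs_of_pos (by positivity), abs_sub_comm,
    speedGap]
  ring

lemma flow_sub_flow (s τ s' τ' : ℝ) : Q.flow s τ - Q.flow s' τ' =
    (flowCoord Q.contraction s τ - flowCoord Q.contraction s' τ') • (Q.B - Q.A) +
      (τ - τ') • (Q.D - Q.A) := chart_sub_chart _ _ _ _

lemma IsCell.smul_apply_one (hQ : Q.IsCell) (a b : ℝ) :
    (a • (Q.B - Q.A) + b • (Q.D - Q.A)) 1 = b * Q.height := by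
  simp [height, hQ.lower_base]

lemma field_side_gridCell (N K M : ℕ) : (Q.gridCell N K M).D - (Q.gridCell N K M).A =
    (-((1 - Q.contraction) * (cdfSlope N K M / 2 ^ N))) • (Q.B - Q.A) +
      (1 / 2 ^ N : ℝ) • (Q.D - Q.A) := by
  simp only [gridCell, flow_sub_flow, flowCoord, cdfSlope]
  congr 2
  · field_simp; ring
  · ring

/-- The field of a grid cell is a velocity whose slope is the one of the left side of the cell, up
to `2⁻ᴺ`. There is no error on incompressible cells. -/
lemma IsCell.field_gridCell (hQ : Q.IsCell) (hc : Q.Compressible) {N K M : ℕ} {s τ : ℝ}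
    (hs : 0 ≤ s) (hx : Q.flow s τ ∈ (Q.gridCell N K M).conv) :
    ∃ g ∈ Icc (cdfSlope N K M) (cdfSlope N K M + 1 / 2 ^ N),
      (M ≠ heightIndex N K → g = cdfSlope N K M) ∧
        (Q.gridCell N K M).field (Q.flow s τ) = Q.velocity g := by
  have hκ := sub_pos.2 (hQ.contraction_lt_one hc)
  have hκ0 := hQ.contraction_pos
  have hh := hQ.height_pos'
  have h2 : (0 : ℝ) < 2 ^ N := by positivity
  rw [field, if_pos hx]
  obtain ⟨⟨hs0, hs1⟩, ht0, ht1⟩ := (hQ.flow_mem_conv_gridCell hc hs).1 hx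
  by_cases hM : M = heightIndex N K
  · rw [if_pos ((hQ.compressible_gridCell hc _ _ _).2 hM)]
    set κ := Q.contraction with hκdef
    -- `r` is the distance of the point from the left side and `E` the vertical distance from the
    -- apex, both in affine coordinates. The width of the cell at height `τ` is `(1 - κ) * E / 2 ^
    -- N`.
    set r := flowCoord κ s τ - flowCoord κ (K / 4 ^ N) τ with hr
    set E := 1 / 2 ^ N / (1 - κ) - (τ - M / 2 ^ N) with hE
    have hδ : τ - M / 2 ^ N ≤ 1 / 2 ^ N := by rw [add_div] at ht1; linarith
    have hδ0 : 0 ≤ τ - M / 2 ^ N := by linarith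
    have hEpos : 0 < E := by
      have : 1 / 2 ^ N < 1 / 2 ^ N / (1 - κ) := by
        rw [lt_div_iff₀ hκ]
        have : (0 : ℝ) < 1 / 2 ^ N := by positivity
        nlinarith
      linarith
    have hr0 : 0 ≤ r := by
      have := le_flowCoord_sub (κ := κ) (by linarith) (by positivity) hs0 τ
      exact (mul_nonneg hκ0.le (sub_nonneg.2 hs0)).trans this
    have hr1 : r ≤ (1 - κ) * E / 2 ^ N := by
      have h1 := le_flowCoord_sub (κ := κ) (by linarith) hs hs1 τ
      have h1' := mul_nonneg hκ0.le (sub_nonneg.2 hs1)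
      have h3 := flowCoord_grid_succ κ N K τ
      rw [← hM, clamp_of_mem] at h3
      · have e : (1 - (1 - κ) * (2 ^ N * τ - M)) / 4 ^ N = (1 - κ) * E / 2 ^ N := by
          rw [hE, show (4 : ℝ) ^ N = 2 ^ N * 2 ^ N by rw [← mul_pow]; norm_num]
          field_simp
        linarith
      · rw [div_le_iff₀ h2] at ht0; linarith
      · rw [le_div_iff₀ h2] at ht1; linarith
    have hapex : Q.flow s τ - (Q.gridCell N K M).apex =
        (r + (1 - κ) * cdfSlope N K M * E) • (Q.B - Q.A) + (-E) • (Q.D - Q.A) := by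
      have hd : (dist (Q.gridCell N K M).A (Q.gridCell N K M).B /
          (dist (Q.gridCell N K M).A (Q.gridCell N K M).B -
            dist (Q.gridCell N K M).C (Q.gridCell N K M).D)) = 1 / (1 - κ) := by
        have hd := hQ.dist_pos.ne'
        rw [dist_lower_gridCell _ _ _ (by linarith) hκ0.le,
          dist_upper_gridCell _ _ _ (by linarith) hκ0.le, ← hM, sub_self, add_sub_cancel_left,
          clamp_of_nonpos le_rfl, clamp_of_one_le le_rfl, ← hκdef, ← sub_mul, ← sub_div,
          mul_zero, sub_zero, mul_one, sub_sub_cancel, mul_div_mul_right _ _ hd,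
          div_div_div_cancel_right₀ (by positivity)]
      have hA : (Q.gridCell N K M).A = Q.flow (K / 4 ^ N) (M / 2 ^ N) := rfl
      rw [apex, hd, ← sub_sub, field_side_gridCell, hA, flow_sub_flow]
      have hcdf : flowCoord κ s τ - flowCoord κ (K / 4 ^ N) (M / 2 ^ N) =
          r - (1 - κ) * (cdfSlope N K M * (τ - M / 2 ^ N)) := by
        rw [← cdf_grid_sub N K M le_rfl (ht0.trans ht1) ht0 ht1, hr]
        simp only [flowCoord]
        ring
      rw [hcdf, hE, ← hκdef]
      have e1 : (1 - κ) * cdfSlope N K M * (1 / 2 ^ N / (1 - κ) - (τ - M / 2 ^ N)) =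
        1 / (1 - κ) * ((1 - κ) * (cdfSlope N K M / 2 ^ N)) -
          (1 - κ) * (cdfSlope N K M * (τ - M / 2 ^ N)) := by field_simp
      rw [e1, div_eq_mul_one_div (1 / 2 ^ N) (1 - κ)]
      module
    refine ⟨cdfSlope N K M + r / ((1 - κ) * E), ⟨?_, ?_⟩, fun h => absurd hM h, ?_⟩
    · have : 0 ≤ r / ((1 - κ) * E) := by positivity
      linarith
    · refine add_le_add le_rfl ?_
      rw [div_le_iff₀ (by positivity), one_div_mul_eq_div]
      exact hr1
    · rw [hapex, hQ.smul_apply_one]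
      have e : (1 - κ) * (cdfSlope N K M + r / ((1 - κ) * E)) = (r + (1 - κ) * cdfSlope N K M * E)
          / E := by
        field_simp; ring
      refine smul_combo_eq_velocity (by field_simp) ?_
      rw [← hκdef, e]
      field_simp
  · rw [if_neg (by rwa [hQ.compressible_gridCell hc])]
    refine ⟨_, ⟨le_rfl, by linarith [show (0 : ℝ) < 1 / 2 ^ N by positivity]⟩, fun _ => rfl, ?_⟩
    rw [field_side_gridCell, hQ.smul_apply_one]
    exact smul_combo_eq_velocity (by field_simp) (by field_simp)

/-- All cells of `P_n` that contain a given point off the dyadic lines have nearly the same field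
there. Incompressible cells of earlier generations contribute no error, and the compressible ones
are all of generation `n`. -/
lemma IsCell.norm_field_sub_le (hQ : Q.IsCell) (hc : Q.Compressible) {n : ℕ} {R : Quad}
    (hR : R ∈ Q.cells n) {s τ : ℝ} (hs0 : 0 ≤ s) (hs1 : s < 1) (hd : ¬ IsDyadic τ)
    (hx : Q.flow s τ ∈ R.conv) :
    ‖R.field (Q.flow s τ) - Q.velocity (deriv (cdf s) τ)‖ ≤ Q.speedGap / 2 ^ n := by
  have hC := hQ.speedGap_nonneg hc
  have key : ∀ N K M, R = Q.gridCell N K M → (M = heightIndex N K → N = n) →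
      ‖R.field (Q.flow s τ) - Q.velocity (deriv (cdf s) τ)‖ ≤ Q.speedGap / 2 ^ n := by
    rintro N K M rfl hN
    obtain ⟨⟨h1, h2⟩, h3, h4⟩ := (hQ.flow_mem_conv_gridCell hc hs0).1 hx
    obtain ⟨⟨d1, d2⟩, d3⟩ := deriv_cdf_mem hs0 hs1 h1 h2 hd h3 h4
    obtain ⟨g, ⟨g1, g2⟩, g3, hg⟩ := hQ.field_gridCell hc hs0 hx
    rw [hg, hQ.norm_velocity_sub hc]
    by_cases hM : M = heightIndex N K
    · obtain rfl := hN hM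
      rw [div_eq_mul_one_div]
      gcongr
      rw [abs_le]
      constructor <;> linarith
    · rw [g3 hM, d3 hM, sub_self, abs_zero, mul_zero]
      positivity
  rcases (hQ.mem_cells hc n R).1 hR with ⟨K, hK, h⟩ | ⟨N, hN, K, M, h, h'⟩ | ⟨N, hN, K, M, h, h'⟩
  · exact key _ _ _ h fun _ => rfl
  · exact key _ _ _ h' fun e => by have := h.2.2.2; omega
  · exact key _ _ _ h' fun e => by have := h.2.2.2; omega

/-- A point of a trajectory below the compressible cell of generation `n` lies in a lower
incompressible cell: the one created when the compressible cells first leave its height. -/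
lemma exists_lowerIndex_of_lt {s τ : ℝ} (hs0 : 0 ≤ s) (hs1 : s < 1) (h0 : 0 ≤ τ) (n : ℕ)
    (h : τ < heightIndex n ⌊4 ^ n * s⌋₊ / 2 ^ n) :
    ∃ N ≤ n, ∃ M, IsLowerIndex N ⌊4 ^ N * s⌋₊ M ∧ M / 2 ^ N ≤ τ ∧ τ ≤ (M + 1) / 2 ^ N := by
  induction n with
  | zero => simp [heightIndex] at h; linarith
  | succ n ih =>
    by_cases hn : τ < heightIndex n ⌊4 ^ n * s⌋₊ / 2 ^ n
    · obtain ⟨N, hN, h⟩ := ih hn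
      exact ⟨N, by omega, h⟩
    · have hn' := not_lt.1 hn
      have e : heightIndex n ⌊4 ^ n * s⌋₊ / 2 ^ n = 2 * heightIndex n ⌊4 ^ n * s⌋₊ / (2 : ℝ) ^
          (n + 1) := by
        rw [pow_succ]; field_simp
      rw [e] at hn'
      by_cases hev : Even ⌊4 ^ (n + 1) * s⌋₊
      · rw [heightIndex, floor_four_pow_succ_div, if_pos hev] at h
        push_cast at h
        refine ⟨n + 1, le_rfl, 2 * heightIndex n ⌊4 ^ n * s⌋₊,
          ⟨by omega, (exists_piece hs0 hs1 _).1, hev, ?_⟩, ?_, ?_⟩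
        · rw [heightIndex, floor_four_pow_succ_div, if_pos hev]
        · push_cast; exact hn'
        · push_cast; exact h.le
      · rw [heightIndex, floor_four_pow_succ_div, if_neg hev] at h
        push_cast at h
        rw [add_zero] at h
        exact absurd h (not_lt.2 hn')

/-- A point of a trajectory above the compressible cell of generation `n` lies in an upper
incompressible cell. -/
lemma exists_upperIndex_of_gt {s τ : ℝ} (hs0 : 0 ≤ s) (hs1 : s < 1) (h1 : τ ≤ 1) (n : ℕ)
    (h : (heightIndex n ⌊4 ^ n * s⌋₊ + 1) / 2 ^ n < τ) :
    ∃ N ≤ n, ∃ M, IsUpperIndex N ⌊4 ^ N * s⌋₊ M ∧ M / 2 ^ N ≤ τ ∧ τ ≤ (M + 1) / 2 ^ N := by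
  induction n with
  | zero => simp [heightIndex] at h; linarith
  | succ n ih =>
    by_cases hn : (heightIndex n ⌊4 ^ n * s⌋₊ + 1) / 2 ^ n < τ
    · obtain ⟨N, hN, h⟩ := ih hn
      exact ⟨N, by omega, h⟩
    · have hn' := not_lt.1 hn
      have e : (heightIndex n ⌊4 ^ n * s⌋₊ + 1) / 2 ^ n =
          (2 * heightIndex n ⌊4 ^ n * s⌋₊ + 1 + 1) / (2 : ℝ) ^ (n + 1) := by
        rw [pow_succ]; field_simp; ring
      rw [e] at hn'
      by_cases hev : Even ⌊4 ^ (n + 1) * s⌋₊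
      · rw [heightIndex, floor_four_pow_succ_div, if_pos hev] at h
        push_cast at h
        exact absurd h (not_lt.2 hn')
      · rw [heightIndex, floor_four_pow_succ_div, if_neg hev] at h
        push_cast at h
        rw [add_zero] at h
        refine ⟨n + 1, le_rfl, 2 * heightIndex n ⌊4 ^ n * s⌋₊ + 1,
          ⟨by omega, (exists_piece hs0 hs1 _).1, hev, ?_⟩, ?_, ?_⟩
        · rw [heightIndex, floor_four_pow_succ_div, if_neg hev]
        · push_cast; exact h.le
        · push_cast; exact hn'

lemma IsCell.exists_cell (hQ : Q.IsCell) (hc : Q.Compressible) (n : ℕ) {s τ : ℝ} (hs0 : 0 ≤ s)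
    (hs1 : s < 1) (h0 : 0 ≤ τ) (h1 : τ ≤ 1) : ∃ R ∈ Q.cells n, Q.flow s τ ∈ R.conv := by
  have hp := fun N => exists_piece hs0 hs1 N
  simp only [hQ.mem_cells hc]
  rcases lt_or_ge τ (heightIndex n ⌊4 ^ n * s⌋₊ / 2 ^ n) with h | h
  · obtain ⟨N, hN, M, hM, h2, h3⟩ := exists_lowerIndex_of_lt hs0 hs1 h0 n h
    exact ⟨_, Or.inr (Or.inl ⟨N, hN, _, M, hM, rfl⟩),
      (hQ.flow_mem_conv_gridCell hc hs0).2 ⟨⟨(hp N).2.1, (hp N).2.2.le⟩, h2, h3⟩⟩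
  rcases lt_or_ge ((heightIndex n ⌊4 ^ n * s⌋₊ + 1 : ℝ) / 2 ^ n) τ with h' | h'
  · obtain ⟨N, hN, M, hM, h2, h3⟩ := exists_upperIndex_of_gt hs0 hs1 h1 n h'
    exact ⟨_, Or.inr (Or.inr ⟨N, hN, _, M, hM, rfl⟩),
      (hQ.flow_mem_conv_gridCell hc hs0).2 ⟨⟨(hp N).2.1, (hp N).2.2.le⟩, h2, h3⟩⟩
  · exact ⟨_, Or.inl ⟨_, (hp n).1, rfl⟩,
      (hQ.flow_mem_conv_gridCell hc hs0).2 ⟨⟨(hp n).2.1, (hp n).2.2.le⟩, h, h'⟩⟩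

/-- At a covered point, the field of a collection of cells is the average of the fields of the
cells that contain the point. -/
lemma norm_unionField_sub_le {l : List Quad} {x v : Plane} {ε : ℝ}
    (h : ∀ R ∈ l, x ∈ R.conv → ‖R.field x - v‖ ≤ ε) (hex : ∃ R ∈ l, x ∈ R.conv) :
    ‖unionField l x - v‖ ≤ ε := by
  -- At a covered point the maximum with `1` in the definition has no effect.
  have h1 : 1 ≤ (l.map fun R' => R'.conv.indicator (fun _ => (1 : ℝ)) x).sum := by
    obtain ⟨R, hR, hx⟩ := hex
    refine le_trans ?_ (List.single_le_sum ?_ _ (List.mem_map_of_mem hR))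
    · rw [indicator_of_mem hx]
    · intro y hy
      obtain ⟨R', -, rfl⟩ := List.mem_map.1 hy
      exact indicator_nonneg (fun _ _ => zero_le_one) _
  rw [unionField, max_eq_right h1]
  set c := (l.map fun R' => R'.conv.indicator (fun _ => (1 : ℝ)) x).sum with hcdef
  have key : ∀ l : List Quad, (∀ R ∈ l, x ∈ R.conv → ‖R.field x - v‖ ≤ ε) →
      ‖(l.map fun R => (R.conv.indicator (fun _ => (1 : ℝ)) x / c) • R.field x).sum -
        ((l.map fun R => R.conv.indicator (fun _ => (1 : ℝ)) x).sum / c) • v‖ ≤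
        ((l.map fun R => R.conv.indicator (fun _ => (1 : ℝ)) x).sum / c) * ε := by
    intro l
    induction l with
    | nil => simp
    | cons R l ih =>
      intro hl
      have h2 := ih fun R' hR' => hl R' (List.mem_cons_of_mem _ hR')
      simp only [List.map_cons, List.sum_cons]
      have e : ∀ (a b : ℝ) (y z : Plane), (a / c) • y + z - ((a + b) / c) • v =
          (a / c) • (y - v) + (z - (b / c) • v) := fun a b y z => by
        rw [add_div]; module
      rw [e, add_div, add_mul]
      refine (norm_add_le _ _).trans (add_le_add ?_ h2)
      by_cases hx : x ∈ R.conv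
      · rw [indicator_of_mem hx, norm_smul, Real.norm_of_nonneg (by positivity)]
        gcongr
        exact hl R List.mem_cons_self hx
      · simp [indicator_of_notMem hx]
  have := key l h
  rwa [div_self (by linarith), one_smul, one_mul] at this

lemma IsCell.norm_approxField_sub_le (hQ : Q.IsCell) (hc : Q.Compressible) (n : ℕ) {s τ : ℝ}
    (hs0 : 0 ≤ s) (hs1 : s < 1) (h0 : 0 ≤ τ) (h1 : τ ≤ 1) (hd : ¬ IsDyadic τ) :
    ‖Q.approxField n (Q.flow s τ) - Q.velocity (deriv (cdf s) τ)‖ ≤ Q.speedGap / 2 ^ n :=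
  norm_unionField_sub_le (fun _ hR hx => hQ.norm_field_sub_le hc hR hs0 hs1 hd hx)
    (hQ.exists_cell hc n hs0 hs1 h0 h1)

lemma tendsto_const_div_two_pow (C : ℝ) : Tendsto (fun n : ℕ => C / 2 ^ n) atTop (𝓝 0) := by
  have := (tendsto_pow_atTop_nhds_zero_of_lt_one (r := (1 / 2 : ℝ)) (by norm_num)
    (by norm_num)).const_mul C
  simpa [div_eq_mul_inv] using this

lemma IsCell.tendsto_approxField (hQ : Q.IsCell) (hc : Q.Compressible) {s τ : ℝ}
    (hs0 : 0 ≤ s) (hs1 : s < 1) (h0 : 0 ≤ τ) (h1 : τ ≤ 1) (hd : ¬ IsDyadic τ) :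
    Tendsto (fun n => Q.approxField n (Q.flow s τ)) atTop (𝓝 (Q.velocity (deriv (cdf s) τ))) :=
  tendsto_iff_norm_sub_tendsto_zero.2 <| squeeze_zero (fun _ => norm_nonneg _)
    (fun n => hQ.norm_approxField_sub_le hc n hs0 hs1 h0 h1 hd) (tendsto_const_div_two_pow _)

lemma IsCell.limitField_flow (hQ : Q.IsCell) (hc : Q.Compressible) {s τ : ℝ}
    (hs0 : 0 ≤ s) (hs1 : s < 1) (h0 : 0 ≤ τ) (h1 : τ ≤ 1) (hd : ¬ IsDyadic τ) :
    Q.limitField (Q.flow s τ) = Q.velocity (deriv (cdf s) τ) :=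
  (hQ.tendsto_approxField hc hs0 hs1 h0 h1 hd).limUnder_eq

lemma IsCell.flow_apply_one (hQ : Q.IsCell) (s τ : ℝ) : Q.flow s τ 1 = Q.A 1 + τ * Q.height :=
  hQ.chart_apply_one _ _

lemma IsCell.tendstoUniformlyOn_approxField (hQ : Q.IsCell) (hc : Q.Compressible) :
    TendstoUniformlyOn Q.approxField Q.limitField atTop (Q.domain \ Q.dyadicLines) := by
  rw [Metric.tendstoUniformlyOn_iff]
  intro ε hε
  filter_upwards [(tendsto_const_div_two_pow Q.speedGap).eventually (gt_mem_nhds hε)] with n hn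
  rintro x ⟨hx, hxL⟩
  obtain ⟨s, hs, τ, hτ, rfl⟩ := (hQ.mem_domain_iff hc).1 hx
  have hd : ¬ IsDyadic τ := by
    rintro ⟨n, m, rfl⟩
    refine hxL ⟨n, m, ?_, hQ.flow_apply_one _ _⟩
    have := hτ.2
    rw [div_lt_one (by positivity)] at this
    exact_mod_cast this.le
  rw [hQ.limitField_flow hc hs.1.le hs.2 hτ.1.le hτ.2.le hd, dist_comm, dist_eq_norm]
  exact (hQ.norm_approxField_sub_le hc n hs.1.le hs.2 hτ.1.le hτ.2.le hd).trans_lt hn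

/-! ### Flow lines are trajectories of the limit field -/

lemma hasDerivAt_flow {s τ : ℝ} (hs0 : 0 ≤ s) (hs1 : s < 1) (h0 : 0 ≤ τ) (hd : ¬ IsDyadic τ) :
    HasDerivAt (Q.flow s)
      ((Q.D - Q.A) - ((1 - Q.contraction) * deriv (cdf s) τ) • (Q.B - Q.A)) τ := by
  have h := hasDerivAt_cdf hs0 hs1 h0 hd
  have h1 : HasDerivAt (fun τ => flowCoord Q.contraction s τ)
      (-((1 - Q.contraction) * deriv (cdf s) τ)) τ := (h.const_mul _).const_sub s
  refine HasDerivAt.congr_deriv (f := Q.flow s) (((h1.smul_const (Q.B - Q.A)).const_add Q.A).add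
    ((hasDerivAt_id τ).smul_const (Q.D - Q.A))) ?_
  module

/-- The flow line of parameter `s`, parametrized by the height above `AB`. -/
def path (Q : Quad) (s t : ℝ) : Plane := Q.flow s (t / Q.height)

lemma hasDerivAt_path (hQ : Q.IsCell) {s t : ℝ} (hs0 : 0 ≤ s) (hs1 : s < 1) (h0 : 0 ≤ t)
    (hd : ¬ IsDyadic (t / Q.height)) :
    HasDerivAt (Q.path s) (Q.velocity (deriv (cdf s) (t / Q.height))) t := by
  have := hQ.height_pos'
  have h := hasDerivAt_flow (Q := Q) hs0 hs1 (div_nonneg h0 this.le) hd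
  have h' : HasDerivAt (fun t => t / Q.height) (Q.height⁻¹) t := by
    simpa using (hasDerivAt_id t).div_const Q.height
  exact h.scomp t h'

lemma IsCell.norm_flow_sub_le (hQ : Q.IsCell) (hc : Q.Compressible) {s : ℝ} (hs0 : 0 ≤ s)
    (hs1 : s ≤ 1)
    (τ τ' : ℝ) : ‖Q.flow s τ - Q.flow s τ'‖ ≤ (‖Q.B - Q.A‖ + ‖Q.D - Q.A‖) * |τ - τ'| := by
  have hκ := sub_pos.2 (hQ.contraction_lt_one hc)
  have hκ0 := hQ.contraction_pos
  rw [flow_sub_flow]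
  refine (norm_add_le _ _).trans ?_
  rw [norm_smul, norm_smul, add_mul, mul_comm ‖Q.B - Q.A‖, mul_comm ‖Q.D - Q.A‖, Real.norm_eq_abs,
    Real.norm_eq_abs]
  refine add_le_add (mul_le_mul_of_nonneg_right ?_ (norm_nonneg _)) le_rfl
  have e : flowCoord Q.contraction s τ - flowCoord Q.contraction s τ' =
    (1 - Q.contraction) * (cdf s τ' - cdf s τ) := by simp only [flowCoord]; ring
  rw [e, abs_mul, abs_of_pos hκ]
  have := abs_cdf_sub_le hs0 hs1 τ τ'
  rw [abs_sub_comm τ' τ] at this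
  nlinarith [abs_nonneg (cdf s τ' - cdf s τ)]

lemma IsCell.isCrossing_path (hQ : Q.IsCell) (hc : Q.Compressible) {s : ℝ}
    (hs : s ∈ Ioo (0 : ℝ) 1) :
    IsCrossing Q (Q.flow s '' Ioo 0 1) (Q.path s) := by
  have hh := hQ.height_pos'
  have hdiv : ∀ t ∈ Ioo 0 Q.height, t / Q.height ∈ Ioo (0 : ℝ) 1 := fun t ht =>
    ⟨div_pos ht.1 hh, (div_lt_one hh).2 ht.2⟩
  have himage : Q.path s '' Ioo 0 Q.height = Q.flow s '' Ioo 0 1 := by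
    ext x
    constructor
    · rintro ⟨t, ht, rfl⟩; exact ⟨_, hdiv t ht, rfl⟩
    · rintro ⟨τ, hτ, rfl⟩
      refine ⟨τ * Q.height, ⟨mul_pos hτ.1 hh, by nlinarith [hτ.2]⟩, ?_⟩
      rw [path, mul_div_cancel_right₀ _ hh.ne']
  have hlip : ∃ c : NNReal, LipschitzOnWith c (Q.path s) (Ioo 0 Q.height) := by
    refine ⟨((‖Q.B - Q.A‖ + ‖Q.D - Q.A‖) / Q.height).toNNReal,
      LipschitzOnWith.of_dist_le_mul fun t _ t' _ => ?_⟩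
    rw [Real.coe_toNNReal _ (by positivity), dist_eq_norm, Real.dist_eq]
    refine (hQ.norm_flow_sub_le hc hs.1.le hs.2.le _ _).trans (le_of_eq ?_)
    rw [← sub_div, abs_div, abs_of_pos hh]
    ring
  refine ⟨⟨⟨nonempty_Ioo.2 hh, isPreconnected_Ioo⟩, himage, ?_, ?_, ?_, hlip, ?_⟩, ?_⟩
  · rintro x ⟨τ, hτ, rfl⟩
    exact (hQ.mem_domain_iff hc).2 ⟨s, hs, τ, hτ, rfl⟩
  · obtain ⟨c, hl⟩ := hlip
    rw [← himage]
    refine (hl.hausdorffMeasure_image_le zero_le_one).trans_lt ?_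
    rw [hausdorffMeasure_real]
    exact ENNReal.mul_lt_top (by simp) (by simp)
  · intro t _ t' _ h
    have := (hQ.flow_inj hc hs.1.le hs.1.le h).2
    field_simp at this
    exact this
  -- The differential equation may fail at the countably many dyadic heights.
  · have hcount : {t | IsDyadic (t / Q.height)}.Countable := by
      refine (countable_isDyadic.image (· * Q.height)).mono ?_
      intro t ht
      exact ⟨t / Q.height, ht, div_mul_cancel₀ t hh.ne'⟩
    rw [ae_restrict_iff' measurableSet_Ioo]
    filter_upwards [hcount.ae_notMem volume] with t ht hI
    have hτ := hdiv t hI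
    rw [path, hQ.limitField_flow hc hs.1.le hs.2 hτ.1.le hτ.2.le ht]
    exact (hasDerivAt_path hQ hs.1.le hs.2 hI.1.le ht).hasDerivWithinAt
  · intro t ht
    rw [path, hQ.flow_apply_one]
    field_simp

end Quad

/-! ### The area formula in flow coordinates -/

namespace CantorFlow

lemma measurable_cdf : Measurable fun p : ℝ × ℝ => cdf p.1 p.2 := by
  have hT := measurable_crossHeight
  have h1 : MeasurableSet {q : (ℝ × ℝ) × ℝ | 0 ≤ q.2} := measurableSet_le (by fun_prop)
      (by fun_prop)
  have h2 : MeasurableSet {q : (ℝ × ℝ) × ℝ | q.2 < q.1.1} := measurableSet_lt (by fun_prop)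
      (by fun_prop)
  have h3 : MeasurableSet {q : (ℝ × ℝ) × ℝ | crossHeight q.2 ≤ q.1.2} :=
    measurableSet_le (by fun_prop) (by fun_prop)
  have hm := (h1.inter h2).inter h3
  exact (measurable_measure_prodMk_left (ν := volume) hm).ennreal_toReal

/-- The partial derivative in `s` of `flowCoord`: `1` before the crossing and `κ` after it. -/
def jacobian (κ s τ : ℝ) : ℝ := if crossHeight s ≤ τ then κ else 1

lemma measurable_jacobian (κ : ℝ) : Measurable fun p : ℝ × ℝ => jacobian κ p.1 p.2 :=
  Measurable.ite (measurableSet_le (measurable_crossHeight.comp measurable_fst) measurable_snd)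
    measurable_const measurable_const

lemma jacobian_nonneg {κ : ℝ} (h : 0 ≤ κ) (s τ : ℝ) : 0 ≤ jacobian κ s τ := by
  unfold jacobian; split_ifs <;> linarith

end CantorFlow

namespace Quad

open CantorFlow

variable {Q : Quad}

lemma measurable_flowCoord (κ : ℝ) : Measurable fun p : ℝ × ℝ => flowCoord κ p.1 p.2 :=
  measurable_fst.sub (measurable_cdf.const_mul _)

lemma lintegral_jacobian {κ : ℝ} (h0 : 0 ≤ κ) {a : ℝ} (ha : 0 ≤ a) (τ : ℝ) :
    ∫⁻ s in Ioo 0 a, ENNReal.ofReal (jacobian κ s τ) = ENNReal.ofReal (flowCoord κ a τ) := by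
  have hS := measurableSet_crossHeight_le τ
  have e : ∀ s, jacobian κ s τ = 1 - (1 - κ) * {s | crossHeight s ≤ τ}.indicator 1 s := by
    intro s
    by_cases h : crossHeight s ≤ τ
    · rw [indicator_of_mem (by exact h), jacobian, if_pos h]; simp
    · rw [indicator_of_notMem (by exact h), jacobian, if_neg h]; simp
  have hI : Integrable ({s | crossHeight s ≤ τ}.indicator (1 : ℝ → ℝ)) (volume.restrict (Ico 0 a))
      :=
    (integrable_const 1).indicator hS
  rw [Measure.restrict_congr_set Ioo_ae_eq_Ico, ← ofReal_integral_eq_lintegral_ofReal]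
  · simp only [e]
    rw [integral_sub (integrable_const _) (hI.const_mul _), integral_const_mul,
        integral_indicator_one hS,
      measureReal_restrict_apply hS, inter_comm, setIntegral_const, Real.volume_real_Ico_of_le ha,
      flowCoord, cdf, lowMass]
    simp
  · simp only [e]
    exact (integrable_const _).sub (hI.const_mul _)
  · exact ae_of_all _ fun s => jacobian_nonneg h0 s τ

/-- Change of variables on a horizontal slice. -/
lemma map_flowCoord_slice {κ : ℝ} (h0 : 0 < κ) (h1 : κ ≤ 1) (τ : ℝ) :
    ((volume.restrict (Ioo 0 1)).withDensity fun s => ENNReal.ofReal (jacobian κ s τ)).map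
      (fun s => flowCoord κ s τ) = volume.restrict (Ioo 0 (flowCoord κ 1 τ)) := by
  have hm : Measurable fun s => flowCoord κ s τ :=
    (measurable_flowCoord κ).comp measurable_prodMk_right
  have hmono := flowCoord_strictMonoOn h0 h1 τ
  have hz : flowCoord κ 0 τ = 0 := by simp [flowCoord, cdf_zero]
  have key : ∀ a ∈ Icc (0 : ℝ) 1, ∫⁻ s in Ioo 0 a, ENNReal.ofReal (jacobian κ s τ) =
      ENNReal.ofReal (flowCoord κ a τ) := fun a ha => lintegral_jacobian h0.le ha.1 τ
  symm
  -- Both measures are finite, so it suffices to compare their distribution functions.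
  refine Measure.ext_of_Iic _ _ fun v => ?_
  rw [Measure.map_apply hm measurableSet_Iic, withDensity_apply _ (hm measurableSet_Iic),
    Measure.restrict_restrict (hm measurableSet_Iic), Measure.restrict_apply measurableSet_Iic]
  rcases le_or_gt v 0 with hv | hv
  · have e1 : Iic v ∩ Ioo 0 (flowCoord κ 1 τ) = ∅ := by
      ext u; simp only [mem_inter_iff, mem_Iic, mem_Ioo, mem_empty_iff_false, iff_false]; intro h
      linarith [h.1, h.2.1]
    have e2 : (fun s => flowCoord κ s τ) ⁻¹' Iic v ∩ Ioo 0 1 = ∅ := by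
      ext s
      simp only [mem_inter_iff, mem_preimage, mem_Iic, mem_Ioo, mem_empty_iff_false, iff_false]
      rintro ⟨h, hs, -⟩
      have : flowCoord κ 0 τ < flowCoord κ s τ := hmono (mem_Ici.2 le_rfl) (mem_Ici.2 hs.le) hs
      linarith
    simp [e1, e2]
  rcases le_or_gt (flowCoord κ 1 τ) v with hv' | hv'
  · have e1 : Iic v ∩ Ioo 0 (flowCoord κ 1 τ) = Ioo 0 (flowCoord κ 1 τ) :=
      inter_eq_right.2 fun u hu => hu.2.le.trans hv'
    have e2 : (fun s => flowCoord κ s τ) ⁻¹' Iic v ∩ Ioo 0 1 = Ioo 0 1 := by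
      refine inter_eq_right.2 fun s hs => le_trans ?_ hv'
      exact hmono.monotoneOn (mem_Ici.2 hs.1.le) (mem_Ici.2 zero_le_one) hs.2.le
    rw [e1, e2, key 1 (by simp), Real.volume_Ioo, sub_zero]
  · obtain ⟨a, ha, hav⟩ := intermediate_value_Ioo (zero_le_one' ℝ)
      ((continuousOn_flowCoord (κ := κ) τ h1 h0.le).mono Icc_subset_Ici_self)
      (show v ∈ Ioo _ _ from ⟨by rw [hz]; exact hv, hv'⟩)
    change flowCoord κ a τ = v at hav
    have e1 : Iic v ∩ Ioo 0 (flowCoord κ 1 τ) = Ioc 0 v := by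
      ext u; simp only [mem_inter_iff, mem_Iic, mem_Ioo, mem_Ioc]
      exact ⟨fun h => ⟨h.2.1, h.1⟩, fun h => ⟨h.2, h.1, h.2.trans_lt hv'⟩⟩
    have e2 : (fun s => flowCoord κ s τ) ⁻¹' Iic v ∩ Ioo 0 1 = Ioc 0 a := by
      ext s
      simp only [mem_inter_iff, mem_preimage, mem_Iic, mem_Ioo, mem_Ioc, ← hav]
      constructor
      · rintro ⟨h, hs, -⟩
        exact ⟨hs, (hmono.le_iff_le (mem_Ici.2 hs.le) (mem_Ici.2 ha.1.le)).1 h⟩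
      · rintro ⟨hs, h⟩
        exact ⟨(hmono.le_iff_le (mem_Ici.2 hs.le) (mem_Ici.2 ha.1.le)).2 h, hs, h.trans_lt ha.2⟩
    rw [e1, e2, Measure.restrict_congr_set Ioo_ae_eq_Ioc.symm, key a ⟨ha.1.le, ha.2.le⟩, hav,
        Real.volume_Ioc,
      sub_zero]

/-- The domain in affine coordinates. -/
def chartRegion (κ : ℝ) : Set (ℝ × ℝ) := {p | p.2 ∈ Ioo (0 : ℝ) 1 ∧ p.1 ∈ Ioo 0 (flowCoord κ 1 p.2)}

lemma measurableSet_chartRegion (κ : ℝ) : MeasurableSet (chartRegion κ) := by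
  have h1 : Measurable fun p : ℝ × ℝ => flowCoord κ 1 p.2 :=
    (measurable_flowCoord κ).comp (by fun_prop : Measurable fun p : ℝ × ℝ => ((1 : ℝ), p.2))
  exact (measurable_snd measurableSet_Ioo).inter
    ((measurableSet_lt measurable_const measurable_fst).inter (measurableSet_lt measurable_fst h1))

/-- The measure on the unit square, with density `jacobian`, that the flow carries to a multiple of
the area. -/
def flowMeasure (κ : ℝ) : Measure (ℝ × ℝ) :=
  (volume.restrict (Ioo (0 : ℝ) 1 ×ˢ Ioo (0 : ℝ) 1)).withDensity
    fun p => ENNReal.ofReal (jacobian κ p.1 p.2)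

lemma map_flowMeasure {κ : ℝ} (h0 : 0 < κ) (h1 : κ ≤ 1) :
    (flowMeasure κ).map (fun p => (flowCoord κ p.1 p.2, p.2)) = volume.restrict (chartRegion κ) :=
        by
  have hm : Measurable fun p : ℝ × ℝ => (flowCoord κ p.1 p.2, p.2) :=
    (measurable_flowCoord κ).prodMk measurable_snd
  have hj : Measurable fun p : ℝ × ℝ => ENNReal.ofReal (jacobian κ p.1 p.2) :=
    (measurable_jacobian κ).ennreal_ofReal
  ext E hE
  have hR := measurableSet_chartRegion κ
  rw [Measure.map_apply hm hE, Measure.restrict_apply hE, flowMeasure, withDensity_apply _ (hm hE),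
    Measure.volume_eq_prod, Measure.prod_apply_symm (hE.inter hR), ← lintegral_indicator (hm hE),
    ← Measure.prod_restrict,
    lintegral_prod_symm _ ((hj.indicator (hm hE)).aemeasurable)]
  rw [← lintegral_indicator measurableSet_Ioo]
  refine lintegral_congr fun τ => ?_
  have hEτ : MeasurableSet ((fun u : ℝ => (u, τ)) ⁻¹' E) := measurable_prodMk_right hE
  have hmτ : Measurable fun s => flowCoord κ s τ :=
    (measurable_flowCoord κ).comp measurable_prodMk_right
  by_cases hτ : τ ∈ Ioo (0 : ℝ) 1
  · rw [indicator_of_mem hτ]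
    have e : (fun u : ℝ => (u, τ)) ⁻¹' (E ∩ chartRegion κ) =
        ((fun u : ℝ => (u, τ)) ⁻¹' E) ∩ Ioo 0 (flowCoord κ 1 τ) := by
      ext u
      simp only [mem_preimage, mem_inter_iff, chartRegion, mem_ofPred_eq]
      tauto
    rw [e, ← Measure.restrict_apply hEτ, ← map_flowCoord_slice h0 h1, Measure.map_apply hmτ hEτ,
      withDensity_apply _ (hmτ hEτ), ← lintegral_indicator (hmτ hEτ)]
    rfl
  · rw [indicator_of_notMem hτ]
    have e : (fun u : ℝ => (u, τ)) ⁻¹' (E ∩ chartRegion κ) = ∅ := by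
      ext u
      simp only [mem_preimage, mem_inter_iff, chartRegion, mem_ofPred_eq, mem_empty_iff_false]
      tauto
    rw [e, measure_empty]

/-- The affine coordinates as a linear map, given by a triangular matrix, followed by a
translation. -/
lemma IsCell.map_chart (hQ : Q.IsCell) :
    (volume : Measure (ℝ × ℝ)).map (fun p => Q.chart p.1 p.2) =
      ENNReal.ofReal |((Q.B 0 - Q.A 0) * Q.height)⁻¹| • volume := by
  set M : Matrix (Fin 2) (Fin 2) ℝ := !![Q.B 0 - Q.A 0, Q.D 0 - Q.A 0; 0, Q.height] with hM
  have hdet : M.det = (Q.B 0 - Q.A 0) * Q.height := by simp [hM, Matrix.det_fin_two]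
  have hdet0 : M.det ≠ 0 := by
    rw [hdet]; exact mul_ne_zero hQ.width_ne hQ.height_pos'.ne'
  have e : (fun p : ℝ × ℝ => Q.chart p.1 p.2) = (fun x => Q.A + x) ∘
      (WithLp.toLp 2 : (Fin 2 → ℝ) → Plane) ∘
      (Matrix.toLin' M) ∘ MeasurableEquiv.finTwoArrow.symm := by
    ext p i
    fin_cases i
    · simp [chart, hM, Matrix.toLin'_apply, MeasurableEquiv.finTwoArrow]; ring
    · simp [chart, hM, Matrix.toLin'_apply, MeasurableEquiv.finTwoArrow, height, hQ.lower_base]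
  have hL : Measurable (Matrix.toLin' M) := (LinearMap.continuous_of_finiteDimensional _).measurable
  have hT : Measurable (WithLp.toLp 2 : (Fin 2 → ℝ) → Plane) :=
    (PiLp.volume_preserving_toLp (Fin 2)).measurable
  rw [e, ← Measure.map_map (by fun_prop) (hT.comp (hL.comp (MeasurableEquiv.measurable _))),
    ← Measure.map_map hT (hL.comp (MeasurableEquiv.measurable _)),
    ← Measure.map_map hL (MeasurableEquiv.measurable _),
    ((volume_preserving_finTwoArrow ℝ).symm _).map_eq,
    Real.map_matrix_volume_pi_eq_smul_volume_pi hdet0, hdet, Measure.map_smul, Measure.map_smul,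
    (PiLp.volume_preserving_toLp (Fin 2)).map_eq, map_add_left_eq_self]

/-- The absolute value of the Jacobian determinant of the affine coordinates: the area of the
parallelogram spanned by `AB` and `AD`. -/
def area (Q : Quad) : ℝ := |Q.B 0 - Q.A 0| * Q.height

lemma IsCell.area_pos (hQ : Q.IsCell) : 0 < Q.area := mul_pos (abs_pos.2 hQ.width_ne) hQ.height_pos'

lemma IsCell.chart_mem_domain_iff (hQ : Q.IsCell) (hc : Q.Compressible) (p : ℝ × ℝ) :
    Q.chart p.1 p.2 ∈ Q.domain ↔ p ∈ chartRegion Q.contraction := by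
  have hκ := hQ.contraction_lt_one hc
  have hmono := flowCoord_strictMonoOn hQ.contraction_pos hκ.le p.2
  have hz : flowCoord Q.contraction 0 p.2 = 0 := by simp [flowCoord, cdf_zero]
  rw [hQ.mem_domain_iff hc]
  constructor
  · rintro ⟨s, hs, τ, hτ, h⟩
    obtain ⟨h1, h2⟩ := hQ.chart_inj h
    rw [h2] at h1 hτ
    refine ⟨hτ, ?_, ?_⟩
    · rw [← h1, ← hz]; exact hmono (mem_Ici.2 le_rfl) (mem_Ici.2 hs.1.le) hs.1
    · rw [← h1]; exact hmono (mem_Ici.2 hs.1.le) (mem_Ici.2 zero_le_one) hs.2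
  · rintro ⟨hτ, hu⟩
    obtain ⟨a, ha, hav⟩ := intermediate_value_Ioo (zero_le_one' ℝ)
      ((continuousOn_flowCoord (κ := Q.contraction) p.2 hκ.le hQ.contraction_pos.le).mono
          Icc_subset_Ici_self)
      (show p.1 ∈ Ioo _ _ from ⟨by rw [hz]; exact hu.1, hu.2⟩)
    change flowCoord _ a p.2 = p.1 at hav
    exact ⟨a, ha, p.2, hτ, by rw [flow, hav]⟩

lemma continuous_chart (Q : Quad) : Continuous fun p : ℝ × ℝ => Q.chart p.1 p.2 := by
  unfold chart; fun_prop

lemma measurable_flow (Q : Quad) : Measurable fun p : ℝ × ℝ => Q.flow p.1 p.2 := by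
  have h : Measurable fun p : ℝ × ℝ => (flowCoord Q.contraction p.1 p.2, p.2) :=
    (measurable_flowCoord _).prodMk measurable_snd
  have e : (fun p : ℝ × ℝ => Q.flow p.1 p.2) = (fun p : ℝ × ℝ => Q.chart p.1 p.2) ∘
    fun p => (flowCoord Q.contraction p.1 p.2, p.2) := rfl
  rw [e]
  exact Q.continuous_chart.measurable.comp h

lemma IsCell.volume_eq_map_chart (hQ : Q.IsCell) : (volume : Measure Plane) =
    ENNReal.ofReal Q.area • (volume : Measure (ℝ × ℝ)).map (fun p => Q.chart p.1 p.2) := by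
  have h := hQ.area_pos
  rw [hQ.map_chart, smul_smul, ← ENNReal.ofReal_mul h.le, abs_inv, abs_mul,
    abs_of_pos hQ.height_pos', ← area, mul_inv_cancel₀ h.ne', ENNReal.ofReal_one, one_smul]

lemma IsCell.restrict_map_chart (hQ : Q.IsCell) (hc : Q.Compressible) :
    ((volume : Measure (ℝ × ℝ)).map (fun p => Q.chart p.1 p.2)).restrict Q.domain =
      (flowMeasure Q.contraction).map fun p => Q.flow p.1 p.2 := by
  have hΩ : MeasurableSet Q.domain := isOpen_interior.measurableSet
  have hm := Q.continuous_chart.measurable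
  have h2 : (fun p : ℝ × ℝ => Q.chart p.1 p.2) ⁻¹' Q.domain = chartRegion Q.contraction := by
    ext p; exact hQ.chart_mem_domain_iff hc p
  have h3 : (fun p : ℝ × ℝ => Q.flow p.1 p.2) = (fun p : ℝ × ℝ => Q.chart p.1 p.2) ∘
    fun p => (flowCoord Q.contraction p.1 p.2, p.2) := rfl
  rw [Measure.restrict_map hm hΩ, h2,
    ← map_flowMeasure hQ.contraction_pos (hQ.contraction_lt_one hc).le,
    Measure.map_map hm ((measurable_flowCoord _).prodMk measurable_snd), h3]

/-- The area formula for the flow. -/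
lemma IsCell.volume_restrict_domain (hQ : Q.IsCell) (hc : Q.Compressible) :
    volume.restrict Q.domain =
      ENNReal.ofReal Q.area • (flowMeasure Q.contraction).map fun p => Q.flow p.1 p.2 := by
  have h : volume.restrict Q.domain = (ENNReal.ofReal Q.area •
      (volume : Measure (ℝ × ℝ)).map (fun p => Q.chart p.1 p.2)).restrict Q.domain :=
    congrArg (fun m : Measure Plane => m.restrict Q.domain) hQ.volume_eq_map_chart
  rw [h, Measure.restrict_smul, hQ.restrict_map_chart hc]

end Quad

/-! ### Generic points, the Cantor set and the density -/

namespace CantorFlow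

/-- band -/
lemma volume_band (a b : ℝ) {τ τ' : ℝ} (h : τ ≤ τ') :
    volume (Ico a b ∩ {s | τ < crossHeight s ∧ crossHeight s ≤ τ'}) =
      ENNReal.ofReal (lowMass a b τ' - lowMass a b τ) := by
  have hsub : Ico a b ∩ {s | crossHeight s ≤ τ} ⊆ Ico a b ∩ {s | crossHeight s ≤ τ'} :=
    inter_subset_inter_right _ fun s hs => le_trans hs h
  have hm := measurableSet_Ico.inter (measurableSet_crossHeight_le τ) (s₁ := Ico a b)
  have e : Ico a b ∩ {s | τ < crossHeight s ∧ crossHeight s ≤ τ'} =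
      (Ico a b ∩ {s | crossHeight s ≤ τ'}) \ (Ico a b ∩ {s | crossHeight s ≤ τ}) := by
    ext s
    simp only [mem_inter_iff, Set.mem_sdiff, mem_ofPred_eq, not_and, not_le]
    tauto
  rw [e, lowMass, lowMass, ← measureReal_sdiff hsub hm (lowMass_ne_top _ _ _), measureReal_def,
    ENNReal.ofReal_toReal]
  exact measure_ne_top_of_subset sdiff_subset (lowMass_ne_top a b τ')

/-- The uniform law has no atoms. -/
lemma volume_crossHeight_eq (τ : ℝ) : volume (Ico 0 1 ∩ {s | crossHeight s = τ}) = 0 := by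
  have key : ∀ n : ℕ, volume (Ico 0 1 ∩ {s | crossHeight s = τ}) ≤ ENNReal.ofReal (1 / 2 ^ n) := by
    intro n
    have hpos : (0 : ℝ) < 1 / 2 ^ n := by positivity
    refine (measure_mono ?_).trans ((volume_band 0 1 (by linarith : τ - 1 / 2 ^ n ≤ τ)).le.trans
      (ENNReal.ofReal_le_ofReal ?_))
    · refine inter_subset_inter_right _ ?_
      rintro s rfl
      exact ⟨by linarith, le_rfl⟩
    · rw [lowMass_zero_one, lowMass_zero_one]
      exact (clamp_sub_le (by linarith)).trans (by linarith)
  have ht : Tendsto (fun n : ℕ => ENNReal.ofReal (1 / 2 ^ n)) atTop (𝓝 0) := by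
    have := ENNReal.tendsto_ofReal (Quad.tendsto_const_div_two_pow 1)
    simpa using this
  exact le_antisymm (ge_of_tendsto' ht key) bot_le

/-- The parameters that are not base-4 rationals and whose crossing takes place in the open cell.
Almost every parameter is generic. -/
def genericParams : Set ℝ :=
  {s | s ∈ Ioo (0 : ℝ) 1 ∧ (¬ ∃ n k : ℕ, s = k / 4 ^ n) ∧ crossHeight s ≠ 0 ∧ crossHeight s ≠ 1}

/-- The relative heights that are not dyadic. -/
def genericHeights : Set ℝ := {τ | τ ∈ Ioo (0 : ℝ) 1 ∧ ¬ IsDyadic τ}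

lemma countable_quaternary : {s : ℝ | ∃ n k : ℕ, s = k / 4 ^ n}.Countable := by
  have : {s : ℝ | ∃ n k : ℕ, s = k / 4 ^ n} ⊆ ⋃ n : ℕ, ⋃ m : ℕ, {(m : ℝ) / 4 ^ n} := by
    rintro τ ⟨n, m, h⟩
    simp only [mem_iUnion, mem_singleton_iff]
    exact ⟨n, m, h⟩
  exact (countable_iUnion fun n => countable_iUnion fun m => countable_singleton _).mono this

lemma measurableSet_genericParams : MeasurableSet genericParams :=
  measurableSet_Ioo.inter (countable_quaternary.measurableSet.compl.inter
    ((measurable_crossHeight (measurableSet_singleton 0)).compl.inter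
      (measurable_crossHeight (measurableSet_singleton 1)).compl))

lemma measurableSet_genericHeights : MeasurableSet genericHeights :=
  measurableSet_Ioo.inter countable_isDyadic.measurableSet.compl

lemma ae_mem_genericParams : ∀ᵐ s ∂volume.restrict (Ioo (0 : ℝ) 1), s ∈ genericParams := by
  have h : ∀ τ : ℝ, ∀ᵐ s ∂(volume : Measure ℝ), ¬ (s ∈ Ico (0 : ℝ) 1 ∧ crossHeight s = τ) := fun τ
      => by
    rw [ae_iff]
    simp only [not_not]
    exact volume_crossHeight_eq τ
  rw [ae_restrict_iff' measurableSet_Ioo]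
  filter_upwards [countable_quaternary.ae_notMem volume, h 0, h 1] with s h1 h2 h3 hs
  exact ⟨hs, h1, fun e => h2 ⟨⟨hs.1.le, hs.2⟩, e⟩, fun e => h3 ⟨⟨hs.1.le, hs.2⟩, e⟩⟩

lemma ae_mem_genericHeights : ∀ᵐ τ ∂volume.restrict (Ioo (0 : ℝ) 1), τ ∈ genericHeights := by
  rw [ae_restrict_iff' measurableSet_Ioo]
  filter_upwards [countable_isDyadic.ae_notMem volume] with τ h hτ
  exact ⟨hτ, h⟩

lemma crossHeight_mem_Ioo {s : ℝ} (hs : s ∈ genericParams) : crossHeight s ∈ Ioo (0 : ℝ) 1 :=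
  ⟨lt_of_le_of_ne (crossHeight_nonneg s) hs.2.2.1.symm,
    lt_of_le_of_ne (crossHeight_le_one s) hs.2.2.2⟩

lemma strict_of_generic {s : ℝ} (hs : s ∈ genericParams) {N K : ℕ} (h0 : (K : ℝ) / 4 ^ N ≤ s)
    (h1 : s ≤ (K + 1) / 4 ^ N) : (K : ℝ) / 4 ^ N < s ∧ s < (K + 1) / 4 ^ N :=
  ⟨lt_of_le_of_ne h0 fun h => hs.2.1 ⟨N, K, h.symm⟩,
    lt_of_le_of_ne h1 fun h => hs.2.1 ⟨N, K + 1, by rw [h]; push_cast; rfl⟩⟩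

lemma strict_of_genericHeight {τ : ℝ} (hs : τ ∈ genericHeights) {N M : ℕ} (h0 : (M : ℝ) / 2 ^ N ≤ τ)
    (h1 : τ ≤ (M + 1) / 2 ^ N) : (M : ℝ) / 2 ^ N < τ ∧ τ < (M + 1) / 2 ^ N :=
  ⟨lt_of_le_of_ne h0 fun h => hs.2 ⟨N, M, h.symm⟩,
    lt_of_le_of_ne h1 fun h => hs.2 ⟨N, M + 1, by rw [h]; push_cast; rfl⟩⟩

end CantorFlow

namespace Quad

open CantorFlow

variable {Q : Quad}

lemma IsCell.mem_cantorSet (hQ : Q.IsCell) (hc : Q.Compressible) (x : Plane) :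
    x ∈ Q.cantorSet ↔ ∀ n, ∃ K < 4 ^ n, x ∈ (Q.gridCell n K (heightIndex n K)).conv := by
  simp only [cantorSet, mem_iInter, mem_iUnion, hQ.mem_compressibleCells hc, exists_prop]
  refine forall_congr' fun n => ⟨?_, ?_⟩
  · rintro ⟨_, ⟨K, hK, rfl⟩, h⟩; exact ⟨K, hK, h⟩
  · rintro ⟨K, hK, h⟩; exact ⟨_, ⟨K, hK, rfl⟩, h⟩

lemma isClosed_conv (R : Quad) : IsClosed R.conv :=
  ((Set.toFinite {R.A, R.B, R.C, R.D}).isCompact_convexHull ℝ).isClosed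

lemma isClosed_cantorSet (Q : Quad) : IsClosed Q.cantorSet := by
  refine isClosed_iInter fun n => ?_
  exact (List.finite_toSet (Q.compressibleCells n)).isClosed_biUnion fun R _ => R.isClosed_conv

/-- A generic trajectory meets the Cantor set exactly at its crossing height. -/
lemma IsCell.flow_mem_cantorSet (hQ : Q.IsCell) (hc : Q.Compressible) {s τ : ℝ}
    (hs : s ∈ genericParams) : Q.flow s τ ∈ Q.cantorSet ↔ τ = crossHeight s := by
  rw [hQ.mem_cantorSet hc]
  simp only [hQ.flow_mem_conv_gridCell hc hs.1.1.le]
  constructor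
  · intro h
    have key : ∀ n : ℕ, |τ - crossHeight s| ≤ 1 / 2 ^ n := fun n => by
      obtain ⟨K, -, ⟨h1, h2⟩, h3, h4⟩ := h n
      obtain ⟨h5, h6⟩ := crossHeight_mem h1 (strict_of_generic hs h1 h2).2
      rw [add_div] at h4 h6
      rw [abs_le]
      constructor <;> linarith
    have := ge_of_tendsto' (tendsto_const_div_two_pow 1) key
    linarith [abs_nonpos_iff.1 this]
  · rintro rfl n
    obtain ⟨h1, h2, h3⟩ := exists_piece hs.1.1.le hs.1.2 n
    exact ⟨_, h1, ⟨h2, h3.le⟩, crossHeight_mem h2 h3⟩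

lemma IsCell.notMem_lowerCell (hQ : Q.IsCell) (hc : Q.Compressible) {s τ : ℝ}
    (hs : s ∈ genericParams) (h : crossHeight s < τ) {n : ℕ} {R : Quad} (hR : R ∈ Q.lowerCells n) :
    Q.flow s τ ∉ R.conv := by
  obtain ⟨N, -, K, M, ⟨-, -, -, hM⟩, rfl⟩ := (hQ.mem_lowerCells hc n R).1 hR
  rw [hQ.flow_mem_conv_gridCell hc hs.1.1.le]
  rintro ⟨⟨h1, h2⟩, -, h4⟩
  have h5 := (crossHeight_mem h1 (strict_of_generic hs h1 h2).2).1
  rw [← hM] at h5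
  push_cast at h5
  linarith

/-- Before the crossing, a generic point lies in the interior of a lower cell. -/
lemma IsCell.density_of_lt (hQ : Q.IsCell) (hc : Q.Compressible) {s τ : ℝ}
    (hs : s ∈ genericParams) (hτ : τ ∈ genericHeights) (h : τ < crossHeight s) :
    Q.density (Q.flow s τ) = 1 := by
  obtain ⟨n, hn⟩ := ((tendsto_const_div_two_pow 1).eventually
    (gt_mem_nhds (sub_pos.2 h))).exists
  obtain ⟨h1, h2, h3⟩ := exists_piece hs.1.1.le hs.1.2 n
  have h4 := (crossHeight_mem h2 h3).2
  rw [add_div] at h4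
  obtain ⟨N, hN, M, hM, a, b⟩ := exists_lowerIndex_of_lt hs.1.1.le hs.1.2 hτ.1.1.le n (τ := τ)
    (by linarith)
  obtain ⟨-, c, d⟩ := exists_piece hs.1.1.le hs.1.2 N
  have a' := strict_of_genericHeight hτ a b
  have c' := strict_of_generic hs c d.le
  rw [density, if_pos]
  exact ⟨N, _, (hQ.mem_lowerCells hc N _).2 ⟨N, le_rfl, _, M, hM, rfl⟩,
    hQ.flow_mem_interior_gridCell hc c'.1 c'.2 a'.1 a'.2⟩

/-- After the crossing, a generic point lies in the interior of an upper cell and in no lower cell.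
-/
lemma IsCell.density_of_gt (hQ : Q.IsCell) (hc : Q.Compressible) {s τ : ℝ}
    (hs : s ∈ genericParams) (hτ : τ ∈ genericHeights) (h : crossHeight s < τ) :
    Q.density (Q.flow s τ) = Q.ratio := by
  obtain ⟨n, hn⟩ := ((tendsto_const_div_two_pow 1).eventually
    (gt_mem_nhds (sub_pos.2 h))).exists
  obtain ⟨h1, h2, h3⟩ := exists_piece hs.1.1.le hs.1.2 n
  have h4 := (crossHeight_mem h2 h3).1
  obtain ⟨N, hN, M, hM, a, b⟩ := exists_upperIndex_of_gt hs.1.1.le hs.1.2 hτ.1.2.le n (τ := τ)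
    (by rw [add_div]; linarith)
  obtain ⟨-, c, d⟩ := exists_piece hs.1.1.le hs.1.2 N
  have a' := strict_of_genericHeight hτ a b
  have c' := strict_of_generic hs c d.le
  rw [density, if_neg, if_pos]
  · exact ⟨N, _, (hQ.mem_upperCells hc N _).2 ⟨N, le_rfl, _, M, hM, rfl⟩,
      hQ.flow_mem_interior_gridCell hc c'.1 c'.2 a'.1 a'.2⟩
  · rintro ⟨m, R, hR, hx⟩
    exact hQ.notMem_lowerCell hc hs h hR (interior_subset hx)

lemma IsCell.continuousOn_flow (hQ : Q.IsCell) (hc : Q.Compressible) :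
    ContinuousOn (fun p : ℝ × ℝ => Q.flow p.1 p.2) (Ioo 0 1 ×ˢ Ioo 0 1) := by
  have hκ := hQ.contraction_lt_one hc
  refine continuousOn_prod_of_continuousOn_lipschitzOnWith' _ (‖Q.B - Q.A‖ + ‖Q.D - Q.A‖).toNNReal
      ?_ ?_
  · intro s hs
    refine LipschitzOnWith.of_dist_le_mul fun τ _ τ' _ => ?_
    rw [Real.coe_toNNReal _ (by positivity), dist_eq_norm, Real.dist_eq]
    exact hQ.norm_flow_sub_le hc hs.1.le hs.2.le τ τ'
  · intro τ _
    have h := (continuousOn_flowCoord (κ := Q.contraction) τ hκ.le hQ.contraction_pos.le).mono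
      (Ioo_subset_Icc_self.trans Icc_subset_Ici_self : Ioo (0 : ℝ) 1 ⊆ Ici 0)
    exact (continuousOn_const.add (h.smul continuousOn_const)).add
      (continuousOn_const (c := τ • (Q.D - Q.A)))

lemma IsCell.measurableSet_image_flow (hQ : Q.IsCell) (hc : Q.Compressible) {A B : Set ℝ}
    (hA : MeasurableSet A) (hB : MeasurableSet B) (hA1 : A ⊆ Ioo 0 1) (hB1 : B ⊆ Ioo 0 1) :
    MeasurableSet ((fun p : ℝ × ℝ => Q.flow p.1 p.2) '' A ×ˢ B) := by
  refine (hA.prod hB).image_of_continuousOn_injOn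
    ((hQ.continuousOn_flow hc).mono (prod_mono hA1 hB1)) ?_
  rintro ⟨s, τ⟩ ⟨hs, -⟩ ⟨s', τ'⟩ ⟨hs', -⟩ h
  obtain ⟨h1, h2⟩ := hQ.flow_inj hc (hA1 hs).1.le (hA1 hs').1.le h
  exact Prod.ext h1 h2

/-- A property of almost all parameters and a property of almost all heights hold together at
almost every point of the domain. -/
lemma IsCell.ae_mem_image_flow (hQ : Q.IsCell) (hc : Q.Compressible) {A B : Set ℝ}
    (hA : MeasurableSet A) (hB : MeasurableSet B) (hA1 : A ⊆ Ioo 0 1) (hB1 : B ⊆ Ioo 0 1)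
    (hA2 : ∀ᵐ s ∂volume.restrict (Ioo (0 : ℝ) 1), s ∈ A)
    (hB2 : ∀ᵐ s ∂volume.restrict (Ioo (0 : ℝ) 1), s ∈ B) :
    ∀ᵐ x ∂volume.restrict Q.domain, x ∈ (fun p : ℝ × ℝ => Q.flow p.1 p.2) '' A ×ˢ B := by
  have hm := hQ.measurableSet_image_flow hc hA hB hA1 hB1
  rw [hQ.volume_restrict_domain hc]
  refine Measure.ae_smul_measure ?_ _
  refine (ae_map_iff (p := fun x => x ∈ (fun p : ℝ × ℝ => Q.flow p.1 p.2) '' A ×ˢ B)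
    Q.measurable_flow.aemeasurable hm).2 ?_
  refine (withDensity_absolutelyContinuous _ _).ae_le ?_
  rw [Measure.volume_eq_prod, ← Measure.prod_restrict]
  filter_upwards [Measure.quasiMeasurePreserving_fst.ae hA2,
    Measure.quasiMeasurePreserving_snd.ae hB2] with p h1 h2
  exact ⟨p, ⟨h1, h2⟩, rfl⟩

end Quad

/-! ### The crossing measure -/

namespace Quad

open CantorFlow

variable {Q : Quad}

/-- The point at which the trajectory of parameter `s` crosses the Cantor set. -/
def crossingPoint (Q : Quad) (s : ℝ) : Plane := Q.flow s (crossHeight s)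

lemma measurable_crossingPoint (Q : Quad) : Measurable Q.crossingPoint := by
  have e : Q.crossingPoint = (fun p : ℝ × ℝ => Q.flow p.1 p.2) ∘ fun s => (s, crossHeight s) := rfl
  rw [e]
  exact Q.measurable_flow.comp (measurable_id.prodMk measurable_crossHeight)

/-- The distribution of the crossing point of a uniform parameter in `(0, 1)`. -/
def crossingMeasure (Q : Quad) : Measure Plane :=
  (volume.restrict (Ioo (0 : ℝ) 1)).map Q.crossingPoint

/-- The mass of a band of crossing heights over three consecutive base-4 intervals. -/
lemma volume_band_le {n k : ℕ} {τ τ' : ℝ} (h : τ ≤ τ') :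
    volume (Ico ((k : ℝ) / 4 ^ n) ((k + 3 : ℕ) / 4 ^ n) ∩
        {s | τ < crossHeight s ∧ crossHeight s ≤ τ'}) ≤
      ENNReal.ofReal (3 * ((τ' - τ) / 2 ^ n)) := by
  rw [volume_band _ _ h]
  refine ENNReal.ofReal_le_ofReal ?_
  have hmono : ∀ i : ℕ, (i : ℝ) / 4 ^ n ≤ ((i + 1 : ℕ) : ℝ) / 4 ^ n := fun i => by
    gcongr; exact Nat.le_succ i
  have hp : ∀ i : ℕ, lowMass (i / 4 ^ n) ((i + 1 : ℕ) / 4 ^ n) τ' - lowMass (i / 4 ^ n)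
      ((i + 1 : ℕ) / 4 ^ n) τ
      ≤ (τ' - τ) / 2 ^ n := fun i =>
    lowMass_sub_le_of_piece le_rfl (hmono i) (by push_cast; rfl) h
  have e : ∀ t, lowMass (k / 4 ^ n) ((k + 3 : ℕ) / 4 ^ n) t = lowMass (k / 4 ^ n)
      ((k + 1 : ℕ) / 4 ^ n) t +
      lowMass ((k + 1 : ℕ) / 4 ^ n) ((k + 1 + 1 : ℕ) / 4 ^ n) t +
      lowMass ((k + 1 + 1 : ℕ) / 4 ^ n) ((k + 1 + 1 + 1 : ℕ) / 4 ^ n) t := fun t => by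
    rw [lowMass_add (hmono _) (hmono _), lowMass_add ((hmono _).trans (hmono _)) (hmono _)]
  rw [e, e]
  linarith [hp k, hp (k + 1), hp (k + 1 + 1)]

/-- A Lipschitz constant of the parameter `s` as a function of the point `flow s τ`. -/
def spread (Q : Quad) : ℝ :=
  (1 + (‖Q.B - Q.A‖ + ‖Q.D - Q.A‖) / Q.height) / (Q.contraction * ‖Q.B - Q.A‖)

lemma IsCell.norm_base_pos (hQ : Q.IsCell) : 0 < ‖Q.B - Q.A‖ := by
  rw [← dist_eq_norm, dist_comm]; exact hQ.dist_pos

lemma IsCell.spread_pos (hQ : Q.IsCell) : 0 < Q.spread := by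
  have := hQ.norm_base_pos
  have := hQ.height_pos'
  have := hQ.contraction_pos
  unfold spread
  positivity

lemma IsCell.abs_height_sub_le (hQ : Q.IsCell) (s τ s' τ' : ℝ) :
    |τ - τ'| ≤ ‖Q.flow s τ - Q.flow s' τ'‖ / Q.height := by
  have hh := hQ.height_pos'
  have h := PiLp.norm_apply_le (Q.flow s τ - Q.flow s' τ') 1
  rw [PiLp.sub_apply, hQ.flow_apply_one, hQ.flow_apply_one, Real.norm_eq_abs,
    show Q.A 1 + τ * Q.height - (Q.A 1 + τ' * Q.height) = (τ - τ') * Q.height by ring, abs_mul,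
    abs_of_pos hh] at h
  rwa [le_div_iff₀ hh]

lemma IsCell.abs_param_sub_le (hQ : Q.IsCell) (hc : Q.Compressible) {s τ s' τ' : ℝ}
    (hs : s ∈ Ioo (0 : ℝ) 1) (hs' : s' ∈ Ioo (0 : ℝ) 1) :
    |s - s'| ≤ Q.spread * ‖Q.flow s τ - Q.flow s' τ'‖ := by
  have hh := hQ.height_pos'
  have hb := hQ.norm_base_pos
  have hκ := hQ.contraction_pos
  have hκ1 := hQ.contraction_lt_one hc
  have h1 := hQ.abs_height_sub_le s τ s' τ'
  have h2 := hQ.norm_flow_sub_le hc hs.1.le hs.2.le τ' τ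
  have h3 : ‖Q.flow s τ' - Q.flow s' τ'‖ = |flowCoord Q.contraction s τ' - flowCoord Q.contraction
      s' τ'| *
      ‖Q.B - Q.A‖ := by
    rw [flow_sub_flow, sub_self, zero_smul, add_zero, norm_smul, Real.norm_eq_abs]
  have h4 : Q.contraction * |s - s'| ≤
      |flowCoord Q.contraction s τ' - flowCoord Q.contraction s' τ'| := by
    rcases le_total s s' with h | h
    · have := le_flowCoord_sub hκ1.le hs.1.le h τ'
      rw [abs_sub_comm s, abs_sub_comm (flowCoord _ s _), abs_of_nonneg (sub_nonneg.2 h)]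
      exact this.trans (le_abs_self _)
    · have := le_flowCoord_sub hκ1.le hs'.1.le h τ'
      rw [abs_of_nonneg (sub_nonneg.2 h)]
      exact this.trans (le_abs_self _)
  have h5 := norm_sub_le_norm_sub_add_norm_sub (Q.flow s τ') (Q.flow s τ) (Q.flow s' τ')
  rw [abs_sub_comm τ' τ] at h2
  have h6 : (‖Q.B - Q.A‖ + ‖Q.D - Q.A‖) * |τ - τ'| ≤
      (‖Q.B - Q.A‖ + ‖Q.D - Q.A‖) * (‖Q.flow s τ - Q.flow s' τ'‖ / Q.height) := by gcongr
  have h7 := mul_le_mul_of_nonneg_right h4 hb.le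
  rw [spread, div_mul_eq_mul_div, le_div_iff₀ (by positivity), add_mul, one_mul, div_mul_eq_mul_div,
    ← mul_div_assoc']
  linarith

/-- The mass of a set of diameter at most a constant times `4⁻ⁿ` is at most a constant times `2⁻ⁿ`
times its diameter. -/
lemma IsCell.crossingMeasure_le (hQ : Q.IsCell) (hc : Q.Compressible) (n : ℕ) (E : Set Plane)
    (hE : Metric.ediam E ≤ ENNReal.ofReal (1 / 4 ^ n / Q.spread)) :
    Q.crossingMeasure E ≤ ENNReal.ofReal (9 / Q.height / 2 ^ n) * Metric.ediam E := by
  have hh := hQ.height_pos'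
  have hsp := hQ.spread_pos
  have h4 : (0 : ℝ) < 4 ^ n := by positivity
  -- Passing to the closure makes the set measurable without changing its diameter.
  rw [← Metric.ediam_closure E] at hE ⊢
  refine (measure_mono subset_closure).trans ?_
  set F := closure E with hF
  have hFm : MeasurableSet F := isClosed_closure.measurableSet
  have hfin : Metric.ediam F ≠ ⊤ := ne_top_of_le_ne_top ENNReal.ofReal_ne_top hE
  set d := (Metric.ediam F).toReal with hd
  have hd0 : 0 ≤ d := ENNReal.toReal_nonneg
  have hed : Metric.ediam F = ENNReal.ofReal d := (ENNReal.ofReal_toReal hfin).symm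
  have hd1 : Q.spread * d ≤ 1 / 4 ^ n := by
    have : d ≤ 1 / 4 ^ n / Q.spread := by
      rw [hed] at hE
      exact (ENNReal.ofReal_le_ofReal_iff (by positivity)).1 hE
    rw [le_div_iff₀ hsp] at this
    linarith
  have hdist : ∀ x ∈ F, ∀ y ∈ F, ‖x - y‖ ≤ d := fun x hx y hy => by
    have h := Metric.edist_le_ediam_of_mem hx hy
    rw [hed, edist_dist, dist_eq_norm] at h
    exact (ENNReal.ofReal_le_ofReal_iff hd0).1 h
  rw [crossingMeasure, Measure.map_apply Q.measurable_crossingPoint hFm,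
    Measure.restrict_apply (Q.measurable_crossingPoint hFm)]
  rcases (Q.crossingPoint ⁻¹' F ∩ Ioo 0 1).eq_empty_or_nonempty with he | ⟨s₀, hs₀F, hs₀⟩
  · rw [he, measure_empty]; exact bot_le
  have hpar : ∀ s ∈ Q.crossingPoint ⁻¹' F ∩ Ioo 0 1, |s - s₀| ≤ Q.spread * d := fun s hs =>
    (hQ.abs_param_sub_le hc hs.2 hs₀).trans (by gcongr; exact hdist _ hs.1 _ hs₀F)
  have hhei : ∀ s ∈ Q.crossingPoint ⁻¹' F ∩ Ioo 0 1, |crossHeight s - crossHeight s₀| ≤ d /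
      Q.height :=
    fun s hs => (hQ.abs_height_sub_le _ _ _ _).trans (by gcongr; exact hdist _ hs.1 _ hs₀F)
  -- A set of diameter zero contains at most one crossing point.
  rcases hd0.eq_or_lt with h0 | hpos
  · have hsub : Q.crossingPoint ⁻¹' F ∩ Ioo 0 1 ⊆ {s₀} := fun s hs => by
      have := hpar s hs
      rw [← h0, mul_zero] at this
      exact sub_eq_zero.1 (abs_nonpos_iff.1 this)
    exact (measure_mono hsub).trans (by simp)
  have hdh : 0 < d / Q.height := by positivity
  obtain ⟨-, hk1, hk2⟩ := exists_piece hs₀.1.le hs₀.2 n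
  set k := ⌊4 ^ n * s₀⌋₊
  rw [div_le_iff₀ h4] at hk1
  rw [lt_div_iff₀ h4] at hk2
  -- The parameters differ from `s₀` by at most `4⁻ⁿ`, hence they lie in the interval of `s₀` or
  -- one of its neighbours. For `k = 0` the truncated `k - 1` is `0`, which is harmless. The lower
  -- margin is doubled because the band is open below.
  have hsub : Q.crossingPoint ⁻¹' F ∩ Ioo 0 1 ⊆
      Ico (((k - 1 : ℕ) : ℝ) / 4 ^ n) ((k - 1 + 3 : ℕ) / 4 ^ n) ∩
        {s | crossHeight s₀ - 2 * (d / Q.height) < crossHeight s ∧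
          crossHeight s ≤ crossHeight s₀ + d / Q.height} := by
    intro s hs
    have h1 := abs_le.1 ((hpar s hs).trans hd1)
    have h2 := abs_le.1 (hhei s hs)
    have e4 : (1 : ℝ) / 4 ^ n * 4 ^ n = 1 := by field_simp
    have h3 := mul_le_mul_of_nonneg_right h1.1 h4.le
    have h5 := mul_le_mul_of_nonneg_right h1.2 h4.le
    rw [neg_mul, e4, sub_mul] at h3
    rw [e4, sub_mul] at h5
    have h6 : 0 ≤ s * 4 ^ n := mul_nonneg hs.2.1.le h4.le
    refine ⟨⟨?_, ?_⟩, by linarith, by linarith⟩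
    · rw [div_le_iff₀ h4]
      rcases Nat.eq_zero_or_pos k with hk | hk
      · simpa [hk] using h6
      · rw [Nat.cast_sub hk]; push_cast; linarith
    · rw [lt_div_iff₀ h4]
      have : (k : ℝ) + 2 ≤ ((k - 1 + 3 : ℕ) : ℝ) := by
        have : k + 2 ≤ k - 1 + 3 := by omega
        exact_mod_cast this
      linarith
  refine (measure_mono hsub).trans ((volume_band_le (by linarith)).trans ?_)
  rw [hed, ← ENNReal.ofReal_mul (by positivity)]
  refine ENNReal.ofReal_le_ofReal (le_of_eq ?_)
  field_simp
  ring

lemma IsCell.crossingMeasure_le_hausdorffMeasure (hQ : Q.IsCell) (hc : Q.Compressible) (n : ℕ) :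
    Q.crossingMeasure ≤ ENNReal.ofReal (9 / Q.height / 2 ^ n) • Measure.hausdorffMeasure 1 := by
  have hh := hQ.height_pos'
  have hsp := hQ.spread_pos
  have hc0 : ENNReal.ofReal (9 / Q.height / 2 ^ n) ≠ 0 := by
    rw [Ne, ENNReal.ofReal_eq_zero, not_le]; positivity
  have h := Measure.le_hausdorffMeasure 1
    ((ENNReal.ofReal (9 / Q.height / 2 ^ n))⁻¹ • Q.crossingMeasure)
    (ENNReal.ofReal (1 / 4 ^ n / Q.spread)) (by rw [ENNReal.ofReal_pos]; positivity) fun E hE => by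
      rw [ENNReal.rpow_one, Measure.smul_apply, smul_eq_mul, mul_comm, ← div_eq_mul_inv]
      exact ENNReal.div_le_of_le_mul' (hQ.crossingMeasure_le hc n E hE)
  refine Measure.le_iff.2 fun E hE => ?_
  have h' := h E
  rw [Measure.smul_apply, smul_eq_mul, mul_comm, ← div_eq_mul_inv,
    ENNReal.div_le_iff hc0 ENNReal.ofReal_ne_top] at h'
  rwa [Measure.smul_apply, smul_eq_mul, mul_comm]

/-- The crossing measure does not charge sets of finite length. -/
lemma IsCell.crossingMeasure_eq_zero (hQ : Q.IsCell) (hc : Q.Compressible) {E : Set Plane}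
    (hE : Measure.hausdorffMeasure 1 E < ⊤) : Q.crossingMeasure E = 0 := by
  have ht : Tendsto (fun n : ℕ => ENNReal.ofReal (9 / Q.height / 2 ^ n) * Measure.hausdorffMeasure
      1 E)
      atTop (𝓝 0) := by
    have := ENNReal.Tendsto.mul_const (ENNReal.tendsto_ofReal
        (tendsto_const_div_two_pow (9 / Q.height)))
      (Or.inr hE.ne)
    simpa using this
  exact le_antisymm (ge_of_tendsto' ht fun n => hQ.crossingMeasure_le_hausdorffMeasure hc n E)
      bot_le

/-- The negative of the divergence of the limit field. The factor is `|AB| - |CD|`, the loss of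
flux from the lower to the upper base. -/
def cantorMeasure (Q : Quad) : Measure Plane :=
  ENNReal.ofReal ((1 - Q.contraction) * |Q.B 0 - Q.A 0|) • Q.crossingMeasure.restrict Q.domain

instance (Q : Quad) : IsFiniteMeasure Q.crossingMeasure := by
  unfold crossingMeasure; infer_instance

instance (Q : Quad) : IsFiniteMeasure Q.cantorMeasure :=
  Measure.smul_finite _ ENNReal.ofReal_ne_top

lemma cantorMeasure_compl_domain (Q : Quad) : Q.cantorMeasure Q.domainᶜ = 0 := by
  have hΩ : MeasurableSet Q.domain := isOpen_interior.measurableSet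
  rw [cantorMeasure, Measure.smul_apply, Measure.restrict_apply hΩ.compl]
  simp

lemma IsCell.ae_cantorMeasure (hQ : Q.IsCell) (hc : Q.Compressible) :
    ∀ᵐ x ∂Q.cantorMeasure, ∃ s ∈ genericParams, x = Q.crossingPoint s := by
  have hm := hQ.measurableSet_image_flow hc measurableSet_genericParams measurableSet_Ioo
    (fun s hs => hs.1) Subset.rfl
  have hS := Q.isClosed_cantorSet.measurableSet
  have h : ∀ᵐ x ∂Q.crossingMeasure,
      x ∈ (fun p : ℝ × ℝ => Q.flow p.1 p.2) '' genericParams ×ˢ Ioo 0 1 ∩ Q.cantorSet := by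
    refine (ae_map_iff (p := fun x => x ∈ (fun p : ℝ × ℝ => Q.flow p.1 p.2) ''
      genericParams ×ˢ Ioo 0 1 ∩ Q.cantorSet) Q.measurable_crossingPoint.aemeasurable
          (hm.inter hS)).2 ?_
    filter_upwards [ae_mem_genericParams] with s hs
    exact ⟨⟨(s, crossHeight s), ⟨hs, crossHeight_mem_Ioo hs⟩, rfl⟩,
      (hQ.flow_mem_cantorSet hc hs).2 rfl⟩
  refine Measure.ae_smul_measure (ae_restrict_of_ae ?_) _
  filter_upwards [h] with x hx
  obtain ⟨⟨⟨s, τ⟩, ⟨hs, -⟩, rfl⟩, hx⟩ := hx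
  exact ⟨s, hs, by rw [crossingPoint, ← (hQ.flow_mem_cantorSet hc hs).1 hx]⟩

/-- The crossing measure lives on the Cantor set, which is a null set because almost every
trajectory meets it only once. -/
lemma IsCell.mutuallySingular_cantorMeasure (hQ : Q.IsCell) (hc : Q.Compressible) :
    Q.cantorMeasure ⟂ₘ volume := by
  have hΩ : MeasurableSet Q.domain := isOpen_interior.measurableSet
  have hS := Q.isClosed_cantorSet.measurableSet
  refine ⟨(Q.cantorSet ∩ Q.domain)ᶜ, (hS.inter hΩ).compl, ?_, ?_⟩
  · rw [compl_inter]
    refine measure_union_null ?_ Q.cantorMeasure_compl_domain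
    rw [← mem_ae_iff]
    filter_upwards [hQ.ae_cantorMeasure hc] with x hx
    obtain ⟨s, hs, rfl⟩ := hx
    exact (hQ.flow_mem_cantorSet hc hs).2 rfl
  · rw [compl_compl, ← Measure.restrict_apply hS, hQ.volume_restrict_domain hc, Measure.smul_apply,
      Measure.map_apply Q.measurable_flow hS]
    have hz : flowMeasure Q.contraction ((fun p : ℝ × ℝ => Q.flow p.1 p.2) ⁻¹' Q.cantorSet) = 0 :=
        by
      refine withDensity_absolutelyContinuous _ _ ?_
      rw [Measure.volume_eq_prod, ← Measure.prod_restrict,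
        Measure.measure_prod_null (Q.measurable_flow hS)]
      filter_upwards [ae_mem_genericParams] with s hs
      have hsub : Prod.mk s ⁻¹' ((fun p : ℝ × ℝ => Q.flow p.1 p.2) ⁻¹' Q.cantorSet) ⊆
          {crossHeight s} :=
        fun τ hτ => (hQ.flow_mem_cantorSet hc hs).1 hτ
      exact measure_mono_null hsub (by simp)
    rw [hz, smul_zero]

end Quad

/-! ### The distributional divergence -/

namespace Quad

open CantorFlow

variable {Q : Quad}

lemma measurable_field (R : Quad) : Measurable R.field := by
  unfold field
  refine Measurable.ite R.isClosed_conv.measurableSet ?_ measurable_const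
  split_ifs <;> fun_prop

lemma measurable_unionField (l : List Quad) : Measurable (unionField l) := by
  have hind : ∀ R : Quad, Measurable (R.conv.indicator fun _ => (1 : ℝ)) := fun R =>
    measurable_const.indicator R.isClosed_conv.measurableSet
  have hsum : ∀ l : List Quad, Measurable fun x =>
      (l.map fun R => R.conv.indicator (fun _ => (1 : ℝ)) x).sum := by
    intro l
    induction l with
    | nil => exact measurable_const
    | cons R l ih =>
      simp only [List.map_cons, List.sum_cons]
      exact (hind R).add ih
  have key : ∀ (c : Plane → ℝ), Measurable c → ∀ l' : List Quad, Measurable fun x =>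
      (l'.map fun R => (R.conv.indicator (fun _ => (1 : ℝ)) x / c x) • R.field x).sum := by
    intro c hc l'
    induction l' with
    | nil => exact measurable_const
    | cons R l' ih =>
      simp only [List.map_cons, List.sum_cons]
      exact (((hind R).div hc).smul R.measurable_field).add ih
  exact key _ (measurable_const.max (hsum l)) l

lemma IsCell.ae_generic (hQ : Q.IsCell) (hc : Q.Compressible) :
    ∀ᵐ x ∂volume.restrict Q.domain, ∃ s ∈ genericParams, ∃ τ ∈ genericHeights, Q.flow s τ = x := by
  filter_upwards [hQ.ae_mem_image_flow hc measurableSet_genericParams measurableSet_genericHeights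
    (fun s hs => hs.1) (fun s hs => hs.1) ae_mem_genericParams ae_mem_genericHeights] with x hx
  obtain ⟨⟨s, τ⟩, ⟨hs, hτ⟩, rfl⟩ := hx
  exact ⟨s, hs, τ, hτ, rfl⟩

lemma deriv_cdf_mem_Icc {s τ : ℝ} (hs : s ∈ Ioo (0 : ℝ) 1) (hτ : τ ∈ genericHeights) :
    deriv (cdf s) τ ∈ Icc (0 : ℝ) 1 := by
  have h := (deriv_cdf_mem (N := 0) (K := 0) (M := 0) hs.1.le hs.2 (by simpa using hs.1.le)
    (by simpa using hs.2.le) hτ.2 (by simpa using hτ.1.1.le) (by simpa using hτ.1.2.le)).1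
  simpa [cdfSlope, cdf_zero] using h

lemma IsCell.norm_velocity_le (hQ : Q.IsCell) (hc : Q.Compressible) {g : ℝ}
    (hg : g ∈ Icc (0 : ℝ) 1) :
    ‖Q.velocity g‖ ≤ ‖Q.velocity 0‖ + Q.speedGap := by
  have h := hQ.norm_velocity_sub hc g 0
  have h' := norm_sub_norm_le (Q.velocity g) (Q.velocity 0)
  rw [sub_zero, abs_of_nonneg hg.1] at h
  nlinarith [hQ.speedGap_nonneg hc, hg.2]

lemma IsCell.memLp_limitField (hQ : Q.IsCell) (hc : Q.Compressible) :
    MemLp Q.limitField ⊤ (volume.restrict Q.domain) := by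
  refine memLp_top_of_bound ?_ (‖Q.velocity 0‖ + Q.speedGap) ?_
  · refine aestronglyMeasurable_of_tendsto_ae atTop
      (fun n => (measurable_unionField (Q.cells n)).aestronglyMeasurable) ?_
    filter_upwards [hQ.ae_generic hc] with x hx
    obtain ⟨s, hs, τ, hτ, rfl⟩ := hx
    rw [hQ.limitField_flow hc hs.1.1.le hs.1.2 hτ.1.1.le hτ.1.2.le hτ.2]
    exact hQ.tendsto_approxField hc hs.1.1.le hs.1.2 hτ.1.1.le hτ.1.2.le hτ.2
  · filter_upwards [hQ.ae_generic hc] with x hx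
    obtain ⟨s, hs, τ, hτ, rfl⟩ := hx
    rw [hQ.limitField_flow hc hs.1.1.le hs.1.2 hτ.1.1.le hτ.1.2.le hτ.2]
    exact hQ.norm_velocity_le hc (deriv_cdf_mem_Icc hs.1 hτ)

lemma IsCell.flow_notMem_domain (hQ : Q.IsCell) (hc : Q.Compressible) {s τ : ℝ} (hs : 0 ≤ s)
    (hτ : τ ∉ Ioo (0 : ℝ) 1) : Q.flow s τ ∉ Q.domain := by
  intro h
  obtain ⟨s', hs', τ', hτ', e⟩ := (hQ.mem_domain_iff hc).1 h
  exact hτ ((hQ.flow_inj hc hs'.1.le hs e).2 ▸ hτ')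

/-- Integration of the derivative of a test function along one trajectory, with the density
`jacobian`: only the jump of the density at the crossing contributes. -/
lemma IsCell.integral_along_flow (hQ : Q.IsCell) (hc : Q.Compressible) {φ : Plane → ℝ}
    (hφ : ContDiff ℝ ∞ φ) (hcs : HasCompactSupport φ) (hsupp : tsupport φ ⊆ Q.domain) {s : ℝ}
    (hs : s ∈ Ioo (0 : ℝ) 1) :
    ∫ τ in Ioo (0 : ℝ) 1, jacobian Q.contraction s τ *
      fderiv ℝ φ (Q.flow s τ) (Q.limitField (Q.flow s τ)) =
      Q.height⁻¹ * (1 - Q.contraction) * φ (Q.crossingPoint s) := by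
  have hh := hQ.height_pos'
  set κ := Q.contraction with hκ
  set f : ℝ → ℝ := fun τ => φ (Q.flow s τ) with hf
  obtain ⟨C, hC⟩ := hφ.lipschitzWith_of_hasCompactSupport hcs (by simp)
  have hflow : LipschitzWith (‖Q.B - Q.A‖ + ‖Q.D - Q.A‖).toNNReal (Q.flow s) :=
    LipschitzWith.of_dist_le_mul fun τ τ' => by
      rw [Real.coe_toNNReal _ (by positivity), dist_eq_norm, Real.dist_eq]
      exact hQ.norm_flow_sub_le hc hs.1.le hs.2.le τ τ'
  have hac : ∀ a b, AbsolutelyContinuousOnInterval f a b := fun a b =>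
    ((hC.comp hflow).lipschitzOnWith (s := uIcc a b)).absolutelyContinuousOnInterval
  have hzero : ∀ τ, τ ∉ Ioo (0 : ℝ) 1 → f τ = 0 := fun τ hτ =>
    image_eq_zero_of_notMem_tsupport (f := φ) fun h => hQ.flow_notMem_domain hc hs.1.le hτ (hsupp h)
  have hint : ∀ a b : ℝ, a ≤ b → ∫ τ in Ioo a b, deriv f τ = f b - f a := fun a b hab => by
    rw [← (hac a b).integral_deriv_eq_sub, intervalIntegral.integral_of_le hab,
      integral_Ioc_eq_integral_Ioo]
  have hT0 := crossHeight_nonneg s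
  have hT1 := crossHeight_le_one s
  have hI : IntegrableOn (deriv f) (Ioo 0 1) :=
    ((intervalIntegrable_iff_integrableOn_Ioc_of_le zero_le_one).1
      (hac 0 1).intervalIntegrable_deriv).mono_set Ioo_subset_Ioc_self
  -- The density is `κ + (1 - κ) 1_{τ < T}` with `T` the crossing height. As the test function
  -- vanishes at both ends, only the second term contributes.
  have hcongr : ∫ τ in Ioo (0 : ℝ) 1, jacobian κ s τ *
      fderiv ℝ φ (Q.flow s τ) (Q.limitField (Q.flow s τ)) =
      ∫ τ in Ioo (0 : ℝ) 1, Q.height⁻¹ * (κ * deriv f τ +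
        (1 - κ) * (Iio (crossHeight s)).indicator (deriv f) τ) := by
    refine integral_congr_ae ?_
    filter_upwards [ae_mem_genericHeights] with τ hτ
    have hd : HasDerivAt f (fderiv ℝ φ (Q.flow s τ)
        ((Q.D - Q.A) - ((1 - κ) * deriv (cdf s) τ) • (Q.B - Q.A))) τ :=
      ((hφ.differentiable (by simp)).differentiableAt.hasFDerivAt).comp_hasDerivAt τ
        (hasDerivAt_flow hs.1.le hs.2 hτ.1.1.le hτ.2)
    rw [hQ.limitField_flow hc hs.1.le hs.2 hτ.1.1.le hτ.1.2.le hτ.2, velocity, map_smul, ← hκ,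
      ← hd.deriv, smul_eq_mul, jacobian]
    by_cases h : crossHeight s ≤ τ
    · rw [if_pos h, indicator_of_notMem (by simpa using h)]; ring
    · rw [if_neg h, indicator_of_mem (by simpa using h)]; ring
  have hset : Ioo (0 : ℝ) 1 ∩ Iio (crossHeight s) = Ioo 0 (crossHeight s) := by
    ext τ
    simp only [mem_inter_iff, mem_Ioo, mem_Iio]
    exact ⟨fun h => ⟨h.1.1, h.2⟩, fun h => ⟨⟨h.1, h.2.trans_le hT1⟩, h.2⟩⟩
  rw [hcongr, integral_const_mul, integral_add (hI.const_mul _)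
    ((hI.indicator measurableSet_Iio).const_mul _), integral_const_mul, integral_const_mul,
    setIntegral_indicator measurableSet_Iio, hset, hint 0 1 zero_le_one, hint 0 _ hT0,
    hzero 0 (by simp), hzero 1 (by simp)]
  simp only [hf, crossingPoint]
  ring

/-- Fubini in flow coordinates: the distributional divergence of the limit field is
`-cantorMeasure`. -/
lemma IsCell.integral_divergence (hQ : Q.IsCell) (hc : Q.Compressible) {φ : Plane → ℝ}
    (hφ : ContDiff ℝ ∞ φ) (hcs : HasCompactSupport φ) (hsupp : tsupport φ ⊆ Q.domain) :
    ∫ x in Q.domain, fderiv ℝ φ x (Q.limitField x) = ∫ x, φ x ∂Q.cantorMeasure := by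
  have hh := hQ.height_pos'
  have hκ1 := sub_pos.2 (hQ.contraction_lt_one hc)
  have hκ0 := hQ.contraction_pos
  have hmem := hQ.memLp_limitField hc
  obtain ⟨C, hC⟩ := hφ.lipschitzWith_of_hasCompactSupport hcs (by simp)
  have hfin : IsFiniteMeasure (volume.restrict Q.domain) := by
    refine isFiniteMeasure_restrict.2 (measure_ne_top_of_subset interior_subset ?_)
    exact ((Set.toFinite {Q.A, Q.B, Q.C, Q.D}).isCompact_convexHull ℝ).measure_lt_top.ne
  have hFI : Integrable (fun x => fderiv ℝ φ x (Q.limitField x)) (volume.restrict Q.domain) := by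
    have hI : Integrable Q.limitField (volume.restrict Q.domain) := hmem.integrable le_top
    refine (hI.norm.const_mul (C : ℝ)).mono' ?_ (ae_of_all _ fun x => ?_)
    · have hfd : AEStronglyMeasurable (fderiv ℝ φ) (volume.restrict Q.domain) :=
        (hφ.continuous_fderiv (by simp)).aestronglyMeasurable
      exact (isBoundedBilinearMap_apply (𝕜 := ℝ) (E := Plane)
        (F := ℝ)).continuous.comp_aestronglyMeasurable (hfd.prodMk hmem.1)
    · exact (ContinuousLinearMap.le_opNorm _ _).trans
        (mul_le_mul_of_nonneg_right (norm_fderiv_le_of_lipschitz ℝ hC) (norm_nonneg _))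
  have hrhs : ∫ x, φ x ∂Q.cantorMeasure = (1 - Q.contraction) * |Q.B 0 - Q.A 0| *
      ∫ s in Ioo (0 : ℝ) 1, φ (Q.crossingPoint s) := by
    rw [cantorMeasure, integral_smul_measure, ENNReal.toReal_ofReal (by positivity), smul_eq_mul,
      setIntegral_eq_integral_of_forall_compl_eq_zero fun x hx =>
        image_eq_zero_of_notMem_tsupport fun h => hx (hsupp h), crossingMeasure,
      integral_map Q.measurable_crossingPoint.aemeasurable hφ.continuous.aestronglyMeasurable]
  have hj : Measurable fun p : ℝ × ℝ => ENNReal.ofReal (jacobian Q.contraction p.1 p.2) :=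
    (measurable_jacobian _).ennreal_ofReal
  have ha : ENNReal.ofReal Q.area ≠ 0 := by
    rw [Ne, ENNReal.ofReal_eq_zero, not_le]; exact hQ.area_pos
  have hjtop : ∀ᵐ p ∂(volume.restrict (Ioo (0 : ℝ) 1 ×ˢ Ioo (0 : ℝ) 1)),
      ENNReal.ofReal (jacobian Q.contraction p.1 p.2) < ⊤ := ae_of_all _ fun _ =>
          ENNReal.ofReal_lt_top
  rw [hQ.volume_restrict_domain hc] at hFI ⊢
  have hFI' := (integrable_smul_measure ha ENNReal.ofReal_ne_top).1 hFI
  rw [integral_smul_measure, integral_map Q.measurable_flow.aemeasurable hFI'.1, flowMeasure,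
    integral_withDensity_eq_integral_toReal_smul hj hjtop, ENNReal.toReal_ofReal hQ.area_pos.le]
  have hFI2 := (integrable_map_measure hFI'.1 Q.measurable_flow.aemeasurable).1 hFI'
  rw [flowMeasure, integrable_withDensity_iff_integrable_smul' hj hjtop] at hFI2
  have e := setIntegral_prod (μ := (volume : Measure ℝ)) (ν := (volume : Measure ℝ)) _
    (s := Ioo (0 : ℝ) 1) (t := Ioo (0 : ℝ) 1) hFI2
  refine (congrArg (Q.area • ·) e).trans ?_
  have e2 : ∀ s ∈ Ioo (0 : ℝ) 1, ∫ τ in Ioo (0 : ℝ) 1,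
      (ENNReal.ofReal (jacobian Q.contraction s τ)).toReal •
        fderiv ℝ φ (Q.flow s τ) (Q.limitField (Q.flow s τ)) =
      Q.height⁻¹ * (1 - Q.contraction) * φ (Q.crossingPoint s) := fun s hs => by
    rw [← hQ.integral_along_flow hc hφ hcs hsupp hs]
    refine integral_congr_ae (ae_of_all _ fun τ => ?_)
    simp only [ENNReal.toReal_ofReal (jacobian_nonneg hκ0.le s τ), smul_eq_mul]
  have e3 := setIntegral_congr_fun measurableSet_Ioo e2 (μ := volume)
  refine (congrArg (Q.area • ·) e3).trans ?_
  rw [hrhs, integral_const_mul, area]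
  simp only [smul_eq_mul]
  field_simp

/-- The divergence of the limit field as a signed measure. -/
def divergenceMeasure (Q : Quad) : SignedMeasure Plane := -Q.cantorMeasure.toSignedMeasure

lemma toJordanDecomposition_divergenceMeasure (Q : Quad) :
    Q.divergenceMeasure.toJordanDecomposition.posPart = 0 ∧
      Q.divergenceMeasure.toJordanDecomposition.negPart = Q.cantorMeasure := by
  let j : JordanDecomposition Plane :=
    ⟨Q.cantorMeasure, 0, Measure.MutuallySingular.zero_right⟩
  have hj : j.toSignedMeasure = Q.cantorMeasure.toSignedMeasure := by
    simp [j, JordanDecomposition.toSignedMeasure]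
  have h : Q.divergenceMeasure.toJordanDecomposition = -j := by
    rw [divergenceMeasure, SignedMeasure.toJordanDecomposition_neg, ← hj,
      JordanDecomposition.toJordanDecomposition_toSignedMeasure]
  rw [h]
  exact ⟨rfl, rfl⟩

lemma totalVariation_divergenceMeasure (Q : Quad) :
    Q.divergenceMeasure.totalVariation = Q.cantorMeasure := by
  obtain ⟨h1, h2⟩ := Q.toJordanDecomposition_divergenceMeasure
  rw [SignedMeasure.totalVariation, h1, h2, zero_add]

lemma IsCell.hasDivergence (hQ : Q.IsCell) (hc : Q.Compressible) :
    HasDivergence Q.domain Q.limitField Q.divergenceMeasure where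
  bounded := hQ.memLp_limitField hc
  concentrated := by
    rw [totalVariation_divergenceMeasure, cantorMeasure_compl_domain]
  divergence φ hφ hcs hsupp := by
    obtain ⟨h1, h2⟩ := Q.toJordanDecomposition_divergenceMeasure
    rw [h1, h2, hQ.integral_divergence hc hφ hcs hsupp]
    simp

lemma IsCell.isCantorPart (hQ : Q.IsCell) (hc : Q.Compressible) :
    IsCantorPart Q.divergenceMeasure Q.divergenceMeasure := by
  have hz : (0 : SignedMeasure Plane).totalVariation = 0 := SignedMeasure.totalVariation_zero
  refine ⟨0, 0, ⟨by simp, ?_, ?_, ?_, ?_, ∅, MeasurableSet.empty, ?_, ?_⟩⟩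
  · rw [hz]; exact Measure.AbsolutelyContinuous.zero _
  · rw [zero_add, totalVariation_divergenceMeasure]
    exact hQ.mutuallySingular_cantorMeasure hc
  · intro E hE hH
    have h0 : Q.cantorMeasure E = 0 := by
      have h := measure_mono_null (inter_subset_left : E ∩ Q.domain ⊆ E)
          (hQ.crossingMeasure_eq_zero hc hH)
      rw [cantorMeasure, Measure.smul_apply, Measure.restrict_apply hE, h, smul_zero]
    rw [divergenceMeasure, neg_apply, Measure.toSignedMeasure_apply_measurable hE,
      measureReal_def, h0]
    simp
  · rw [hz]; exact Measure.AbsolutelyContinuous.zero _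
  · rw [Measure.restrict_empty]; infer_instance
  · rw [hz]; rfl

/-! ### The family of trajectories -/

/-- The images of the flow lines. -/
def trajectories (Q : Quad) : Set (Set Plane) := (fun s => Q.flow s '' Ioo 0 1) '' Ioo 0 1

lemma IsCell.pairwiseDisjoint_trajectories (hQ : Q.IsCell) (hc : Q.Compressible) :
    Q.trajectories.PairwiseDisjoint id := by
  rintro _ ⟨s, hs, rfl⟩ _ ⟨s', hs', rfl⟩ hne
  refine Set.disjoint_left.2 ?_
  rintro _ ⟨τ, _, rfl⟩ ⟨τ', _, h⟩
  obtain ⟨rfl, -⟩ := hQ.flow_inj hc hs'.1.le hs.1.le h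
  exact hne rfl

lemma IsCell.sUnion_trajectories (hQ : Q.IsCell) (hc : Q.Compressible) :
    ⋃₀ Q.trajectories = Q.domain := by
  ext x
  rw [hQ.mem_domain_iff hc]
  constructor
  · rintro ⟨_, ⟨s, hs, rfl⟩, τ, hτ, rfl⟩; exact ⟨s, hs, τ, hτ, rfl⟩
  · rintro ⟨s, hs, τ, hτ, rfl⟩; exact ⟨_, ⟨s, hs, rfl⟩, τ, hτ, rfl⟩

lemma IsCell.existsUnique_cantorSet (hQ : Q.IsCell) (hc : Q.Compressible) {s : ℝ}
    (hs : s ∈ genericParams) : ∃! x : Plane, x ∈ Q.flow s '' Ioo 0 1 ∩ Q.cantorSet := by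
  refine ⟨Q.crossingPoint s, ⟨⟨_, crossHeight_mem_Ioo hs, rfl⟩, (hQ.flow_mem_cantorSet hc hs).2
      rfl⟩, ?_⟩
  rintro _ ⟨⟨τ, _, rfl⟩, h⟩
  rw [(hQ.flow_mem_cantorSet hc hs).1 h, crossingPoint]

/-- A parametrization by the height above `AB` is unique. -/
lemma IsCell.eq_of_isCrossing (hQ : Q.IsCell) {s : ℝ} {γ : ℝ → Plane}
    (hγ : IsCrossing Q (Q.flow s '' Ioo 0 1) γ) {t : ℝ} (ht : t ∈ Ioo 0 Q.height) :
    γ t = Q.flow s (t / Q.height) := by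
  have hh := hQ.height_pos'
  have hmem : γ t ∈ Q.flow s '' Ioo 0 1 := hγ.1.image_eq ▸ mem_image_of_mem γ ht
  obtain ⟨τ, -, h⟩ := hmem
  have h1 := hγ.2 t ht
  rw [← h, hQ.flow_apply_one] at h1
  rw [← h, show t / Q.height = τ by field_simp; linarith]

/-- The density jumps at the crossing of the Cantor set. The heights allowed are those needed for
almost every point with respect to area (generic heights) and for the crossing points, where
neither inequality between `t` and `t'` can hold. -/
lemma IsCell.density_along_crossing (hQ : Q.IsCell) (hc : Q.Compressible) {s τ : ℝ}
    (hs : s ∈ genericParams) (hτ : τ ∈ genericHeights ∨ τ = crossHeight s) {γ : ℝ → Plane}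
    (hγ : IsCrossing Q (Q.flow s '' Ioo 0 1) γ) {t t' : ℝ} (ht : t ∈ Ioo 0 Q.height)
    (ht' : t' ∈ Ioo 0 Q.height) (h : γ t = Q.flow s τ) (h' : γ t' ∈ Q.cantorSet) :
    (t < t' → Q.density (Q.flow s τ) = 1) ∧ (t' < t → Q.density (Q.flow s τ) = Q.ratio) := by
  have hh := hQ.height_pos'
  rw [hQ.eq_of_isCrossing hγ ht] at h
  rw [hQ.eq_of_isCrossing hγ ht', hQ.flow_mem_cantorSet hc hs] at h'
  have e := (hQ.flow_inj hc hs.1.1.le hs.1.1.le h).2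
  rcases hτ with hτ | hτ
  · constructor
    · intro hlt
      refine hQ.density_of_lt hc hs hτ ?_
      rw [← e, ← h']; gcongr
    · intro hlt
      refine hQ.density_of_gt hc hs hτ ?_
      rw [← e, ← h']; gcongr
  · have : t = t' := by
      rw [hτ, ← h'] at e
      field_simp at e
      exact e
    exact ⟨fun hlt => absurd this hlt.ne, fun hlt => absurd this hlt.ne'⟩

end Quad

end

theorem mainTheorem10 (Q : Quad) (hQ : Q.IsCell) (hc : Q.Compressible) :
    TendstoUniformlyOn Q.approxField Q.limitField atTop (Q.domain \ Q.dyadicLines) ∧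
    ∃ F : Set (Set Plane),
      (∀ K ∈ F, ∃ γ : ℝ → Plane, IsCrossing Q K γ) ∧
      F.PairwiseDisjoint id ∧
      ⋃₀ F = Q.domain ∧
      ∃ lam lamC : SignedMeasure Plane,
        HasDivergence Q.domain Q.limitField lam ∧
        IsCantorPart lam lamC ∧
        ∀ᵐ x ∂(lamC.totalVariation + volume.restrict Q.domain),
          ∃ K ∈ F, x ∈ K ∧
            (∃! s : Plane, s ∈ K ∩ Q.cantorSet) ∧
            ∀ γ : ℝ → Plane, IsCrossing Q K γ →
              ∀ t ∈ Ioo 0 Q.height, ∀ t' ∈ Ioo 0 Q.height,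
                γ t = x → γ t' ∈ Q.cantorSet →
                  (t < t' → Q.density x = 1) ∧ (t' < t → Q.density x = Q.ratio) := by
  refine ⟨hQ.tendstoUniformlyOn_approxField hc, Q.trajectories, ?_,
    hQ.pairwiseDisjoint_trajectories hc, hQ.sUnion_trajectories hc, Q.divergenceMeasure,
    Q.divergenceMeasure, hQ.hasDivergence hc, hQ.isCantorPart hc, ?_⟩
  · rintro _ ⟨s, hs, rfl⟩
    exact ⟨Q.path s, hQ.isCrossing_path hc hs⟩
  have key : ∀ s ∈ CantorFlow.genericParams, ∀ τ ∈ Ioo (0 : ℝ) 1,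
      (τ ∈ CantorFlow.genericHeights ∨ τ = CantorFlow.crossHeight s) →
      ∃ K ∈ Q.trajectories, Q.flow s τ ∈ K ∧ (∃! s : Plane, s ∈ K ∩ Q.cantorSet) ∧
        ∀ γ : ℝ → Plane, IsCrossing Q K γ → ∀ t ∈ Ioo 0 Q.height, ∀ t' ∈ Ioo 0 Q.height,
          γ t = Q.flow s τ → γ t' ∈ Q.cantorSet →
            (t < t' → Q.density (Q.flow s τ) = 1) ∧ (t' < t → Q.density (Q.flow s τ) = Q.ratio) :=
    fun s hs τ hτ h => ⟨_, ⟨s, hs.1, rfl⟩, ⟨τ, hτ, rfl⟩, hQ.existsUnique_cantorSet hc hs,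
      fun γ hγ t ht t' ht' => hQ.density_along_crossing hc hs h hγ ht ht'⟩
  rw [Quad.totalVariation_divergenceMeasure, ae_add_measure_iff]
  constructor
  · filter_upwards [hQ.ae_cantorMeasure hc] with x hx
    obtain ⟨s, hs, rfl⟩ := hx
    exact key s hs _ (CantorFlow.crossHeight_mem_Ioo hs) (Or.inr rfl)
  · filter_upwards [hQ.ae_generic hc] with x hx
    obtain ⟨s, hs, τ, hτ, rfl⟩ := hx
    exact key s hs τ hτ.1 (Or.inl hτ)
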